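/- Let $\hat q_j\psi=q_j\psi$ and $\hat p_j\psi=-\mathrm i\,\partial\psi/\partial q_j$ ($j=1,2$) act on smooth functions $\psi:\mathbb R^2\to\mathbb C$, let $\gamma_1,\dots,\gamma_5\in\mathbb C$ be arbitrary (in particular each may be real or purely imaginary), and put $$\hat H_5=\hat p_1^2+\hat p_2^2+\sum_{k=1}^5\gamma_k(\hat q_1\hat p_1+\hat q_2\hat p_2)^k,\qquad \hat C=\hat q_1\hat p_2-\hat q_2\hat p_1 ,$$ $$\begin{aligned}\hat I_5'={}&\hat p_1^2+\gamma_1\hat q_1\hat p_1+\gamma_2(\hat q_1^2+\hat q_2^2)\hat p_1^2\\ &+\gamma_3\bigl(\hat q_1^3(\hat p_1^3-\hat p_1\hat p_2^2)+(\hat q_2^3+3\hat q_1^2\hat q_2)\hat p_1^2\hat p_2-3\mathrm i\hat q_1^2\hat p_1^2-3\mathrm i\hat q_1\hat q_2\hat p_1\hat p_2-\hat q_1\hat p_1\bigr)\\ &+\gamma_4\bigl((\hat q_1^4-\hat q_2^4)(\hat p_1^4-\hat p_1^2\hat p_2^2)+4(\hat q_1\hat q_2^3+\hat q_1^3\hat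 q_2)\hat p_1^3\hat p_2-6\mathrm i(\hat q_1^3+\hat q_1\hat q_2^2)\hat p_1^3-6\mathrm i(\hat q_2^3+\hat q_1^2\hat q_2)\hat p_1^2\hat p_2-4(\hat q_1^2+\hat q_2^2)\hat p_1^2\bigr)\\ &+\gamma_5\bigl(\hat q_1^5(\hat p_1^5+\hat p_1\hat p_2^4)-(\hat q_2^5-5\hat q_1^4\hat q_2)(\hat p_1^4\hat p_2-\hat p_1^2\hat p_2^3)-(\hat q_1^5-10\hat q_1^3\hat q_2^2-5\hat q_1\hat q_2^4)\hat p_1^3\hat p_2^2\\ &\quad-10\mathrm i\hat q_1^4(\hat p_1^4-\hat p_1^2\hat p_2^2)-10\mathrm i(\hat q_1\hat q_2^3+4\hat q_1^3\hat q_2)\hat p_1^3\hat p_2-10\mathrm i(\hat q_2^4+3\hat q_1^2\hat q_2^2)\hat p_1^2\hat p_2^2+10\mathrm i\hat q_1^3\hat q_2\hat p_1\hat p_2^3\\ &\quad-25\hat q_1^3\hat p_1^3-10(\hat q_2^3+6\hat q_1^2\hat q_2)\hat p_1^2\hat p_2+5(2\hat q_1^3-3\hat q_1\hat q_2^2)\hat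 p_1\hat p_2^2+15\mathrm i\hat q_1^2\hat p_1^2+15\mathrm i\hat q_1\hat q_2\hat p_1\hat p_2+\hat q_1\hat p_1\bigr),\end{aligned}$$ and let $\hat I_5$ be determined by $\hat H_5=\hat I_5+\hat I_5'-4\gamma_4\hat C^2+\gamma_4\hat C^4$. (1) $\hat C,\hat I_5,\hat I_5'$ commute with $\hat H_5$. The operators $\hat I_5'-\hat p_1^2$ and $\hat I_5-\hat p_2^2$ are linear combinations of monomials $\hat q_1^a\hat q_2^b\hat p_1^c\hat p_2^d$ with $a+b=c+d$ and $a+b+c+d\le 10$; $\hat I_5$ and $\hat I_5'$ have order at most $5$ in the momenta, and exactly $5$ if $\gamma_5\ne0$. Each of the sets $\{\hat H_5,\hat C,\hat I_5\}$ and $\{\hat H_5,\hat C,\hat I_5'\}$ is algebraically independent (no nonzero symmetrized polynomial in the three operators vanishes). (2) Put $\hat K_1=\hat C$, $\hat K_2=\frac12(\hat I_5'-\hat I_5)$, $\hat K_3=[\hat K_1,\hat K_2]$, $\hat K=\frac12\hat K_1$ and $\hat K_\pm=\hat K_2\pm\frac12\hat K_3-(\frac12\gamma_2-2\gamma_4)\hat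 K_1^2$. Then $[\hat K,\hat K_\pm]=\pm\hat K_\pm$, $[\hat K_-,\hat K_+]=\Phi(\hat H_5,\hat K+\mathrm{Id})-\Phi(\hat H_5,\hat K)$ and $\hat K_+\hat K_-=\Phi(\hat H_5,\hat K)=\Phi_1\Phi_2$, where $[\Phi_1,\Phi_2]=0$ and $$\Phi_1(\hat H_5,\hat K)=\tfrac14\Bigl(\hat H_5-\sum_{k=1}^5(2\mathrm i)^k\gamma_k\hat K^k\Bigr),\qquad \Phi_2(\hat H_5,\hat K)=\hat H_5-\sum_{k=1}^5(-2\mathrm i)^k\gamma_k(\hat K-\mathrm{Id})^k,$$ that is, $\Phi_1=\frac14(\hat H_5-2\mathrm i\gamma_1\hat K+4\gamma_2\hat K^2+8\mathrm i\gamma_3\hat K^3-16\gamma_4\hat K^4-32\mathrm i\gamma_5\hat K^5)$ and, with $\hat L=\hat K-\mathrm{Id}$, $\Phi_2=\hat H_5+2\mathrm i\gamma_1\hat L+4\gamma_2\hat L^2-8\mathrm i\gamma_3\hat L^3-16\gamma_4\hat L^4+32\mathrm i\gamma_5\hat L^5$. There are polynomials $c_0,\dots,c_4$ of degree at most $1$,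 with $c_4=2560\gamma_5^2$, such that $$[\hat K_-,\hat K_+]=\sum_{j=0}^4c_j(\hat H_5)\hat K^{2j+1}$$ (a ninth-order Higgs-type algebra $\mathfrak{sl}^{(9)}(2,\mathbb R)$), and $\hat K_1,\hat K_2,\hat K_3$ close on the polynomial algebra $[\hat K_1,\hat K_2]=\hat K_3$, $[\hat K_1,\hat K_3]=4\hat K_2-2(\gamma_2-4\gamma_4)\hat K_1^2$, $$[\hat K_2,\hat K_3]=\sum_{j=0}^4c_j(\hat H_5)(\tfrac12\hat K_1)^{2j+1}+4(\gamma_2-4\gamma_4)\hat K_1\hat K_2-2(\gamma_2-4\gamma_4)\hat K_3-2(\gamma_2-4\gamma_4)^2\hat K_1^3.$$ For every $u\in\mathbb C$ the operators $\hat B=\hat K-u\,\mathrm{Id}$, $\hat b_\pm=\hat K_\pm$ satisfy $[\hat B,\hat b_\pm]=\pm\hat b_\pm$, $[\hat b_-,\hat b_+]=\Phi(\hat H_5,\hat B+(u+1)\mathrm{Id})-\Phi(\hat H_5,\hat B+u\,\mathrm{Id})$ and $\hat b_+\hat b_-=\Phi(\hat H_5,\hat B+u\,\mathrm{Id})$.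 (3) For $B,E,u\in\mathbb C$ let $\Phi(B,E,u)=\frac14\bigl(E-\sum_{k=1}^5(2\mathrm i)^k\gamma_k(B+u)^k\bigr)\bigl(E-\sum_{k=1}^5(-2\mathrm i)^k\gamma_k(B+u-1)^k\bigr)$ and, for $n\in\{1,2,\dots\}$, consider the equations $$\Phi(0,E,u)=0,\qquad \Phi(n+1,E,u)=0.\qquad(*)$$ They hold if and only if the deformed oscillator algebra (the relations of $\hat B,\hat b_\pm$ above, including the one for $\hat b_+\hat b_-$) has an $(n+1)$-dimensional representation in which $\hat H_5$ acts as the scalar $E$ and $\hat B$ is diagonal with eigenvalues $0,1,\dots,n$. Two families of solutions $(u,E)$ of $(*)$ exist for all values of the coefficients: $u_{\rm I}=u_{\rm II}=-\frac n2$ with $$E_{\rm I}=\sum_{k=1}^5(-\mathrm i)^k\gamma_kn^k=-(\mathrm i\gamma_1n+\gamma_2n^2-\mathrm i\gamma_3n^3-\gamma_4n^4+\mathrm i\gamma_5n^5),$$ $$E_{\rm II}=\sum_{k=1}^5\mathrm i^k\gamma_k(n+2)^k=\mathrm i\gamma_1(n+2)-\gamma_2(n+2)^2-\mathrm i\gamma_3(n+2)^3+\gamma_4(n+2)^4+\mathrm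 i\gamma_5(n+2)^5.$$ The corresponding structure functions are, for all $B$, $$\Phi_{\rm I}=\tfrac14\Bigl(\sum_{k=1}^5(-\mathrm i)^k\gamma_k\bigl(n^k-(n-2B)^k\bigr)\Bigr)\Bigl(\sum_{k=1}^5(-\mathrm i)^k\gamma_k\bigl(n^k-(2B-n-2)^k\bigr)\Bigr),$$ $$\Phi_{\rm II}=\tfrac14\Bigl(\sum_{k=1}^5\mathrm i^k\gamma_k\bigl((n+2)^k-(2B-n)^k\bigr)\Bigr)\Bigl(\sum_{k=1}^5\mathrm i^k\gamma_k\bigl((n+2)^k-(n+2-2B)^k\bigr)\Bigr).$$ If $N\le5$ and $\gamma_k=0$ for all $k>N$, then $\hat H_5$, $E_{\rm I}$, $E_{\rm II}$ reduce to the Hamiltonian and the spectra given by the same formulas with $5$ replaced by $N$. (4) These two are the only admissible solutions. Fix $n\ge1$. (a) If $u,E:\mathbb C^5\to\mathbb C$ are continuous functions of $(\gamma_1,\dots,\gamma_5)$, then $(u,E)$ solves $(*)$ for all $\gamma\in\mathbb C^5$ if and only if $u=-\frac n2$, $E=E_{\rm I}$ identically or $u=-\frac n2$, $E=E_{\rm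 II}$ identically. (b) The same holds for real-analytic $u,E:\mathbb R^5\to\mathbb C$ and coefficients $\gamma_k=\theta_kt_k$, $t\in\mathbb R^5$, for each fixed choice of $\theta_1,\dots,\theta_5\in\{1,\mathrm i\}$. -/

import Mathlib

noncomputable section

namespace Zernike

/-- The complex vector space of smooth wave functions on the plane. -/
def SmoothFun : Submodule ℂ ((Fin 2 → ℝ) → ℂ) where
  carrier := {ψ | ContDiff ℝ (⊤ : ℕ∞) ψ}
  add_mem' := by
    intro a b ha hb
    have ha' : ContDiff ℝ (⊤ : ℕ∞) a := ha
    have hb' : ContDiff ℝ (⊤ : ℕ∞) b := hb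
    exact ha'.add hb'
  zero_mem' := by
    have h : ContDiff ℝ (⊤ : ℕ∞) (fun _ : Fin 2 → ℝ => (0 : ℂ)) := contDiff_const
    exact h
  smul_mem' := by
    intro c a ha
    have ha' : ContDiff ℝ (⊤ : ℕ∞) a := ha
    exact contDiff_const.smul ha'

theorem smoothFun_contDiff (ψ : SmoothFun) : ContDiff ℝ (⊤ : ℕ∞) ψ.1 := ψ.2

theorem smoothFun_differentiableAt (ψ : SmoothFun) (x : Fin 2 → ℝ) :
    DifferentiableAt ℝ ψ.1 x :=
  ((smoothFun_contDiff ψ).differentiable (by simp)) x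

theorem smoothFun_contDiff_pos (i : Fin 2) (ψ : SmoothFun) :
    ContDiff ℝ (⊤ : ℕ∞) (fun x : Fin 2 → ℝ => (x i : ℂ) * ψ.1 x) :=
  (Complex.ofRealCLM.contDiff.comp (contDiff_apply ℝ ℝ i)).mul (smoothFun_contDiff ψ)

theorem smoothFun_contDiff_mom (i : Fin 2) (ψ : SmoothFun) :
    ContDiff ℝ (⊤ : ℕ∞) (fun x => -Complex.I * fderiv ℝ ψ.1 x (Pi.single i 1)) :=
  contDiff_const.mul
    ((ContDiff.fderiv_right (m := (⊤ : ℕ∞)) (smoothFun_contDiff ψ) (by simp)).clm_apply contDiff_const)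

/-- The algebra of linear operators on smooth wave functions (the product is composition). -/
abbrev Op : Type := Module.End ℂ SmoothFun

/-- The position operator, multiplication by the coordinate `x i`. -/
def pos (i : Fin 2) : Op where
  toFun ψ := ⟨fun x => (x i : ℂ) * ψ.1 x, smoothFun_contDiff_pos i ψ⟩
  map_add' ψ φ := by
    ext x
    simp [mul_add]
  map_smul' c ψ := by
    ext x
    simp [mul_left_comm]

/-- The momentum operator `-i ∂/∂x_i`. -/
def mom (i : Fin 2) : Op where
  toFun ψ := ⟨fun x => -Complex.I * fderiv ℝ ψ.1 x (Pi.single i 1), smoothFun_contDiff_mom i ψ⟩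
  map_add' ψ φ := by
    ext x
    simp only [Submodule.coe_add, Pi.add_apply]
    rw [fderiv_add (smoothFun_differentiableAt ψ x) (smoothFun_differentiableAt φ x)]
    simp only [add_apply]
    ring
  map_smul' c ψ := by
    ext x
    simp only [Submodule.coe_smul, Pi.smul_apply, RingHom.id_apply]
    rw [fderiv_const_smul (smoothFun_differentiableAt ψ x)]
    simp only [smul_apply, smul_eq_mul]
    ring

/-- Abbreviations for the two positions and the two momenta. -/
abbrev q₁ : Op := pos 0
abbrev q₂ : Op := pos 1
abbrev p₁ : Op := mom 0
abbrev p₂ : Op := mom 1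

/-- The Hamiltonian `p² + ∑_{k=1}^N γ_k (q·p)^k`; the coefficient `γ_k` is `γ (k-1)`. -/
def ham {N : ℕ} (γ : Fin N → ℂ) : Op :=
  p₁ ^ 2 + p₂ ^ 2 + ∑ k : Fin N, γ k • (q₁ * p₁ + q₂ * p₂) ^ (k.val + 1)

/-- The angular momentum. -/
def angMom : Op := q₁ * p₂ - q₂ * p₁

/-- The explicit fifth-order operator `I_5'` (with `γ 0 = γ_1`, ..., `γ 4 = γ_5`). -/
def symIPrime (γ : Fin 5 → ℂ) : Op :=
  p₁ ^ 2 + γ 0 • (q₁ * p₁) + γ 1 • ((q₁ ^ 2 + q₂ ^ 2) * p₁ ^ 2)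
  + γ 2 • (q₁ ^ 3 * (p₁ ^ 3 - p₁ * p₂ ^ 2)
      + (q₂ ^ 3 + (3 : ℂ) • (q₁ ^ 2 * q₂)) * (p₁ ^ 2 * p₂)
      - (3 * Complex.I) • (q₁ ^ 2 * p₁ ^ 2)
      - (3 * Complex.I) • (q₁ * q₂ * p₁ * p₂)
      - q₁ * p₁)
  + γ 3 • ((q₁ ^ 4 - q₂ ^ 4) * (p₁ ^ 4 - p₁ ^ 2 * p₂ ^ 2)
      + (4 : ℂ) • ((q₁ * q₂ ^ 3 + q₁ ^ 3 * q₂) * (p₁ ^ 3 * p₂))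
      - (6 * Complex.I) • ((q₁ ^ 3 + q₁ * q₂ ^ 2) * p₁ ^ 3)
      - (6 * Complex.I) • ((q₂ ^ 3 + q₁ ^ 2 * q₂) * (p₁ ^ 2 * p₂))
      - (4 : ℂ) • ((q₁ ^ 2 + q₂ ^ 2) * p₁ ^ 2))
  + γ 4 • (q₁ ^ 5 * (p₁ ^ 5 + p₁ * p₂ ^ 4)
      - (q₂ ^ 5 - (5 : ℂ) • (q₁ ^ 4 * q₂)) * (p₁ ^ 4 * p₂ - p₁ ^ 2 * p₂ ^ 3)
      - (q₁ ^ 5 - (10 : ℂ) • (q₁ ^ 3 * q₂ ^ 2) - (5 : ℂ) • (q₁ * q₂ ^ 4)) * (p₁ ^ 3 * p₂ ^ 2)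
      - (10 * Complex.I) • (q₁ ^ 4 * (p₁ ^ 4 - p₁ ^ 2 * p₂ ^ 2))
      - (10 * Complex.I) • ((q₁ * q₂ ^ 3 + (4 : ℂ) • (q₁ ^ 3 * q₂)) * (p₁ ^ 3 * p₂))
      - (10 * Complex.I) • ((q₂ ^ 4 + (3 : ℂ) • (q₁ ^ 2 * q₂ ^ 2)) * (p₁ ^ 2 * p₂ ^ 2))
      + (10 * Complex.I) • (q₁ ^ 3 * q₂ * (p₁ * p₂ ^ 3))
      - (25 : ℂ) • (q₁ ^ 3 * p₁ ^ 3)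
      - (10 : ℂ) • ((q₂ ^ 3 + (6 : ℂ) • (q₁ ^ 2 * q₂)) * (p₁ ^ 2 * p₂))
      + (5 : ℂ) • (((2 : ℂ) • q₁ ^ 3 - (3 : ℂ) • (q₁ * q₂ ^ 2)) * (p₁ * p₂ ^ 2))
      + (15 * Complex.I) • (q₁ ^ 2 * p₁ ^ 2)
      + (15 * Complex.I) • (q₁ * q₂ * p₁ * p₂)
      + q₁ * p₁)

/-- The operator `I_5`, determined by `H_5 = I_5 + I_5' - 4 γ_4 C² + γ_4 C⁴`. -/
def symI (γ : Fin 5 → ℂ) : Op :=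
  ham γ - symIPrime γ + (4 * γ 3) • angMom ^ 2 - γ 3 • angMom ^ 4

/-- The span of the normally ordered monomials of total grading zero
(`q` has grading `1` and `p` has grading `-1`) and of degree at most `2 N`. -/
def gradeZero (N : ℕ) : Submodule ℂ Op :=
  Submodule.span ℂ {X | ∃ a b c d : ℕ, a + b = c + d ∧ a + b + c + d ≤ 2 * N ∧
    X = q₁ ^ a * q₂ ^ b * p₁ ^ c * p₂ ^ d}

/-- The differential operators with polynomial coefficients, of order at most `m` in the
momenta. -/
def orderLE (m : ℕ) : Submodule ℂ Op :=
  Submodule.span ℂ {X | ∃ a b c d : ℕ, c + d ≤ m ∧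
    X = q₁ ^ a * q₂ ^ b * p₁ ^ c * p₂ ^ d}

/-- The symmetrized product of a list of operators: the sum, over all rearrangements of the
list (with multiplicity), of the products. -/
def symProd {A : Type*} [Ring A] (l : List A) : A :=
  (l.permutations.map List.prod).sum

/-- Algebraic independence of three possibly noncommuting operators: no nonzero symmetrized
(Jordan) polynomial in them vanishes. -/
def AlgIndep {A : Type*} [Ring A] [Algebra ℂ A] (x y z : A) : Prop :=
  LinearIndependent ℂ (fun m : ℕ × ℕ × ℕ =>
    symProd (List.replicate m.1 x ++ List.replicate m.2.1 y ++ List.replicate m.2.2 z))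

/-- The operators `K_1`, `K_2`, `K_3`. -/
def K1 : Op := angMom
def K2 (γ : Fin 5 → ℂ) : Op := (1 / 2 : ℂ) • (symIPrime γ - symI γ)
def K3 (γ : Fin 5 → ℂ) : Op := ⁅K1, K2 γ⁆

/-- The number operator `K` and the ladder operators `K_+`, `K_-`. -/
def numK : Op := (1 / 2 : ℂ) • K1
def raiseK (γ : Fin 5 → ℂ) : Op :=
  K2 γ + (1 / 2 : ℂ) • K3 γ - (γ 1 / 2 - 2 * γ 3) • K1 ^ 2
def lowerK (γ : Fin 5 → ℂ) : Op :=
  K2 γ - (1 / 2 : ℂ) • K3 γ - (γ 1 / 2 - 2 * γ 3) • K1 ^ 2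

/-- The two factors of the structure function, evaluated at elements of any complex algebra
(operators, matrices or complex numbers). -/
def Phi1 {A : Type*} [Ring A] [Algebra ℂ A] {N : ℕ} (γ : Fin N → ℂ) (H K : A) : A :=
  (1 / 4 : ℂ) • (H - ∑ k : Fin N, ((2 * Complex.I) ^ (k.val + 1) * γ k) • K ^ (k.val + 1))
def Phi2 {A : Type*} [Ring A] [Algebra ℂ A] {N : ℕ} (γ : Fin N → ℂ) (H K : A) : A :=
  H - ∑ k : Fin N, ((-2 * Complex.I) ^ (k.val + 1) * γ k) • (K - 1) ^ (k.val + 1)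

/-- The structure function `Φ = Φ_1 Φ_2`. -/
def Phi {A : Type*} [Ring A] [Algebra ℂ A] {N : ℕ} (γ : Fin N → ℂ) (H K : A) : A :=
  Phi1 γ H K * Phi2 γ H K

/-- The two conditions `Φ(0, E, u) = 0` and `Φ(n + 1, E, u) = 0`. -/
def SpecEqs {N : ℕ} (γ : Fin N → ℂ) (n : ℕ) (u E : ℂ) : Prop :=
  Phi γ E (0 + u) = 0 ∧ Phi γ E ((n : ℂ) + 1 + u) = 0

/-- There is an `(n + 1)`-dimensional representation of the deformed oscillator algebra in
which the Hamiltonian acts as the scalar `E` and the number operator `B` is diagonal with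
eigenvalues `0, 1, ..., n`. -/
def HasOscillatorRep {N : ℕ} (γ : Fin N → ℂ) (n : ℕ) (u E : ℂ) : Prop :=
  ∃ B bm bp : Matrix (Fin (n + 1)) (Fin (n + 1)) ℂ,
    B = Matrix.diagonal (fun j => (j.val : ℂ)) ∧
    ⁅B, bp⁆ = bp ∧ ⁅B, bm⁆ = -bm ∧
    ⁅bm, bp⁆ = Phi γ (E • 1) (B + (u + 1) • 1) - Phi γ (E • 1) (B + u • 1) ∧
    bp * bm = Phi γ (E • 1) (B + u • 1)

/-- The spectra of types I and II. -/
def EI {N : ℕ} (γ : Fin N → ℂ) (n : ℕ) : ℂ :=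
  ∑ k : Fin N, (-Complex.I) ^ (k.val + 1) * γ k * (n : ℂ) ^ (k.val + 1)
def EII {N : ℕ} (γ : Fin N → ℂ) (n : ℕ) : ℂ :=
  ∑ k : Fin N, Complex.I ^ (k.val + 1) * γ k * ((n : ℂ) + 2) ^ (k.val + 1)

/-- The structure functions of types I and II. -/
def PhiI {N : ℕ} (γ : Fin N → ℂ) (n : ℕ) (B : ℂ) : ℂ :=
  (1 / 4)
    * (∑ k : Fin N, (-Complex.I) ^ (k.val + 1) * γ k
        * ((n : ℂ) ^ (k.val + 1) - ((n : ℂ) - 2 * B) ^ (k.val + 1)))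
    * (∑ k : Fin N, (-Complex.I) ^ (k.val + 1) * γ k
        * ((n : ℂ) ^ (k.val + 1) - (2 * B - (n : ℂ) - 2) ^ (k.val + 1)))
def PhiII {N : ℕ} (γ : Fin N → ℂ) (n : ℕ) (B : ℂ) : ℂ :=
  (1 / 4)
    * (∑ k : Fin N, Complex.I ^ (k.val + 1) * γ k
        * (((n : ℂ) + 2) ^ (k.val + 1) - (2 * B - (n : ℂ)) ^ (k.val + 1)))
    * (∑ k : Fin N, Complex.I ^ (k.val + 1) * γ k
        * (((n : ℂ) + 2) ^ (k.val + 1) - ((n : ℂ) + 2 - 2 * B) ^ (k.val + 1)))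

end Zernike

end

open Zernike

set_option linter.unusedSimpArgs false
set_option linter.unusedSectionVars false
noncomputable section
namespace Zernike

/-! Write f(X) = ∑ γ_k X^k, D = q₁p₁ + q₂p₂, C for the angular momentum and, for ε = ±1, P_ε = p₁ +
iεp₂, Q_ε = q₁ + iεq₂. Then P_ε P_{-ε} = p₁² + p₂² and Q_ε P_{-ε} = D - iεC, where D and C commute.
Since X - Y divides f(X) - f(Y), the Hamiltonian factors: H - f(iεC) = A_ε P_{-ε} with A_ε = P_ε +
g(D, iεC) Q_ε and g the divided difference of f (`Weyl.intertwiner_mul_mom`). In the opposite order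
P_{-ε} A_ε = H' - f(iε(C + ε)), with partner H' = p₁² + p₂² + f(D - i) (`Weyl.mom_mul_intertwiner`).
Hence P_ε intertwines H with H', A_ε leads back, and L_ε = ½ A_ε P_ε commutes with H and satisfies
[C, L_ε] = 2εL_ε. The product L_ε L_{-ε} collapses to ¼ (H - f(-iε(C - 2ε))) (H - f(iεC)), which for
ε = 1 is Φ (`Weyl.ladder_mul_ladder`). Only the canonical relations enter.

The explicit symmetry is I₅' = ½ (H + L₁ + L₋₁ + γ₂C² - γ₄C⁴) (`Weyl.symIPrime_eq`). This is checked
one γ_k at a time by normal ordering, which turns operator products into differential operators on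
commutative polynomials. It follows that K_± = L_{±1}, and the relations of part (2) are
consequences. The commutator of K_- and K_+ is odd in K because Φ(H, K + 1) = Φ(H, -K).

Normal ordering is injective, as seen on plane waves. The exact order 5 is then detected by a fifth
difference of the symbol along a ray of momenta. For algebraic independence, q has weight -4 and p
weight 5: each contraction lowers the weight by 1, and the leading symbols of H, C, I₅', I₅ are the
commuting polynomials p₁² + p₂², q₁p₂ - q₂p₁, p₁², p₂² (`Weyl.algIndep_of_hasSymbol`).

A finite-dimensional representation is a weighted shift, which closes exactly when Φ vanishes at
both ends. Each end condition says that E is one of two values of f. At a linear Hamiltonian the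
only solutions are types I and II. A continuous solution keeps its type locally as long as E_I ≠
E_II and f has nonzero derivative at the relevant point. On a complex line of coefficients only
finitely many parameters are exceptional, and their complement is connected and dense
(`type_everywhere`). For real parameters the identity theorem for analytic functions takes over
(`analytic_solutions`). -/

theorem pos_apply (i : Fin 2) (ψ : SmoothFun) (x : Fin 2 → ℝ) :
    (pos i ψ).1 x = (x i : ℂ) * ψ.1 x := rfl

theorem mom_apply (i : Fin 2) (ψ : SmoothFun) (x : Fin 2 → ℝ) :
    (mom i ψ).1 x = -Complex.I * fderiv ℝ ψ.1 x (Pi.single i 1) := rfl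

theorem op_ext {X Y : Op} (h : ∀ (ψ : SmoothFun) x, (X ψ).1 x = (Y ψ).1 x) : X = Y :=
  LinearMap.ext fun ψ => Subtype.ext (funext (h ψ))

/-! ### Canonical commutation relations on smooth functions -/

theorem pos_mul_pos_comm (i j : Fin 2) : pos i * pos j = pos j * pos i := by
  refine op_ext fun ψ x => ?_
  simp only [Module.End.mul_apply, pos_apply]
  ring

theorem mom_mul_mom_comm (i j : Fin 2) : mom i * mom j = mom j * mom i := by
  have key : ∀ (ψ : SmoothFun) (x : Fin 2 → ℝ) (i j : Fin 2),
      ((mom i * mom j) ψ).1 x =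
        -fderiv ℝ (fderiv ℝ ψ.1) x (Pi.single i 1) (Pi.single j 1) := by
    intro ψ x i j
    have hd : DifferentiableAt ℝ (fderiv ℝ ψ.1) x :=
      ((ContDiff.fderiv_right (m := (⊤ : ℕ∞)) (smoothFun_contDiff ψ) (by simp)).differentiable
        (by simp)) x
    have h2 : fderiv ℝ (mom j ψ).1 x (Pi.single i 1) =
        -Complex.I * fderiv ℝ (fderiv ℝ ψ.1) x (Pi.single i 1) (Pi.single j 1) := by
      have : (mom j ψ).1 = fun x => -Complex.I * fderiv ℝ ψ.1 x (Pi.single j 1) := rfl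
      rw [this, fderiv_const_mul (hd.clm_apply (differentiableAt_const _)),
        fderiv_clm_apply hd (differentiableAt_const _)]
      simp
    rw [Module.End.mul_apply, mom_apply, h2]
    linear_combination (fderiv ℝ (fderiv ℝ ψ.1) x (Pi.single i 1) (Pi.single j 1)) * Complex.I_sq
  refine op_ext fun ψ x => ?_
  rw [key, key]
  have : IsSymmSndFDerivAt ℝ ψ.1 x :=
    (smoothFun_contDiff ψ).contDiffAt.isSymmSndFDerivAt
      (by rw [minSmoothness_of_isRCLikeNormedField]; exact WithTop.coe_le_coe.2 (le_top : (2 : ℕ∞)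
        ≤ ⊤))
  rw [this.eq]

theorem mom_mul_pos (i j : Fin 2) :
    mom i * pos j = pos j * mom i - (if i = j then Complex.I else 0) • (1 : Op) := by
  refine op_ext fun ψ x => ?_
  have h0 : HasFDerivAt (fun x : Fin 2 → ℝ => (x j : ℂ))
      (Complex.ofRealCLM.comp (ContinuousLinearMap.proj j : (Fin 2 → ℝ) →L[ℝ] ℝ)) x :=
    (Complex.ofRealCLM.comp (ContinuousLinearMap.proj j : (Fin 2 → ℝ) →L[ℝ] ℝ)).hasFDerivAt
  have h1 : (pos j ψ).1 = fun x => (x j : ℂ) * ψ.1 x := rfl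
  have h2 : ∀ (φ χ : SmoothFun), (φ - χ).1 x = φ.1 x - χ.1 x := fun _ _ => rfl
  have h3 : ∀ (c : ℂ) (φ : SmoothFun), (c • φ).1 x = c * φ.1 x := fun _ _ => rfl
  have h4 : fderiv ℝ (fun x => (x j : ℂ) * ψ.1 x) x = _ :=
    (h0.mul (smoothFun_differentiableAt ψ x).hasFDerivAt).fderiv
  rw [LinearMap.sub_apply, h2, LinearMap.smul_apply, h3, Module.End.mul_apply,
    Module.End.mul_apply, Module.End.one_apply, mom_apply, pos_apply, mom_apply, h1, h4]
  by_cases h : i = j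
  · subst h
    simp
    ring
  · simp [h, Ne.symm h]
    ring

/-! ### Plane waves as joint eigenfunctions of the momenta -/

/-- The plane wave with complex wave vector `(k, l)`. -/
def planeWave (k l : ℂ) : SmoothFun :=
  ⟨fun x => Complex.exp (Complex.I * (k * (x 0 : ℂ) + l * (x 1 : ℂ))), by
    have h : ∀ i : Fin 2, ContDiff ℝ (⊤ : ℕ∞) (fun x : Fin 2 → ℝ => (x i : ℂ)) := fun i =>
      Complex.ofRealCLM.contDiff.comp (contDiff_apply ℝ ℝ i)
    exact (contDiff_const.mul ((contDiff_const.mul (h 0)).add (contDiff_const.mul (h 1)))).cexp⟩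

theorem planeWave_apply (k l : ℂ) (x : Fin 2 → ℝ) :
    (planeWave k l).1 x = Complex.exp (Complex.I * (k * (x 0 : ℂ) + l * (x 1 : ℂ))) := rfl

theorem mom_planeWave (i : Fin 2) (k l : ℂ) :
    mom i (planeWave k l) = (![k, l] i) • planeWave k l := by
  refine Subtype.ext (funext fun x => ?_)
  have h0 : ∀ j : Fin 2, HasFDerivAt (fun x : Fin 2 → ℝ => (x j : ℂ))
      (Complex.ofRealCLM.comp (ContinuousLinearMap.proj j : (Fin 2 → ℝ) →L[ℝ] ℝ)) x := fun j =>
    (Complex.ofRealCLM.comp (ContinuousLinearMap.proj j : (Fin 2 → ℝ) →L[ℝ] ℝ)).hasFDerivAt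
  have h1 := ((((h0 0).const_mul k).add ((h0 1).const_mul l)).const_mul Complex.I).cexp
  have h3 : (![k, l] i • planeWave k l).1 x = ![k, l] i * (planeWave k l).1 x := rfl
  have h2 : fderiv ℝ (planeWave k l).1 x = _ := h1.fderiv
  rw [mom_apply, h3, h2, planeWave_apply]
  fin_cases i
  · simp
    linear_combination (-k * Complex.exp (Complex.I * (k * (x 0 : ℂ) + l * (x 1 : ℂ)))) * Complex.I_sq
  · simp
    linear_combination (-l * Complex.exp (Complex.I * (k * (x 0 : ℂ) + l * (x 1 : ℂ)))) * Complex.I_sq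

/-! ### Normal ordering for two abstract canonical pairs -/

open MvPolynomial

/-- Two canonical pairs in a complex algebra. -/
structure Weyl (A : Type*) [Ring A] [Algebra ℂ A] where
  (q₁ q₂ p₁ p₂ : A)
  q_comm : q₂ * q₁ = q₁ * q₂
  p_comm : p₂ * p₁ = p₁ * p₂
  p₁_q₁ : p₁ * q₁ = q₁ * p₁ - Complex.I • (1 : A)
  p₂_q₂ : p₂ * q₂ = q₂ * p₂ - Complex.I • (1 : A)
  p₁_q₂ : p₁ * q₂ = q₂ * p₁
  p₂_q₁ : p₂ * q₁ = q₁ * p₂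

theorem mul_pow_of_canonical {A : Type*} [Ring A] [Algebra ℂ A] {p q : A}
    (h : p * q = q * p - Complex.I • (1 : A)) (a : ℕ) :
    p * q ^ a = q ^ a * p - (Complex.I * a) • q ^ (a - 1) := by
  induction a with
  | zero => simp
  | succ n ih =>
    rw [pow_succ, ← mul_assoc, ih, sub_mul, mul_assoc, h, mul_sub,
      ← mul_assoc, smul_mul_assoc, ← pow_succ, mul_smul_comm, mul_one, Nat.add_sub_cancel]
    rcases n with _ | n
    · simp
    · rw [Nat.add_sub_cancel, ← pow_succ, sub_sub, ← add_smul]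
      congr 2
      push_cast
      ring

namespace Weyl

variable {A : Type*} [Ring A] [Algebra ℂ A] (w : Weyl A)

/-- Normal ordering: the polynomial `x₁^a x₂^b y₁^c y₂^d` is sent to `q₁^a q₂^b p₁^c p₂^d`. -/
def normalOrder : MvPolynomial (Fin 4) ℂ →ₗ[ℂ] A :=
  (basisMonomials (Fin 4) ℂ).constr ℂ
    (fun d => w.q₁ ^ d 0 * w.q₂ ^ d 1 * w.p₁ ^ d 2 * w.p₂ ^ d 3)

theorem normalOrder_monomial (d : Fin 4 →₀ ℕ) (c : ℂ) :
    w.normalOrder (monomial d c) =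
      c • (w.q₁ ^ d 0 * w.q₂ ^ d 1 * w.p₁ ^ d 2 * w.p₂ ^ d 3) := by
  have h : monomial d c = c • basisMonomials (Fin 4) ℂ d := by
    rw [coe_basisMonomials, smul_monomial, smul_eq_mul, mul_one]
  rw [h, map_smul, normalOrder, Module.Basis.constr_basis]

theorem normalOrder_one : w.normalOrder 1 = 1 := by
  rw [← C_1, ← monomial_zero', normalOrder_monomial]
  simp

theorem q₁_mul_normalOrder (f : MvPolynomial (Fin 4) ℂ) :
    w.q₁ * w.normalOrder f = w.normalOrder (X 0 * f) := by
  induction f using MvPolynomial.induction_on' with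
  | monomial d c =>
    rw [X, monomial_mul, normalOrder_monomial, normalOrder_monomial]
    simp [pow_add, mul_assoc]
  | add f g hf hg => rw [mul_add, map_add, map_add, mul_add, hf, hg]

theorem q₂_mul_normalOrder (f : MvPolynomial (Fin 4) ℂ) :
    w.q₂ * w.normalOrder f = w.normalOrder (X 1 * f) := by
  induction f using MvPolynomial.induction_on' with
  | monomial d c =>
    rw [X, monomial_mul, normalOrder_monomial, normalOrder_monomial]
    have h : Commute w.q₂ (w.q₁ ^ d 0) := Commute.pow_right w.q_comm _
    simp [pow_add, mul_assoc]
    rw [← mul_assoc, h.eq, mul_assoc]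
  | add f g hf hg => rw [mul_add, map_add, map_add, mul_add, hf, hg]

/-- Commuting p₁ past q₁^a leaves the contraction -i a q₁^(a-1), that is, -i times the derivative in
the position variable. Left multiplication thus becomes a differential operator on commutative
symbols. -/
theorem p₁_mul_normalOrder (f : MvPolynomial (Fin 4) ℂ) :
    w.p₁ * w.normalOrder f = w.normalOrder (X 2 * f - C Complex.I * pderiv 0 f) := by
  induction f using MvPolynomial.induction_on' with
  | monomial d c =>
    rw [map_sub, pderiv_monomial, C_mul_monomial, X, monomial_mul, normalOrder_monomial,
      normalOrder_monomial, normalOrder_monomial]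
    have h : Commute w.p₁ (w.q₂ ^ d 1) := Commute.pow_right w.p₁_q₂ _
    simp [pow_add, mul_assoc]
    rw [← mul_assoc, mul_pow_of_canonical w.p₁_q₁, sub_mul, smul_sub, mul_assoc,
      ← mul_assoc w.p₁, h.eq, mul_assoc, smul_mul_assoc, smul_smul]
    congr 2
    ring
  | add f g hf hg =>
    rw [map_add, mul_add, hf, hg, ← map_add]
    congr 1
    rw [map_add]
    ring

theorem p₂_mul_normalOrder (f : MvPolynomial (Fin 4) ℂ) :
    w.p₂ * w.normalOrder f = w.normalOrder (X 3 * f - C Complex.I * pderiv 1 f) := by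
  induction f using MvPolynomial.induction_on' with
  | monomial d c =>
    rw [map_sub, pderiv_monomial, C_mul_monomial, X, monomial_mul, normalOrder_monomial,
      normalOrder_monomial, normalOrder_monomial]
    have h : Commute w.p₂ (w.q₁ ^ d 0) := Commute.pow_right w.p₂_q₁ _
    have h' : Commute w.p₂ (w.p₁ ^ d 2) := Commute.pow_right w.p_comm _
    simp [pow_add, mul_assoc]
    rw [← mul_assoc, h.eq, mul_assoc, ← mul_assoc w.p₂, mul_pow_of_canonical w.p₂_q₂, sub_mul,
      mul_sub, smul_sub, mul_assoc, ← mul_assoc w.p₂, h'.eq, mul_assoc, smul_mul_assoc,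
      mul_smul_comm, smul_smul]
    congr 2
    ring
  | add f g hf hg =>
    rw [map_add, mul_add, hf, hg, ← map_add]
    congr 1
    rw [map_add]
    ring

end Weyl

theorem mom_mul_pos_of_ne {i j : Fin 2} (h : i ≠ j) : mom i * pos j = pos j * mom i := by
  have h1 := mom_mul_pos i j
  rw [if_neg h] at h1
  have h2 : ∀ X : Op, X - (0 : ℂ) • (1 : Op) = X := fun X => by
    rw [zero_smul]
    exact sub_zero X
  rwa [h2] at h1

/-- The canonical pairs of the operators of position and momentum. -/
def weylOp : Weyl Op where
  q₁ := q₁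
  q₂ := q₂
  p₁ := p₁
  p₂ := p₂
  q_comm := pos_mul_pos_comm 1 0
  p_comm := mom_mul_mom_comm 1 0
  p₁_q₁ := mom_mul_pos 0 0
  p₂_q₂ := mom_mul_pos 1 1
  p₁_q₂ := mom_mul_pos_of_ne (by decide)
  p₂_q₁ := mom_mul_pos_of_ne (by decide)

theorem pos_pow_apply (i : Fin 2) (n : ℕ) (ψ : SmoothFun) (x : Fin 2 → ℝ) :
    ((pos i ^ n) ψ).1 x = (x i : ℂ) ^ n * ψ.1 x := by
  induction n with
  | zero => simp
  | succ n ih => rw [pow_succ', Module.End.mul_apply, pos_apply, ih]; ring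

theorem mom_pow_planeWave (i : Fin 2) (n : ℕ) (k l : ℂ) :
    (mom i ^ n) (planeWave k l) = (![k, l] i) ^ n • planeWave k l := by
  induction n with
  | zero => simp
  | succ n ih =>
    rw [pow_succ', Module.End.mul_apply, ih, map_smul, mom_planeWave, smul_smul, pow_succ]

/-- A normally ordered operator acts on plane waves by its symbol. -/
theorem normalOrder_planeWave (f : MvPolynomial (Fin 4) ℂ) (k l : ℂ) (x : Fin 2 → ℝ) :
    (weylOp.normalOrder f (planeWave k l)).1 x =
      eval ![(x 0 : ℂ), (x 1 : ℂ), k, l] f * (planeWave k l).1 x := by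
  induction f using MvPolynomial.induction_on' with
  | monomial d c =>
    have h3 : ∀ (c : ℂ) (φ : SmoothFun), (c • φ).1 x = c * φ.1 x := fun _ _ => rfl
    have h5 : weylOp.normalOrder (monomial d c) (planeWave k l) =
        c • (q₁ ^ d 0) ((q₂ ^ d 1) ((p₁ ^ d 2) ((p₂ ^ d 3) (planeWave k l)))) := by
      rw [Weyl.normalOrder_monomial]
      change (c • (q₁ ^ d 0 * q₂ ^ d 1 * p₁ ^ d 2 * p₂ ^ d 3) : Op) (planeWave k l) = _
      rfl
    rw [h5, h3, mom_pow_planeWave, map_smul, mom_pow_planeWave, smul_smul, map_smul,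
      map_smul, h3, pos_pow_apply, pos_pow_apply, eval_monomial,
      Finsupp.prod_fintype _ _ (by simp), Fin.prod_univ_four]
    simp
    ring
  | add f g hf hg =>
    have h2 : ∀ (φ χ : SmoothFun), (φ + χ).1 x = φ.1 x + χ.1 x := fun _ _ => rfl
    have h5 : weylOp.normalOrder (f + g) (planeWave k l) =
        weylOp.normalOrder f (planeWave k l) + weylOp.normalOrder g (planeWave k l) := by
      rw [map_add]
      rfl
    rw [h5, h2, hf, hg, map_add, add_mul]

/-- On the plane wave with wave vector (k, l) the operator is multiplication by its symbol at (x, k,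
l), and the exponential never vanishes. A zero operator therefore has a symbol vanishing at all real
arguments, hence a zero symbol. -/
theorem normalOrder_injective : Function.Injective weylOp.normalOrder := by
  rw [injective_iff_map_eq_zero]
  intro f hf
  refine MvPolynomial.funext_set (fun _ : Fin 4 => Set.range ((↑) : ℝ → ℂ)) (fun _ =>
    Set.infinite_range_of_injective Complex.ofReal_injective) ?_
  intro v hv
  obtain ⟨a, ha⟩ := hv 0 trivial
  obtain ⟨b, hb⟩ := hv 1 trivial
  have h := normalOrder_planeWave f (v 2) (v 3) ![a, b]
  have h4 : ![((![a, b] 0 : ℝ) : ℂ), ((![a, b] 1 : ℝ) : ℂ), v 2, v 3] = v := by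
    ext i
    fin_cases i
    · exact ha
    · exact hb
    · rfl
    · rfl
  have h5 : (planeWave (v 2) (v 3)).1 ![a, b] ≠ 0 := Complex.exp_ne_zero _
  rw [h4, hf] at h
  rw [map_zero]
  exact (mul_eq_zero.1 h.symm).resolve_right h5

/-! ### Divided differences at commuting elements -/

/-- The value of the polynomial `∑ γ_k X^k` without constant term. -/
def coeffSum {A : Type*} [Ring A] [Algebra ℂ A] {N : ℕ} (γ : Fin N → ℂ) (X : A) : A :=
  ∑ k : Fin N, γ k • X ^ (k.val + 1)

/-- The divided difference of `coeffSum γ` at two commuting elements. -/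
def divDiff {A : Type*} [Ring A] [Algebra ℂ A] {N : ℕ} (γ : Fin N → ℂ) (X Y : A) : A :=
  ∑ k : Fin N, γ k • ∑ i ∈ Finset.range (k.val + 1), X ^ i * Y ^ (k.val - i)

section
variable {A : Type*} [Ring A] [Algebra ℂ A] {N : ℕ} (γ : Fin N → ℂ)

theorem divDiff_mul_sub {X Y : A} (h : Commute X Y) :
    divDiff γ X Y * (X - Y) = coeffSum γ X - coeffSum γ Y := by
  rw [divDiff, coeffSum, coeffSum, ← Finset.sum_sub_distrib, Finset.sum_mul]
  refine Finset.sum_congr rfl fun k _ => ?_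
  rw [smul_mul_assoc, ← smul_sub, ← h.geom_sum₂_mul]
  simp only [Nat.add_sub_cancel]

theorem mul_coeffSum {a X Y : A} (h : a * X = Y * a) :
    a * coeffSum γ X = coeffSum γ Y * a := by
  have h' : SemiconjBy a X Y := h
  rw [coeffSum, coeffSum, Finset.sum_mul, Finset.mul_sum]
  refine Finset.sum_congr rfl fun k _ => ?_
  rw [smul_mul_assoc, mul_smul_comm, (h'.pow_right _).eq]

theorem mul_divDiff {a X Y X' Y' : A} (h : a * X = X' * a) (h' : a * Y = Y' * a) :
    a * divDiff γ X Y = divDiff γ X' Y' * a := by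
  have hX : SemiconjBy a X X' := h
  have hY : SemiconjBy a Y Y' := h'
  rw [divDiff, divDiff, Finset.sum_mul, Finset.mul_sum]
  refine Finset.sum_congr rfl fun k _ => ?_
  rw [smul_mul_assoc, mul_smul_comm, Finset.sum_mul, Finset.mul_sum]
  congr 1
  refine Finset.sum_congr rfl fun i _ => ?_
  exact ((hX.pow_right _).mul_right (hY.pow_right _)).eq

end

/-! ### Dilations, rotations and the complex momenta and positions -/

namespace Weyl

variable {A : Type*} [Ring A] [Algebra ℂ A] (w : Weyl A)

/-- The device behind the operator identities below: applied to the normal form of 1, both sides are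
absorbed factor by factor into symbols, and a commutative polynomial identity remains. -/
theorem eq_of_mul_normalOrder_one {X Y : A}
    (h : X * w.normalOrder 1 = Y * w.normalOrder 1) : X = Y := by
  rwa [normalOrder_one, mul_one, mul_one] at h

/-- The dilation generator, the angular momentum, and the complex combinations of the momenta and
of the positions. -/
def dil : A := w.q₁ * w.p₁ + w.q₂ * w.p₂
def ang : A := w.q₁ * w.p₂ - w.q₂ * w.p₁
def mom (ε : ℂ) : A := w.p₁ + (ε * Complex.I) • w.p₂
def pos (ε : ℂ) : A := w.q₁ + (ε * Complex.I) • w.q₂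

theorem C_I_sq : (C Complex.I : MvPolynomial (Fin 4) ℂ) ^ 2 = -1 := by
  rw [← C_pow, Complex.I_sq, C_neg, C_1]

theorem dil_mul_ang : w.dil * w.ang = w.ang * w.dil := by
  refine w.eq_of_mul_normalOrder_one ?_
  simp only [dil, ang, mul_assoc, add_mul, sub_mul, q₁_mul_normalOrder, q₂_mul_normalOrder,
    p₁_mul_normalOrder, p₂_mul_normalOrder, ← map_add, ← map_sub]
  refine congrArg _ ?_
  simp [pderiv_X]
  ring

theorem pos_mul_mom {ε : ℂ} (hε : ε ^ 2 = 1) :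
    w.pos ε * w.mom (-ε) = w.dil - (ε * Complex.I) • w.ang := by
  refine w.eq_of_mul_normalOrder_one ?_
  have h : (C ε : MvPolynomial (Fin 4) ℂ) ^ 2 = 1 := by rw [← C_pow, hε, C_1]
  simp only [dil, ang, pos, mom, mul_assoc, add_mul, sub_mul, q₁_mul_normalOrder,
    q₂_mul_normalOrder, p₁_mul_normalOrder, p₂_mul_normalOrder, smul_mul_assoc, ← map_smul,
    ← map_add, ← map_sub]
  refine congrArg _ ?_
  simp [pderiv_X, smul_eq_C_mul]
  linear_combination (X 1 * X 3) * h + (-(X 1 * X 3) * C ε ^ 2) * C_I_sq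

/-- Compared with the opposite order, each of the two canonical pairs contributes a contraction -i;
the factor -ε² i² = 1 makes them add up to -2i. -/
theorem mom_mul_pos {ε : ℂ} (hε : ε ^ 2 = 1) :
    w.mom (-ε) * w.pos ε = w.dil - (ε * Complex.I) • w.ang - (2 * Complex.I) • (1 : A) := by
  refine w.eq_of_mul_normalOrder_one ?_
  have h : (C ε : MvPolynomial (Fin 4) ℂ) ^ 2 = 1 := by rw [← C_pow, hε, C_1]
  simp only [dil, ang, pos, mom, mul_assoc, add_mul, sub_mul, q₁_mul_normalOrder, one_mul,
    q₂_mul_normalOrder, p₁_mul_normalOrder, p₂_mul_normalOrder, smul_mul_assoc, ← map_smul,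
    ← map_add, ← map_sub]
  refine congrArg _ ?_
  have h2 : (C 2 : MvPolynomial (Fin 4) ℂ) = 2 := map_ofNat C 2
  simp [pderiv_X, smul_eq_C_mul, h2]
  linear_combination (X 1 * X 3 - C Complex.I) * h +
    (-(X 1 * X 3) * C ε ^ 2 + C ε ^ 2 * C Complex.I) * C_I_sq

theorem mom_mul_mom {ε : ℂ} (hε : ε ^ 2 = 1) :
    w.mom ε * w.mom (-ε) = w.p₁ ^ 2 + w.p₂ ^ 2 := by
  refine w.eq_of_mul_normalOrder_one ?_
  have h : (C ε : MvPolynomial (Fin 4) ℂ) ^ 2 = 1 := by rw [← C_pow, hε, C_1]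
  simp only [mom, mul_assoc, add_mul, sq, p₁_mul_normalOrder, p₂_mul_normalOrder, smul_mul_assoc,
    ← map_smul, ← map_add, ← map_sub]
  refine congrArg _ ?_
  simp [pderiv_X, smul_eq_C_mul]
  linear_combination X 3 ^ 2 * h + (-(X 3 ^ 2) * C ε ^ 2) * C_I_sq

theorem mom_mul_dil (ε : ℂ) :
    w.mom ε * w.dil = (w.dil - Complex.I • (1 : A)) * w.mom ε := by
  refine w.eq_of_mul_normalOrder_one ?_
  simp only [dil, mom, mul_assoc, add_mul, sub_mul, q₁_mul_normalOrder, one_mul,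
    q₂_mul_normalOrder, p₁_mul_normalOrder, p₂_mul_normalOrder, smul_mul_assoc, ← map_smul,
    ← map_add, ← map_sub]
  refine congrArg _ ?_
  simp [pderiv_X, smul_eq_C_mul]
  ring

theorem mom_mul_ang {ε : ℂ} (hε : ε ^ 2 = 1) :
    w.mom ε * w.ang = (w.ang - ε • (1 : A)) * w.mom ε := by
  refine w.eq_of_mul_normalOrder_one ?_
  have h : (C ε : MvPolynomial (Fin 4) ℂ) ^ 2 = 1 := by rw [← C_pow, hε, C_1]
  simp only [ang, mom, mul_assoc, add_mul, sub_mul, q₁_mul_normalOrder, one_mul,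
    q₂_mul_normalOrder, p₁_mul_normalOrder, p₂_mul_normalOrder, smul_mul_assoc, ← map_smul,
    ← map_add, ← map_sub]
  refine congrArg _ ?_
  simp [pderiv_X, smul_eq_C_mul]
  linear_combination (X 3 * C Complex.I) * h + (C ε * X 2) * C_I_sq

theorem pos_mul_ang {ε : ℂ} (hε : ε ^ 2 = 1) :
    w.pos ε * w.ang = (w.ang - ε • (1 : A)) * w.pos ε := by
  refine w.eq_of_mul_normalOrder_one ?_
  have h : (C ε : MvPolynomial (Fin 4) ℂ) ^ 2 = 1 := by rw [← C_pow, hε, C_1]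
  simp only [ang, pos, mul_assoc, add_mul, sub_mul, q₁_mul_normalOrder, one_mul,
    q₂_mul_normalOrder, p₁_mul_normalOrder, p₂_mul_normalOrder, smul_mul_assoc, ← map_smul,
    ← map_add, ← map_sub]
  refine congrArg _ ?_
  simp [pderiv_X, smul_eq_C_mul]
  linear_combination (X 1 * C Complex.I) * h + (C ε * X 0) * C_I_sq

/-! ### Factorization of the Hamiltonian and ladder operators -/

section Ladder

variable {N : ℕ} (γ : Fin N → ℂ)

/-- The Hamiltonian, its partner under the intertwining by the momenta, the intertwiners in the
other direction, and the ladder operators. -/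
def ham : A := w.p₁ ^ 2 + w.p₂ ^ 2 + coeffSum γ w.dil
def partner : A := w.p₁ ^ 2 + w.p₂ ^ 2 + coeffSum γ (w.dil - Complex.I • (1 : A))
def intertwiner (ε : ℂ) : A :=
  w.mom ε + divDiff γ w.dil ((ε * Complex.I) • w.ang) * w.pos ε
def ladder (ε : ℂ) : A := (1 / 2 : ℂ) • (w.intertwiner γ ε * w.mom ε)

theorem commute_dil_smul_ang (c : ℂ) : Commute w.dil (c • w.ang) :=
  Commute.smul_right w.dil_mul_ang c

/-- The divided difference multiplied by Q_ε P_{-ε} = D - iεC telescopes to f(D) - f(iεC), while P_ε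
P_{-ε} supplies the kinetic energy. -/
theorem intertwiner_mul_mom {ε : ℂ} (hε : ε ^ 2 = 1) :
    w.intertwiner γ ε * w.mom (-ε) = w.ham γ - coeffSum γ ((ε * Complex.I) • w.ang) := by
  rw [intertwiner, ham, add_mul, mul_assoc, w.mom_mul_mom hε, w.pos_mul_mom hε,
    divDiff_mul_sub γ (w.commute_dil_smul_ang _), add_sub_assoc]

theorem mom_mul_smul_ang {ε : ℂ} (hε : ε ^ 2 = 1) (c : ℂ) :
    w.mom ε * (c • w.ang) = (c • (w.ang - ε • (1 : A))) * w.mom ε := by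
  rw [mul_smul_comm, w.mom_mul_ang hε, smul_mul_assoc]

theorem mom_comm (ε ε' : ℂ) : w.mom ε * w.mom ε' = w.mom ε' * w.mom ε := by
  simp only [mom, add_mul, mul_add, smul_mul_assoc, mul_smul_comm, w.p_comm, smul_add]
  module

/-- Moving P_{-ε} through the divided difference shifts D to D - i and C to C + ε. The contraction
-2i in P_{-ε} Q_ε is exactly what turns D - iεC into the difference (D - i) - iε(C + ε) of the
shifted arguments, so the telescoping survives. -/
theorem mom_mul_intertwiner {ε : ℂ} (hε : ε ^ 2 = 1) :
    w.mom (-ε) * w.intertwiner γ ε =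
      w.partner γ - coeffSum γ ((ε * Complex.I) • (w.ang + ε • (1 : A))) := by
  have h1 : Commute (w.dil - Complex.I • (1 : A)) ((ε * Complex.I) • (w.ang + ε • (1 : A))) := by
    refine Commute.smul_right (Commute.add_right ?_ ?_) _
    · exact Commute.sub_left w.dil_mul_ang ((Commute.one_left _).smul_left _)
    · exact (Commute.one_right _).smul_right _
  have h2 : w.dil - (ε * Complex.I) • w.ang - (2 * Complex.I) • (1 : A) =
      w.dil - Complex.I • (1 : A) - (ε * Complex.I) • (w.ang + ε • (1 : A)) := by
    have : ε * Complex.I * ε = Complex.I := by linear_combination Complex.I * hε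
    rw [smul_add, smul_smul, this]
    module
  have h3 : w.ang - (-ε) • (1 : A) = w.ang + ε • (1 : A) := by module
  rw [intertwiner, partner, mul_add, w.mom_comm, w.mom_mul_mom hε, ← mul_assoc,
    mul_divDiff γ (w.mom_mul_dil _) (w.mom_mul_smul_ang (by rw [neg_sq, hε]) _), mul_assoc,
    w.mom_mul_pos hε, h2, h3, divDiff_mul_sub γ h1, add_sub_assoc]

theorem mom_mul_ham (ε : ℂ) : w.mom ε * w.ham γ = w.partner γ * w.mom ε := by
  have h : w.mom ε * (w.p₁ ^ 2 + w.p₂ ^ 2) = (w.p₁ ^ 2 + w.p₂ ^ 2) * w.mom ε := by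
    rw [← w.mom_mul_mom (one_pow 2), mul_assoc, w.mom_comm (-1) ε, ← mul_assoc, ← mul_assoc,
      w.mom_comm 1 ε]
  rw [ham, partner, mul_add, add_mul, h, mul_coeffSum γ (w.mom_mul_dil ε)]

theorem intertwiner_mul_ang {ε : ℂ} (hε : ε ^ 2 = 1) :
    w.intertwiner γ ε * w.ang = (w.ang - ε • (1 : A)) * w.intertwiner γ ε := by
  have h : ∀ X : A, X * w.ang = w.ang * X →
      X * (w.ang - ε • (1 : A)) = (w.ang - ε • (1 : A)) * X := by
    intro X hX
    rw [mul_sub, sub_mul, hX, mul_smul_comm, smul_mul_assoc, mul_one, one_mul]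
  rw [intertwiner, add_mul, mul_add, w.mom_mul_ang hε, mul_assoc, w.pos_mul_ang hε, ← mul_assoc,
    ← mul_assoc, h]
  refine (mul_divDiff γ ?_ ?_).symm
  · exact w.dil_mul_ang.symm
  · exact ((Commute.refl w.ang).smul_right _).eq

/-- The partner is replaced by P_{-ε} A_ε + f(iε(C + ε)). Then A_ε P_{-ε} A_ε is regrouped, and A_ε
carries f(iε(C + ε)) to f(iεC). -/
theorem intertwiner_mul_partner {ε : ℂ} (hε : ε ^ 2 = 1) :
    w.intertwiner γ ε * w.partner γ = w.ham γ * w.intertwiner γ ε := by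
  have h : w.intertwiner γ ε * ((ε * Complex.I) • (w.ang + ε • (1 : A))) =
      ((ε * Complex.I) • w.ang) * w.intertwiner γ ε := by
    rw [mul_smul_comm, mul_add, w.intertwiner_mul_ang γ hε, smul_mul_assoc, sub_mul,
      mul_smul_comm, smul_mul_assoc, mul_one, one_mul, sub_add_cancel]
  have h1 := w.mom_mul_intertwiner γ hε
  have h2 := w.intertwiner_mul_mom γ hε
  rw [eq_sub_iff_add_eq] at h1 h2
  rw [← h1, ← h2, mul_add, add_mul, mul_coeffSum γ h, mul_assoc]

theorem ladder_mul_ham {ε : ℂ} (hε : ε ^ 2 = 1) :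
    w.ladder γ ε * w.ham γ = w.ham γ * w.ladder γ ε := by
  rw [ladder, smul_mul_assoc, mul_assoc, w.mom_mul_ham, ← mul_assoc, w.intertwiner_mul_partner γ hε,
    mul_assoc, mul_smul_comm]

theorem ang_mul_ladder {ε : ℂ} (hε : ε ^ 2 = 1) :
    w.ang * w.ladder γ ε = w.ladder γ ε * w.ang + (2 * ε) • w.ladder γ ε := by
  have h : w.ladder γ ε * w.ang =
      (w.ang - ε • (1 : A) - ε • (1 : A)) * w.ladder γ ε := by
    rw [ladder, smul_mul_assoc, mul_assoc, w.mom_mul_ang hε, ← mul_assoc, mul_sub,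
      w.intertwiner_mul_ang γ hε, mul_smul_comm, mul_one, mul_smul_comm, ← smul_mul_assoc]
    simp only [sub_mul, smul_mul_assoc, one_mul, mul_assoc, mul_smul_comm]
  rw [h, sub_mul, sub_mul, smul_mul_assoc, one_mul]
  module

theorem ang_mul_ham : w.ang * w.ham γ = w.ham γ * w.ang := by
  have h : w.ang * (w.p₁ ^ 2 + w.p₂ ^ 2) = (w.p₁ ^ 2 + w.p₂ ^ 2) * w.ang := by
    rw [← w.mom_mul_mom (one_pow 2), mul_assoc (w.mom 1), w.mom_mul_ang (by norm_num),
      ← mul_assoc (w.mom 1), mul_sub, w.mom_mul_ang (by norm_num)]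
    simp only [sub_mul, smul_mul_assoc, one_mul, mul_one, mul_assoc, mul_smul_comm]
    module
  rw [ham, mul_add, add_mul, h, mul_coeffSum γ w.dil_mul_ang.symm]

/-- In A_ε (P_ε A_{-ε}) P_{-ε} the inner product is H' minus a function of C. Moving A_ε to the
right through it restores H and shifts C once more, leaving the outer product A_ε P_{-ε}, which is
again a factorization of H. -/
theorem ladder_mul_ladder {ε : ℂ} (hε : ε ^ 2 = 1) :
    w.ladder γ ε * w.ladder γ (-ε) = (1 / 4 : ℂ) •
      ((w.ham γ - coeffSum γ ((-(ε * Complex.I)) • (w.ang - (2 * ε) • (1 : A)))) *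
        (w.ham γ - coeffSum γ ((ε * Complex.I) • w.ang))) := by
  have hε' : (-ε) ^ 2 = 1 := by rw [neg_sq, hε]
  have h := w.mom_mul_intertwiner γ hε'
  rw [neg_neg] at h
  have h2 : w.intertwiner γ ε * ((-ε * Complex.I) • (w.ang + (-ε) • (1 : A))) =
      ((-(ε * Complex.I)) • (w.ang - (2 * ε) • (1 : A))) * w.intertwiner γ ε := by
    rw [mul_smul_comm, mul_add, w.intertwiner_mul_ang γ hε, smul_mul_assoc, sub_mul, sub_mul,
      mul_smul_comm, smul_mul_assoc, smul_mul_assoc, mul_one, one_mul]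
    module
  rw [ladder, ladder, smul_mul_smul_comm, mul_assoc, ← mul_assoc (w.mom ε), h, ← mul_assoc,
    mul_sub, w.intertwiner_mul_partner γ hε, mul_coeffSum γ h2, ← sub_mul, mul_assoc,
    w.intertwiner_mul_mom γ hε]
  norm_num

end Ladder

end Weyl

/-! ### Normal forms of powers of D and C -/

namespace Weyl

variable {A : Type*} [Ring A] [Algebra ℂ A] (w : Weyl A)

/-- The symbols of the dilation generator, of the scaled angular momentum, and of the product
`pos ε * mom ε`. -/
def dilSym : MvPolynomial (Fin 4) ℂ := X 0 * X 2 + X 1 * X 3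
def angSym (ε : ℂ) : MvPolynomial (Fin 4) ℂ := C ε * C Complex.I * (X 0 * X 3 - X 1 * X 2)
def momSym (ε : ℂ) : MvPolynomial (Fin 4) ℂ :=
  X 0 * X 2 - X 1 * X 3 + C ε * C Complex.I * (X 0 * X 3 + X 1 * X 2)

/-- The derivations by which the dilations and the rotations act on symbols. -/
def eulerD : Derivation ℂ (MvPolynomial (Fin 4) ℂ) (MvPolynomial (Fin 4) ℂ) :=
  (X 0 : MvPolynomial (Fin 4) ℂ) • pderiv 0 + (X 1 : MvPolynomial (Fin 4) ℂ) • pderiv 1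
def rotD (ε : ℂ) : Derivation ℂ (MvPolynomial (Fin 4) ℂ) (MvPolynomial (Fin 4) ℂ) :=
  (C ε : MvPolynomial (Fin 4) ℂ) • ((X 0 : MvPolynomial (Fin 4) ℂ) • pderiv 1
    - (X 1 : MvPolynomial (Fin 4) ℂ) • pderiv 0)

theorem eulerD_apply (f : MvPolynomial (Fin 4) ℂ) :
    eulerD f = X 0 * pderiv 0 f + X 1 * pderiv 1 f := rfl

theorem rotD_apply (ε : ℂ) (f : MvPolynomial (Fin 4) ℂ) :
    rotD ε f = C ε * (X 0 * pderiv 1 f - X 1 * pderiv 0 f) := rfl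

theorem derivation_ofNat (D : Derivation ℂ (MvPolynomial (Fin 4) ℂ) (MvPolynomial (Fin 4) ℂ))
    (n : ℕ) [n.AtLeastTwo] : D (no_index (OfNat.ofNat n : MvPolynomial (Fin 4) ℂ)) = 0 :=
  D.map_natCast n

theorem C_sq_eq_one {ε : ℂ} (hε : ε ^ 2 = 1) : (C ε : MvPolynomial (Fin 4) ℂ) ^ 2 = 1 := by
  rw [← C_pow, hε, C_1]

theorem eulerD_dilSym : eulerD dilSym = dilSym := by
  rw [eulerD_apply, dilSym]
  simp [pderiv_X]

theorem eulerD_angSym (ε : ℂ) : eulerD (angSym ε) = angSym ε := by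
  rw [eulerD_apply, angSym]
  simp [pderiv_X]
  ring

theorem eulerD_momSym (ε : ℂ) : eulerD (momSym ε) = momSym ε := by
  rw [eulerD_apply, momSym]
  simp [pderiv_X]
  ring

theorem rotD_dilSym (ε : ℂ) : rotD ε dilSym = -C Complex.I * angSym ε := by
  rw [rotD_apply, dilSym, angSym]
  simp [pderiv_X]
  linear_combination (C ε * (X 0 * X 3 - X 1 * X 2)) * C_I_sq

theorem rotD_angSym {ε : ℂ} (hε : ε ^ 2 = 1) : rotD ε (angSym ε) = -C Complex.I * dilSym := by
  rw [rotD_apply, dilSym, angSym]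
  simp [pderiv_X]
  linear_combination (-C Complex.I * (X 0 * X 2 + X 1 * X 3)) * C_sq_eq_one hε

theorem rotD_momSym {ε : ℂ} (hε : ε ^ 2 = 1) : rotD ε (momSym ε) = C Complex.I * momSym ε := by
  rw [rotD_apply, momSym]
  simp [pderiv_X]
  linear_combination (C Complex.I * (X 0 * X 2 - X 1 * X 3)) * C_sq_eq_one hε -
    C ε * (X 0 * X 3 + X 1 * X 2) * C_I_sq

/-- On symbols D acts as multiplication by `dilSym` minus i times the Euler field in the positions.
The three basic symbols have degree one in the positions, so the Euler field fixes each of them;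
every expansion below stays in the polynomial ring they generate. -/
theorem dil_mul_of_eq {Y : A} {f : MvPolynomial (Fin 4) ℂ} (h : Y = w.normalOrder f) :
    w.dil * Y = w.normalOrder (dilSym * f - C Complex.I * eulerD f) := by
  rw [h, dil, eulerD_apply, dilSym]
  simp only [mul_assoc, add_mul, q₁_mul_normalOrder, q₂_mul_normalOrder,
    p₁_mul_normalOrder, p₂_mul_normalOrder, ← map_add]
  refine congrArg _ ?_
  ring

/-- The corresponding rule for iεC has the rotation field in place of the Euler field. That field
exchanges `dilSym` and `angSym` up to -i and has `momSym` as an eigenvector with eigenvalue i. -/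
theorem smul_ang_mul_of_eq {ε : ℂ} {Y : A} {f : MvPolynomial (Fin 4) ℂ}
    (h : Y = w.normalOrder f) :
    ((ε * Complex.I) • w.ang) * Y = w.normalOrder (angSym ε * f + rotD ε f) := by
  rw [h, ang, rotD_apply, angSym]
  simp only [mul_assoc, sub_mul, q₁_mul_normalOrder, q₂_mul_normalOrder,
    p₁_mul_normalOrder, p₂_mul_normalOrder, ← map_sub, smul_mul_assoc, ← map_smul]
  refine congrArg _ ?_
  rw [smul_eq_C_mul, C_mul]
  linear_combination (-C ε * (X 0 * pderiv 1 f - X 1 * pderiv 0 f)) * C_I_sq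

theorem pos_mul_mom_self {ε : ℂ} (hε : ε ^ 2 = 1) :
    w.pos ε * w.mom ε = w.normalOrder (momSym ε) := by
  have h : w.pos ε * w.mom ε * w.normalOrder 1 = w.normalOrder (momSym ε) := by
    simp only [pos, mom, mul_assoc, add_mul, q₁_mul_normalOrder, q₂_mul_normalOrder,
      p₁_mul_normalOrder, p₂_mul_normalOrder, smul_mul_assoc, ← map_smul, ← map_add]
    refine congrArg _ ?_
    rw [momSym]
    simp [pderiv_X, smul_eq_C_mul]
    linear_combination (-X 1 * X 3) * C_sq_eq_one hε + (X 1 * X 3 * C ε ^ 2) * C_I_sq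
  rwa [normalOrder_one, mul_one] at h

theorem q₁_pow_mul_normalOrder (n : ℕ) (f : MvPolynomial (Fin 4) ℂ) :
    w.q₁ ^ n * w.normalOrder f = w.normalOrder (X 0 ^ n * f) := by
  induction n with
  | zero => simp
  | succ n ih => rw [pow_succ', mul_assoc, ih, q₁_mul_normalOrder, pow_succ', mul_assoc]

theorem q₂_pow_mul_normalOrder (n : ℕ) (f : MvPolynomial (Fin 4) ℂ) :
    w.q₂ ^ n * w.normalOrder f = w.normalOrder (X 1 ^ n * f) := by
  induction n with
  | zero => simp
  | succ n ih => rw [pow_succ', mul_assoc, ih, q₂_mul_normalOrder, pow_succ', mul_assoc]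

theorem p₁_pow_mul_normalOrder (n : ℕ) {f : MvPolynomial (Fin 4) ℂ} (h : pderiv 0 f = 0) :
    w.p₁ ^ n * w.normalOrder f = w.normalOrder (X 2 ^ n * f) := by
  induction n with
  | zero => simp
  | succ n ih =>
    have h' : pderiv 0 (X 2 ^ n * f) = 0 := by simp [h, pderiv_X]
    rw [pow_succ', mul_assoc, ih, p₁_mul_normalOrder, pow_succ', mul_assoc, h', mul_zero, sub_zero]

theorem p₂_pow_mul_normalOrder (n : ℕ) {f : MvPolynomial (Fin 4) ℂ} (h : pderiv 1 f = 0) :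
    w.p₂ ^ n * w.normalOrder f = w.normalOrder (X 3 ^ n * f) := by
  induction n with
  | zero => simp
  | succ n ih =>
    have h' : pderiv 1 (X 3 ^ n * f) = 0 := by simp [h, pderiv_X]
    rw [pow_succ', mul_assoc, ih, p₂_mul_normalOrder, pow_succ', mul_assoc, h', mul_zero, sub_zero]

/-- Horner's scheme: each divided difference of a power comes from the preceding one by a single
multiplication on the left, so no commutativity is needed. -/
theorem geomSum_succ (X Y : A) (n : ℕ) :
    ∑ i ∈ Finset.range (n + 1), X ^ i * Y ^ (n - i) =
      X * ∑ i ∈ Finset.range n, X ^ i * Y ^ (n - 1 - i) + Y ^ n := by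
  rw [Finset.sum_range_succ', Finset.mul_sum]
  congr 1
  · refine Finset.sum_congr rfl fun i _ => ?_
    rw [pow_succ', mul_assoc, Nat.sub_sub, add_comm 1 i]
  · simp

theorem p₁_mul_normalOrder_of_pderiv {f : MvPolynomial (Fin 4) ℂ} (h : pderiv 0 f = 0) :
    w.p₁ * w.normalOrder f = w.normalOrder (X 2 * f) := by
  rw [p₁_mul_normalOrder, h, mul_zero, sub_zero]

theorem p₂_mul_normalOrder_of_pderiv {f : MvPolynomial (Fin 4) ℂ} (h : pderiv 1 f = 0) :
    w.p₂ * w.normalOrder f = w.normalOrder (X 3 * f) := by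
  rw [p₂_mul_normalOrder, h, mul_zero, sub_zero]

theorem eq_normalOrder_of_mul {Y : A} {f : MvPolynomial (Fin 4) ℂ}
    (h : Y * w.normalOrder 1 = w.normalOrder f) : Y = w.normalOrder f := by
  rwa [normalOrder_one, mul_one] at h

theorem pderiv_mom :
    pderiv (0 : Fin 4) (X 2 : MvPolynomial (Fin 4) ℂ) = 0 ∧
    pderiv (0 : Fin 4) (X 3 : MvPolynomial (Fin 4) ℂ) = 0 ∧
    pderiv (1 : Fin 4) (X 2 : MvPolynomial (Fin 4) ℂ) = 0 ∧
    pderiv (1 : Fin 4) (X 3 : MvPolynomial (Fin 4) ℂ) = 0 := by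
  refine ⟨?_, ?_, ?_, ?_⟩ <;> exact pderiv_X_of_ne (by decide)

theorem dil_pow_1 : w.dil ^ 1 = w.normalOrder (dilSym) := by
  rw [pow_succ', w.dil_mul_of_eq ((pow_zero _).trans w.normalOrder_one.symm)]
  refine congrArg _ ?_
  simp only [eulerD_dilSym, eulerD_angSym, eulerD_momSym, Derivation.leibniz,
    Derivation.leibniz_pow, Derivation.map_one_eq_zero, map_add, map_sub, map_neg, derivation_C,
    derivation_ofNat, smul_eq_mul, nsmul_eq_mul, Nat.cast_ofNat, Nat.add_one_sub_one, Nat.reduceSub,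
    pow_one]
  ring

theorem dil_pow_2 : w.dil ^ 2 = w.normalOrder (dilSym ^ 2 - dilSym * C Complex.I) := by
  rw [pow_succ', w.dil_mul_of_eq w.dil_pow_1]
  refine congrArg _ ?_
  simp only [eulerD_dilSym, eulerD_angSym, eulerD_momSym, Derivation.leibniz,
    Derivation.leibniz_pow, Derivation.map_one_eq_zero, map_add, map_sub, map_neg, derivation_C,
    derivation_ofNat, smul_eq_mul, nsmul_eq_mul, Nat.cast_ofNat, Nat.add_one_sub_one, Nat.reduceSub,
    pow_one]
  ring

theorem dil_pow_3 : w.dil ^ 3 = w.normalOrder (dilSym ^ 3 - 3 * dilSym ^ 2 * C Complex.I - dilSym)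
  := by
  rw [pow_succ', w.dil_mul_of_eq w.dil_pow_2]
  refine congrArg _ ?_
  simp only [eulerD_dilSym, eulerD_angSym, eulerD_momSym, Derivation.leibniz,
    Derivation.leibniz_pow, Derivation.map_one_eq_zero, map_add, map_sub, map_neg, derivation_C,
    derivation_ofNat, smul_eq_mul, nsmul_eq_mul, Nat.cast_ofNat, Nat.add_one_sub_one, Nat.reduceSub,
    pow_one]
  linear_combination (dilSym) * C_I_sq

theorem dil_pow_4 : w.dil ^ 4 = w.normalOrder (dilSym ^ 4 - 6 * dilSym ^ 3 * C Complex.I - 7 *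
  dilSym ^ 2 + dilSym * C Complex.I) := by
  rw [pow_succ', w.dil_mul_of_eq w.dil_pow_3]
  refine congrArg _ ?_
  simp only [eulerD_dilSym, eulerD_angSym, eulerD_momSym, Derivation.leibniz,
    Derivation.leibniz_pow, Derivation.map_one_eq_zero, map_add, map_sub, map_neg, derivation_C,
    derivation_ofNat, smul_eq_mul, nsmul_eq_mul, Nat.cast_ofNat, Nat.add_one_sub_one, Nat.reduceSub,
    pow_one]
  linear_combination (6 * dilSym ^ 2) * C_I_sq

theorem dil_pow_5 : w.dil ^ 5 = w.normalOrder (dilSym ^ 5 - 10 * dilSym ^ 4 * C Complex.I - 25 *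
  dilSym ^ 3 + 15 * dilSym ^ 2 * C Complex.I + dilSym) := by
  rw [pow_succ', w.dil_mul_of_eq w.dil_pow_4]
  refine congrArg _ ?_
  simp only [eulerD_dilSym, eulerD_angSym, eulerD_momSym, Derivation.leibniz,
    Derivation.leibniz_pow, Derivation.map_one_eq_zero, map_add, map_sub, map_neg, derivation_C,
    derivation_ofNat, smul_eq_mul, nsmul_eq_mul, Nat.cast_ofNat, Nat.add_one_sub_one, Nat.reduceSub,
    pow_one]
  linear_combination (18 * dilSym ^ 3 - dilSym) * C_I_sq

theorem smul_ang_pow_1 (ε : ℂ) : ((ε * Complex.I) • w.ang) ^ 1 =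
    w.normalOrder ((angSym ε)) := by
  rw [pow_succ', w.smul_ang_mul_of_eq ((pow_zero _).trans w.normalOrder_one.symm)]
  refine congrArg _ ?_
  simp only [rotD_dilSym, Derivation.leibniz, Derivation.leibniz_pow, Derivation.map_one_eq_zero,
    map_add, map_sub, map_neg, derivation_C, derivation_ofNat, smul_eq_mul, nsmul_eq_mul,
    Nat.cast_ofNat, Nat.add_one_sub_one, Nat.reduceSub, pow_one]
  ring

theorem smul_ang_pow_2 {ε : ℂ} (hε : ε ^ 2 = 1) : ((ε * Complex.I) • w.ang) ^ 2 =
    w.normalOrder (-dilSym * C Complex.I + (angSym ε) ^ 2) := by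
  rw [pow_succ', w.smul_ang_mul_of_eq (w.smul_ang_pow_1 ε)]
  refine congrArg _ ?_
  simp only [rotD_dilSym, rotD_angSym hε, rotD_momSym hε, Derivation.leibniz,
    Derivation.leibniz_pow, Derivation.map_one_eq_zero, map_add, map_sub, map_neg, derivation_C,
    derivation_ofNat, smul_eq_mul, nsmul_eq_mul, Nat.cast_ofNat, Nat.add_one_sub_one, Nat.reduceSub,
    pow_one]
  ring

theorem smul_ang_pow_3 {ε : ℂ} (hε : ε ^ 2 = 1) : ((ε * Complex.I) • w.ang) ^ 3 =
    w.normalOrder (-3 * dilSym * (angSym ε) * C Complex.I + (angSym ε) ^ 3 - (angSym ε)) := by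
  rw [pow_succ', w.smul_ang_mul_of_eq (w.smul_ang_pow_2 hε)]
  refine congrArg _ ?_
  simp only [rotD_dilSym, rotD_angSym hε, rotD_momSym hε, Derivation.leibniz,
    Derivation.leibniz_pow, Derivation.map_one_eq_zero, map_add, map_sub, map_neg, derivation_C,
    derivation_ofNat, smul_eq_mul, nsmul_eq_mul, Nat.cast_ofNat, Nat.add_one_sub_one, Nat.reduceSub,
    pow_one]
  linear_combination ((angSym ε)) * C_I_sq

theorem smul_ang_pow_4 {ε : ℂ} (hε : ε ^ 2 = 1) : ((ε * Complex.I) • w.ang) ^ 4 =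
    w.normalOrder (-3 * dilSym ^ 2 - 6 * dilSym * (angSym ε) ^ 2 * C Complex.I + dilSym * C
      Complex.I + (angSym ε) ^ 4 - 4 * (angSym ε) ^ 2) := by
  rw [pow_succ', w.smul_ang_mul_of_eq (w.smul_ang_pow_3 hε)]
  refine congrArg _ ?_
  simp only [rotD_dilSym, rotD_angSym hε, rotD_momSym hε, Derivation.leibniz,
    Derivation.leibniz_pow, Derivation.map_one_eq_zero, map_add, map_sub, map_neg, derivation_C,
    derivation_ofNat, smul_eq_mul, nsmul_eq_mul, Nat.cast_ofNat, Nat.add_one_sub_one, Nat.reduceSub,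
    pow_one]
  linear_combination (3 * dilSym ^ 2 + 3 * (angSym ε) ^ 2) * C_I_sq

theorem smul_ang_pow_1_mul {ε : ℂ} (hε : ε ^ 2 = 1) :
    ((ε * Complex.I) • w.ang) ^ 1 * (w.pos ε * w.mom ε) =
      w.normalOrder ((angSym ε) * (momSym ε) + (momSym ε) * C Complex.I) := by
  rw [pow_succ', mul_assoc, w.smul_ang_mul_of_eq ((congrArg (· * _) (pow_zero _)).trans ((one_mul
    _).trans (w.pos_mul_mom_self hε)))]
  refine congrArg _ ?_
  simp only [rotD_dilSym, rotD_angSym hε, rotD_momSym hε, Derivation.leibniz,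
    Derivation.leibniz_pow, Derivation.map_one_eq_zero, map_add, map_sub, map_neg, derivation_C,
    derivation_ofNat, smul_eq_mul, nsmul_eq_mul, Nat.cast_ofNat, Nat.add_one_sub_one, Nat.reduceSub,
    pow_one]
  ring

theorem smul_ang_pow_2_mul {ε : ℂ} (hε : ε ^ 2 = 1) :
    ((ε * Complex.I) • w.ang) ^ 2 * (w.pos ε * w.mom ε) =
      w.normalOrder (-dilSym * (momSym ε) * C Complex.I + (angSym ε) ^ 2 * (momSym ε) + 2 *
        (angSym ε) * (momSym ε) * C Complex.I - (momSym ε)) := by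
  rw [pow_succ', mul_assoc, w.smul_ang_mul_of_eq (w.smul_ang_pow_1_mul hε)]
  refine congrArg _ ?_
  simp only [rotD_dilSym, rotD_angSym hε, rotD_momSym hε, Derivation.leibniz,
    Derivation.leibniz_pow, Derivation.map_one_eq_zero, map_add, map_sub, map_neg, derivation_C,
    derivation_ofNat, smul_eq_mul, nsmul_eq_mul, Nat.cast_ofNat, Nat.add_one_sub_one, Nat.reduceSub,
    pow_one]
  linear_combination ((momSym ε)) * C_I_sq

theorem smul_ang_pow_3_mul {ε : ℂ} (hε : ε ^ 2 = 1) :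
    ((ε * Complex.I) • w.ang) ^ 3 * (w.pos ε * w.mom ε) =
      w.normalOrder (-3 * dilSym * (angSym ε) * (momSym ε) * C Complex.I + 3 * dilSym * (momSym ε)
        + (angSym ε) ^ 3 * (momSym ε) + 3 * (angSym ε) ^ 2 * (momSym ε) * C Complex.I - 4 * (angSym
        ε) * (momSym ε) - (momSym ε) * C Complex.I) := by
  rw [pow_succ', mul_assoc, w.smul_ang_mul_of_eq (w.smul_ang_pow_2_mul hε)]
  refine congrArg _ ?_
  simp only [rotD_dilSym, rotD_angSym hε, rotD_momSym hε, Derivation.leibniz,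
    Derivation.leibniz_pow, Derivation.map_one_eq_zero, map_add, map_sub, map_neg, derivation_C,
    derivation_ofNat, smul_eq_mul, nsmul_eq_mul, Nat.cast_ofNat, Nat.add_one_sub_one, Nat.reduceSub,
    pow_one]
  linear_combination (-3 * dilSym * (momSym ε) + 3 * (angSym ε) * (momSym ε)) * C_I_sq

theorem smul_ang_pow_4_mul {ε : ℂ} (hε : ε ^ 2 = 1) :
    ((ε * Complex.I) • w.ang) ^ 4 * (w.pos ε * w.mom ε) =
      w.normalOrder (-3 * dilSym ^ 2 * (momSym ε) - 6 * dilSym * (angSym ε) ^ 2 * (momSym ε) * C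
        Complex.I + 12 * dilSym * (angSym ε) * (momSym ε) + 7 * dilSym * (momSym ε) * C Complex.I +
        (angSym ε) ^ 4 * (momSym ε) + 4 * (angSym ε) ^ 3 * (momSym ε) * C Complex.I - 10 * (angSym
        ε) ^ 2 * (momSym ε) - 8 * (angSym ε) * (momSym ε) * C Complex.I + (momSym ε)) := by
  rw [pow_succ', mul_assoc, w.smul_ang_mul_of_eq (w.smul_ang_pow_3_mul hε)]
  refine congrArg _ ?_
  simp only [rotD_dilSym, rotD_angSym hε, rotD_momSym hε, Derivation.leibniz,
    Derivation.leibniz_pow, Derivation.map_one_eq_zero, map_add, map_sub, map_neg, derivation_C,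
    derivation_ofNat, smul_eq_mul, nsmul_eq_mul, Nat.cast_ofNat, Nat.add_one_sub_one, Nat.reduceSub,
    pow_one]
  linear_combination (3 * dilSym ^ 2 * (momSym ε) - 9 * dilSym * (angSym ε) * (momSym ε) + 6 * (angSym ε) ^ 2 * (momSym ε) - (momSym ε)) * C_I_sq

theorem geomSum_1 {ε : ℂ} (hε : ε ^ 2 = 1) :
    (∑ i ∈ Finset.range 1, w.dil ^ i * ((ε * Complex.I) • w.ang) ^ (0 - i)) *
      (w.pos ε * w.mom ε) = w.normalOrder (momSym ε) := by
  rw [Finset.sum_range_one, pow_zero, pow_zero, one_mul, one_mul, w.pos_mul_mom_self hε]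

/-- The case ε = 1 of (iεC)², where the factor i² accounts for the sign. -/
theorem ang_pow_2 : w.ang ^ 2 =
    w.normalOrder (-(-dilSym * C Complex.I + (angSym 1) ^ 2)) := by
  have h := w.smul_ang_pow_2 (one_pow 2)
  rw [smul_pow, one_mul, Complex.I_sq, neg_one_smul, neg_eq_iff_eq_neg] at h
  rw [h, map_neg]

theorem ang_pow_4 : w.ang ^ 4 =
    w.normalOrder ((-3 * dilSym ^ 2 - 6 * dilSym * (angSym 1) ^ 2 * C Complex.I + dilSym * C
      Complex.I + (angSym 1) ^ 4 - 4 * (angSym 1) ^ 2)) := by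
  have h := w.smul_ang_pow_4 (one_pow 2)
  rw [smul_pow, one_mul, Complex.I_pow_four, one_smul] at h
  rw [h]

theorem geomSum_2 {ε : ℂ} (hε : ε ^ 2 = 1) :
    (∑ i ∈ Finset.range 2, w.dil ^ i * ((ε * Complex.I) • w.ang) ^ (1 - i)) *
      (w.pos ε * w.mom ε) = w.normalOrder (dilSym * (momSym ε) + (angSym ε) * (momSym ε)) := by
  refine (congrArg (· * (w.pos ε * w.mom ε))
    (geomSum_succ w.dil ((ε * Complex.I) • w.ang) 1)).trans ?_
  rw [add_mul, mul_assoc, w.dil_mul_of_eq (w.geomSum_1 hε),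
    w.smul_ang_pow_1_mul hε, ← map_add]
  refine congrArg _ ?_
  simp only [eulerD_dilSym, eulerD_angSym, eulerD_momSym, Derivation.leibniz,
    Derivation.leibniz_pow, Derivation.map_one_eq_zero, map_add, map_sub, map_neg, derivation_C,
    derivation_ofNat, smul_eq_mul, nsmul_eq_mul, Nat.cast_ofNat, Nat.add_one_sub_one, Nat.reduceSub,
    pow_one]
  ring

theorem geomSum_3 {ε : ℂ} (hε : ε ^ 2 = 1) :
    (∑ i ∈ Finset.range 3, w.dil ^ i * ((ε * Complex.I) • w.ang) ^ (2 - i)) *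
      (w.pos ε * w.mom ε) = w.normalOrder (dilSym ^ 2 * (momSym ε) + dilSym * (angSym ε) * (momSym
        ε) - 3 * dilSym * (momSym ε) * C Complex.I + (angSym ε) ^ 2 * (momSym ε) - (momSym ε)) := by
  refine (congrArg (· * (w.pos ε * w.mom ε))
    (geomSum_succ w.dil ((ε * Complex.I) • w.ang) 2)).trans ?_
  rw [add_mul, mul_assoc, w.dil_mul_of_eq (w.geomSum_2 hε),
    w.smul_ang_pow_2_mul hε, ← map_add]
  refine congrArg _ ?_
  simp only [eulerD_dilSym, eulerD_angSym, eulerD_momSym, Derivation.leibniz,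
    Derivation.leibniz_pow, Derivation.map_one_eq_zero, map_add, map_sub, map_neg, derivation_C,
    derivation_ofNat, smul_eq_mul, nsmul_eq_mul, Nat.cast_ofNat, Nat.add_one_sub_one, Nat.reduceSub,
    pow_one]
  ring

theorem geomSum_4 {ε : ℂ} (hε : ε ^ 2 = 1) :
    (∑ i ∈ Finset.range 4, w.dil ^ i * ((ε * Complex.I) • w.ang) ^ (3 - i)) *
      (w.pos ε * w.mom ε) = w.normalOrder (dilSym ^ 3 * (momSym ε) + dilSym ^ 2 * (angSym ε) *
        (momSym ε) - 6 * dilSym ^ 2 * (momSym ε) * C Complex.I + dilSym * (angSym ε) ^ 2 * (momSym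
        ε) - 6 * dilSym * (angSym ε) * (momSym ε) * C Complex.I - 4 * dilSym * (momSym ε) + (angSym
        ε) ^ 3 * (momSym ε) - 4 * (angSym ε) * (momSym ε)) := by
  refine (congrArg (· * (w.pos ε * w.mom ε))
    (geomSum_succ w.dil ((ε * Complex.I) • w.ang) 3)).trans ?_
  rw [add_mul, mul_assoc, w.dil_mul_of_eq (w.geomSum_3 hε),
    w.smul_ang_pow_3_mul hε, ← map_add]
  refine congrArg _ ?_
  simp only [eulerD_dilSym, eulerD_angSym, eulerD_momSym, Derivation.leibniz,
    Derivation.leibniz_pow, Derivation.map_one_eq_zero, map_add, map_sub, map_neg, derivation_C,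
    derivation_ofNat, smul_eq_mul, nsmul_eq_mul, Nat.cast_ofNat, Nat.add_one_sub_one, Nat.reduceSub,
    pow_one]
  linear_combination (6 * dilSym * (momSym ε)) * C_I_sq

theorem geomSum_5 {ε : ℂ} (hε : ε ^ 2 = 1) :
    (∑ i ∈ Finset.range 5, w.dil ^ i * ((ε * Complex.I) • w.ang) ^ (4 - i)) *
      (w.pos ε * w.mom ε) = w.normalOrder (dilSym ^ 4 * (momSym ε) + dilSym ^ 3 * (angSym ε) *
        (momSym ε) - 10 * dilSym ^ 3 * (momSym ε) * C Complex.I + dilSym ^ 2 * (angSym ε) ^ 2 *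
        (momSym ε) - 10 * dilSym ^ 2 * (angSym ε) * (momSym ε) * C Complex.I - 25 * dilSym ^ 2 *
        (momSym ε) + dilSym * (angSym ε) ^ 3 * (momSym ε) - 10 * dilSym * (angSym ε) ^ 2 * (momSym
        ε) * C Complex.I - 10 * dilSym * (angSym ε) * (momSym ε) + 15 * dilSym * (momSym ε) * C
        Complex.I + (angSym ε) ^ 4 * (momSym ε) - 10 * (angSym ε) ^ 2 * (momSym ε) + (momSym ε)) :=
        by
  refine (congrArg (· * (w.pos ε * w.mom ε))
    (geomSum_succ w.dil ((ε * Complex.I) • w.ang) 4)).trans ?_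
  rw [add_mul, mul_assoc, w.dil_mul_of_eq (w.geomSum_4 hε),
    w.smul_ang_pow_4_mul hε, ← map_add]
  refine congrArg _ ?_
  simp only [eulerD_dilSym, eulerD_angSym, eulerD_momSym, Derivation.leibniz,
    Derivation.leibniz_pow, Derivation.map_one_eq_zero, map_add, map_sub, map_neg, derivation_C,
    derivation_ofNat, smul_eq_mul, nsmul_eq_mul, Nat.cast_ofNat, Nat.add_one_sub_one, Nat.reduceSub,
    pow_one]
  linear_combination (18 * dilSym ^ 2 * (momSym ε) + 18 * dilSym * (angSym ε) * (momSym ε)) * C_I_sq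

/-- This and the next four identities compare the coefficients of γ_k in I₅' = ½ (H + L₁ + L₋₁ +
γ₂C² - γ₄C⁴), multiplied by 4. The Hamiltonian gives 2D^k and each L_ε gives the divided difference
of X^k times Q_ε P_ε. The corrections ±2C^k occur only for k = 2 and k = 4. -/
theorem symIPrime_coeff_1 :
    (4 : ℂ) • (w.q₁ * w.p₁) =
      (2 : ℂ) • w.dil ^ 1
        + (∑ i ∈ Finset.range 1, w.dil ^ i *
            (((1 : ℂ) * Complex.I) • w.ang) ^ (0 - i)) * (w.pos 1 * w.mom 1)
        + (∑ i ∈ Finset.range 1, w.dil ^ i *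
            (((-1 : ℂ) * Complex.I) • w.ang) ^ (0 - i)) * (w.pos (-1) * w.mom (-1)) := by
  rw [w.geomSum_1 (one_pow 2), w.geomSum_1 (by norm_num), w.dil_pow_1]
  simp only [← map_add, ← map_sub, ← map_smul]
  refine w.eq_normalOrder_of_mul ?_
  simp only [mul_assoc, add_mul, sub_mul, smul_mul_assoc, q₁_mul_normalOrder,
    q₂_mul_normalOrder, q₁_pow_mul_normalOrder, q₂_pow_mul_normalOrder,
    p₁_mul_normalOrder_of_pderiv, p₂_mul_normalOrder_of_pderiv, p₁_pow_mul_normalOrder,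
    p₂_pow_mul_normalOrder, pderiv_mom, pderiv_one, pderiv_mul, pderiv_pow, mul_zero, zero_mul,
    add_zero, ← map_add w.normalOrder, ← map_sub w.normalOrder, ← map_smul w.normalOrder]
  refine congrArg _ ?_
  simp only [dilSym, angSym, momSym, smul_eq_C_mul, C_mul, C_neg, C_1, map_ofNat]
  linear_combination (0) * C_I_sq

theorem symIPrime_coeff_2 :
    (4 : ℂ) • (((w.q₁ ^ 2 + w.q₂ ^ 2) * w.p₁ ^ 2)) =
      (2 : ℂ) • w.dil ^ 2
        + (∑ i ∈ Finset.range 2, w.dil ^ i *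
            (((1 : ℂ) * Complex.I) • w.ang) ^ (1 - i)) * (w.pos 1 * w.mom 1)
        + (∑ i ∈ Finset.range 2, w.dil ^ i *
            (((-1 : ℂ) * Complex.I) • w.ang) ^ (1 - i)) * (w.pos (-1) * w.mom (-1)) + (2 : ℂ) • w.ang ^ 2 := by
  rw [w.geomSum_2 (one_pow 2), w.geomSum_2 (by norm_num), w.dil_pow_2, w.ang_pow_2]
  simp only [← map_add, ← map_sub, ← map_smul]
  refine w.eq_normalOrder_of_mul ?_
  simp only [mul_assoc, add_mul, sub_mul, smul_mul_assoc, q₁_mul_normalOrder,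
    q₂_mul_normalOrder, q₁_pow_mul_normalOrder, q₂_pow_mul_normalOrder,
    p₁_mul_normalOrder_of_pderiv, p₂_mul_normalOrder_of_pderiv, p₁_pow_mul_normalOrder,
    p₂_pow_mul_normalOrder, pderiv_mom, pderiv_one, pderiv_mul, pderiv_pow, mul_zero, zero_mul,
    add_zero, ← map_add w.normalOrder, ← map_sub w.normalOrder, ← map_smul w.normalOrder]
  refine congrArg _ ?_
  simp only [dilSym, angSym, momSym, smul_eq_C_mul, C_mul, C_neg, C_1, map_ofNat]
  -- The symbols agree modulo i² = -1; the coefficient is the quotient of their difference by i² +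
  -- 1.
  linear_combination (2 * (X 0 * X 3 - X 1 * X 2) ^ 2 - 2 * (X 0 * X 3 - X 1 * X 2) * (X 0 * X 3 + X 1 * X 2)) * C_I_sq

theorem symIPrime_coeff_3 :
    (4 : ℂ) • ((w.q₁ ^ 3 * (w.p₁ ^ 3 - w.p₁ * w.p₂ ^ 2)
      + (w.q₂ ^ 3 + (3 : ℂ) • (w.q₁ ^ 2 * w.q₂)) * (w.p₁ ^ 2 * w.p₂)
      - (3 * Complex.I) • (w.q₁ ^ 2 * w.p₁ ^ 2)
      - (3 * Complex.I) • (w.q₁ * w.q₂ * w.p₁ * w.p₂)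
      - w.q₁ * w.p₁)) =
      (2 : ℂ) • w.dil ^ 3
        + (∑ i ∈ Finset.range 3, w.dil ^ i *
            (((1 : ℂ) * Complex.I) • w.ang) ^ (2 - i)) * (w.pos 1 * w.mom 1)
        + (∑ i ∈ Finset.range 3, w.dil ^ i *
            (((-1 : ℂ) * Complex.I) • w.ang) ^ (2 - i)) * (w.pos (-1) * w.mom (-1)) := by
  rw [w.geomSum_3 (one_pow 2), w.geomSum_3 (by norm_num), w.dil_pow_3]
  simp only [← map_add, ← map_sub, ← map_smul]
  refine w.eq_normalOrder_of_mul ?_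
  simp only [mul_assoc, add_mul, sub_mul, smul_mul_assoc, q₁_mul_normalOrder,
    q₂_mul_normalOrder, q₁_pow_mul_normalOrder, q₂_pow_mul_normalOrder,
    p₁_mul_normalOrder_of_pderiv, p₂_mul_normalOrder_of_pderiv, p₁_pow_mul_normalOrder,
    p₂_pow_mul_normalOrder, pderiv_mom, pderiv_one, pderiv_mul, pderiv_pow, mul_zero, zero_mul,
    add_zero, ← map_add w.normalOrder, ← map_sub w.normalOrder, ← map_smul w.normalOrder]
  refine congrArg _ ?_
  simp only [dilSym, angSym, momSym, smul_eq_C_mul, C_mul, C_neg, C_1, map_ofNat]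
  linear_combination (-2 * (X 0 * X 2 + X 1 * X 3) * (X 0 * X 3 - X 1 * X 2) * (X 0 * X 3 + X 1 * X 2) - 2 * (X 0 * X 3 - X 1 * X 2) ^ 2 * (X 0 * X 2 - X 1 * X 3)) * C_I_sq

theorem symIPrime_coeff_4 :
    (4 : ℂ) • (((w.q₁ ^ 4 - w.q₂ ^ 4) * (w.p₁ ^ 4 - w.p₁ ^ 2 * w.p₂ ^ 2)
      + (4 : ℂ) • ((w.q₁ * w.q₂ ^ 3 + w.q₁ ^ 3 * w.q₂) * (w.p₁ ^ 3 * w.p₂))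
      - (6 * Complex.I) • ((w.q₁ ^ 3 + w.q₁ * w.q₂ ^ 2) * w.p₁ ^ 3)
      - (6 * Complex.I) • ((w.q₂ ^ 3 + w.q₁ ^ 2 * w.q₂) * (w.p₁ ^ 2 * w.p₂))
      - (4 : ℂ) • ((w.q₁ ^ 2 + w.q₂ ^ 2) * w.p₁ ^ 2))) =
      (2 : ℂ) • w.dil ^ 4
        + (∑ i ∈ Finset.range 4, w.dil ^ i *
            (((1 : ℂ) * Complex.I) • w.ang) ^ (3 - i)) * (w.pos 1 * w.mom 1)
        + (∑ i ∈ Finset.range 4, w.dil ^ i *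
            (((-1 : ℂ) * Complex.I) • w.ang) ^ (3 - i)) * (w.pos (-1) * w.mom (-1)) - (2 : ℂ) • w.ang ^ 4 := by
  rw [w.geomSum_4 (one_pow 2), w.geomSum_4 (by norm_num), w.dil_pow_4, w.ang_pow_4]
  simp only [← map_add, ← map_sub, ← map_smul]
  refine w.eq_normalOrder_of_mul ?_
  simp only [mul_assoc, add_mul, sub_mul, smul_mul_assoc, q₁_mul_normalOrder,
    q₂_mul_normalOrder, q₁_pow_mul_normalOrder, q₂_pow_mul_normalOrder,
    p₁_mul_normalOrder_of_pderiv, p₂_mul_normalOrder_of_pderiv, p₁_pow_mul_normalOrder,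
    p₂_pow_mul_normalOrder, pderiv_mom, pderiv_one, pderiv_mul, pderiv_pow, mul_zero, zero_mul,
    add_zero, ← map_add w.normalOrder, ← map_sub w.normalOrder, ← map_smul w.normalOrder]
  refine congrArg _ ?_
  simp only [dilSym, angSym, momSym, smul_eq_C_mul, C_mul, C_neg, C_1, map_ofNat]
  linear_combination (-2 * (X 0 * X 2 + X 1 * X 3) ^ 2 * (X 0 * X 3 - X 1 * X 2) * (X 0 * X 3 + X 1 * X 2) - 2 * (X 0 * X 2 + X 1 * X 3) * (X 0 * X 3 - X 1 * X 2) ^ 2 * (X 0 * X 2 - X 1 * X 3) - 12 * (X 0 * X 2 + X 1 * X 3) * (X 0 * X 3 - X 1 * X 2) ^ 2 * C Complex.I + 12 * (X 0 * X 2 + X 1 * X 3) * (X 0 * X 3 - X 1 * X 2) * (X 0 * X 3 + X 1 * X 2) * C Complex.I + 2 * (X 0 * X 3 - X 1 * X 2) ^ 4 * C Complex.I ^ 2 - 2 * (X 0 * X 3 - X 1 * X 2) ^ 4 - 2 * (X 0 * X 3 - X 1 * X 2) ^ 3 * (X 0 * X 3 + X 1 * X 2) * C Complex.I ^ 2 +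 2 * (X 0 * X 3 - X 1 * X 2) ^ 3 * (X 0 * X 3 + X 1 * X 2) - 8 * (X 0 * X 3 - X 1 * X 2) ^ 2 + 8 * (X 0 * X 3 - X 1 * X 2) * (X 0 * X 3 + X 1 * X 2)) * C_I_sq

theorem symIPrime_coeff_5 :
    (4 : ℂ) • ((w.q₁ ^ 5 * (w.p₁ ^ 5 + w.p₁ * w.p₂ ^ 4)
      - (w.q₂ ^ 5 - (5 : ℂ) • (w.q₁ ^ 4 * w.q₂)) * (w.p₁ ^ 4 * w.p₂ - w.p₁ ^ 2 * w.p₂ ^ 3)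
      - (w.q₁ ^ 5 - (10 : ℂ) • (w.q₁ ^ 3 * w.q₂ ^ 2) - (5 : ℂ) • (w.q₁ * w.q₂ ^ 4)) * (w.p₁ ^ 3 * w.p₂ ^ 2)
      - (10 * Complex.I) • (w.q₁ ^ 4 * (w.p₁ ^ 4 - w.p₁ ^ 2 * w.p₂ ^ 2))
      - (10 * Complex.I) • ((w.q₁ * w.q₂ ^ 3 + (4 : ℂ) • (w.q₁ ^ 3 * w.q₂)) * (w.p₁ ^ 3 * w.p₂))
      - (10 * Complex.I) • ((w.q₂ ^ 4 + (3 : ℂ) • (w.q₁ ^ 2 * w.q₂ ^ 2)) * (w.p₁ ^ 2 * w.p₂ ^ 2))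
      + (10 * Complex.I) • (w.q₁ ^ 3 * w.q₂ * (w.p₁ * w.p₂ ^ 3))
      - (25 : ℂ) • (w.q₁ ^ 3 * w.p₁ ^ 3)
      - (10 : ℂ) • ((w.q₂ ^ 3 + (6 : ℂ) • (w.q₁ ^ 2 * w.q₂)) * (w.p₁ ^ 2 * w.p₂))
      + (5 : ℂ) • (((2 : ℂ) • w.q₁ ^ 3 - (3 : ℂ) • (w.q₁ * w.q₂ ^ 2)) * (w.p₁ * w.p₂ ^ 2))
      + (15 * Complex.I) • (w.q₁ ^ 2 * w.p₁ ^ 2)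
      + (15 * Complex.I) • (w.q₁ * w.q₂ * w.p₁ * w.p₂)
      + w.q₁ * w.p₁)) =
      (2 : ℂ) • w.dil ^ 5
        + (∑ i ∈ Finset.range 5, w.dil ^ i *
            (((1 : ℂ) * Complex.I) • w.ang) ^ (4 - i)) * (w.pos 1 * w.mom 1)
        + (∑ i ∈ Finset.range 5, w.dil ^ i *
            (((-1 : ℂ) * Complex.I) • w.ang) ^ (4 - i)) * (w.pos (-1) * w.mom (-1)) := by
  rw [w.geomSum_5 (one_pow 2), w.geomSum_5 (by norm_num), w.dil_pow_5]
  simp only [← map_add, ← map_sub, ← map_smul]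
  refine w.eq_normalOrder_of_mul ?_
  simp only [mul_assoc, add_mul, sub_mul, smul_mul_assoc, q₁_mul_normalOrder,
    q₂_mul_normalOrder, q₁_pow_mul_normalOrder, q₂_pow_mul_normalOrder,
    p₁_mul_normalOrder_of_pderiv, p₂_mul_normalOrder_of_pderiv, p₁_pow_mul_normalOrder,
    p₂_pow_mul_normalOrder, pderiv_mom, pderiv_one, pderiv_mul, pderiv_pow, mul_zero, zero_mul,
    add_zero, ← map_add w.normalOrder, ← map_sub w.normalOrder, ← map_smul w.normalOrder]
  refine congrArg _ ?_
  simp only [dilSym, angSym, momSym, smul_eq_C_mul, C_mul, C_neg, C_1, map_ofNat]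
  linear_combination (-2 * (X 0 * X 2 + X 1 * X 3) ^ 3 * (X 0 * X 3 - X 1 * X 2) * (X 0 * X 3 + X 1 * X 2) - 2 * (X 0 * X 2 + X 1 * X 3) ^ 2 * (X 0 * X 3 - X 1 * X 2) ^ 2 * (X 0 * X 2 - X 1 * X 3) + 20 * (X 0 * X 2 + X 1 * X 3) ^ 2 * (X 0 * X 3 - X 1 * X 2) * (X 0 * X 3 + X 1 * X 2) * C Complex.I - 2 * (X 0 * X 2 + X 1 * X 3) * (X 0 * X 3 - X 1 * X 2) ^ 3 * (X 0 * X 3 + X 1 * X 2) * C Complex.I ^ 2 + 2 * (X 0 * X 2 + X 1 * X 3) * (X 0 * X 3 - X 1 * X 2) ^ 3 * (X 0 * X 3 + X 1 * X 2) + 20 * (X 0 * X 2 + X 1 * X 3) * (X 0 * X 3 - X 1 * X 2) ^ 2 * (X 0 * X 2 - X 1 * X 3) * C Complex.I + 20 * (X 0 * X 2 + X 1 * X 3) * (X 0 * X 3 - X 1 * X 2) * (X 0 * X 3 + X 1 * X 2) - 2 * (X 0 * X 3 - X 1 * X 2) ^ 4 * (X 0 * X 2 - X 1 * X 3) * C Complex.I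 ^ 2 + 2 * (X 0 * X 3 - X 1 * X 2) ^ 4 * (X 0 * X 2 - X 1 * X 3) + 20 * (X 0 * X 3 - X 1 * X 2) ^ 2 * (X 0 * X 2 - X 1 * X 3)) * C_I_sq


/-! ### The fifth-order symmetries in terms of the ladder operators -/

variable {A : Type*} [Ring A] [Algebra ℂ A] (w : Weyl A)

/-- The explicit fifth-order symmetry. -/
def symIPrime (γ : Fin 5 → ℂ) : A :=
  w.p₁ ^ 2 + γ 0 • (w.q₁ * w.p₁) + γ 1 • ((w.q₁ ^ 2 + w.q₂ ^ 2) * w.p₁ ^ 2)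
  + γ 2 • (w.q₁ ^ 3 * (w.p₁ ^ 3 - w.p₁ * w.p₂ ^ 2)
      + (w.q₂ ^ 3 + (3 : ℂ) • (w.q₁ ^ 2 * w.q₂)) * (w.p₁ ^ 2 * w.p₂)
      - (3 * Complex.I) • (w.q₁ ^ 2 * w.p₁ ^ 2)
      - (3 * Complex.I) • (w.q₁ * w.q₂ * w.p₁ * w.p₂)
      - w.q₁ * w.p₁)
  + γ 3 • ((w.q₁ ^ 4 - w.q₂ ^ 4) * (w.p₁ ^ 4 - w.p₁ ^ 2 * w.p₂ ^ 2)
      + (4 : ℂ) • ((w.q₁ * w.q₂ ^ 3 + w.q₁ ^ 3 * w.q₂) * (w.p₁ ^ 3 * w.p₂))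
      - (6 * Complex.I) • ((w.q₁ ^ 3 + w.q₁ * w.q₂ ^ 2) * w.p₁ ^ 3)
      - (6 * Complex.I) • ((w.q₂ ^ 3 + w.q₁ ^ 2 * w.q₂) * (w.p₁ ^ 2 * w.p₂))
      - (4 : ℂ) • ((w.q₁ ^ 2 + w.q₂ ^ 2) * w.p₁ ^ 2))
  + γ 4 • (w.q₁ ^ 5 * (w.p₁ ^ 5 + w.p₁ * w.p₂ ^ 4)
      - (w.q₂ ^ 5 - (5 : ℂ) • (w.q₁ ^ 4 * w.q₂)) * (w.p₁ ^ 4 * w.p₂ - w.p₁ ^ 2 * w.p₂ ^ 3)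
      - (w.q₁ ^ 5 - (10 : ℂ) • (w.q₁ ^ 3 * w.q₂ ^ 2) - (5 : ℂ) • (w.q₁ * w.q₂ ^ 4)) * (w.p₁ ^ 3 * w.p₂ ^ 2)
      - (10 * Complex.I) • (w.q₁ ^ 4 * (w.p₁ ^ 4 - w.p₁ ^ 2 * w.p₂ ^ 2))
      - (10 * Complex.I) • ((w.q₁ * w.q₂ ^ 3 + (4 : ℂ) • (w.q₁ ^ 3 * w.q₂)) * (w.p₁ ^ 3 * w.p₂))
      - (10 * Complex.I) • ((w.q₂ ^ 4 + (3 : ℂ) • (w.q₁ ^ 2 * w.q₂ ^ 2)) * (w.p₁ ^ 2 * w.p₂ ^ 2))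
      + (10 * Complex.I) • (w.q₁ ^ 3 * w.q₂ * (w.p₁ * w.p₂ ^ 3))
      - (25 : ℂ) • (w.q₁ ^ 3 * w.p₁ ^ 3)
      - (10 : ℂ) • ((w.q₂ ^ 3 + (6 : ℂ) • (w.q₁ ^ 2 * w.q₂)) * (w.p₁ ^ 2 * w.p₂))
      + (5 : ℂ) • (((2 : ℂ) • w.q₁ ^ 3 - (3 : ℂ) • (w.q₁ * w.q₂ ^ 2)) * (w.p₁ * w.p₂ ^ 2))
      + (15 * Complex.I) • (w.q₁ ^ 2 * w.p₁ ^ 2)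
      + (15 * Complex.I) • (w.q₁ * w.q₂ * w.p₁ * w.p₂)
      + w.q₁ * w.p₁)

theorem mom_mul_mom_add :
    w.mom 1 * w.mom 1 + w.mom (-1) * w.mom (-1) = (2 : ℂ) • w.p₁ ^ 2 - (2 : ℂ) • w.p₂ ^ 2 := by
  have h : (Complex.I * Complex.I) = -1 := Complex.I_mul_I
  simp only [mom, add_mul, mul_add, smul_mul_assoc, mul_smul_comm, w.p_comm, smul_add, smul_smul,
    one_mul, neg_mul, mul_neg, neg_neg, h, sq]
  module

theorem symIPrime_eq (γ : Fin 5 → ℂ) :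
    w.symIPrime γ = (1 / 2 : ℂ) • (w.ham γ + w.ladder γ 1 + w.ladder γ (-1)
      + γ 1 • w.ang ^ 2 - γ 3 • w.ang ^ 4) := by
  have key : ∀ {X Y : A}, (4 : ℂ) • X = Y → X = (1 / 4 : ℂ) • Y := by
    intro X Y h
    rw [← h, smul_smul]
    norm_num
  have h0 := w.mom_mul_mom_add
  rw [symIPrime, key w.symIPrime_coeff_5, key w.symIPrime_coeff_4, key w.symIPrime_coeff_3,
    key w.symIPrime_coeff_2, key w.symIPrime_coeff_1, ladder, ladder, intertwiner, intertwiner,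
    add_mul, add_mul, mul_assoc, mul_assoc, divDiff, divDiff, ham, coeffSum]
  simp only [Fin.sum_univ_five, add_mul, smul_mul_assoc]
  simp only [Fin.isValue, Fin.coe_ofNat_eq_mod, Nat.zero_mod, Nat.one_mod, Nat.reduceMod,
    Nat.reduceAdd, zero_add]
  rw [← sub_eq_zero] at h0 ⊢
  -- Only the quadratic momentum terms are left: p₁² = ½ (p₁² + p₂²) + ¼ (P₁² + P₋₁²), which
  -- explains the factor ¼ on the identity for P₁² + P₋₁².
  refine Eq.trans ?_ ((congrArg ((-1 / 4 : ℂ) • ·) h0).trans (smul_zero _))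
  module

/-- The complementary symmetry, and the operators `K₂` and `K₃`. -/
def symI (γ : Fin 5 → ℂ) : A :=
  w.ham γ - w.symIPrime γ + (4 * γ 3) • w.ang ^ 2 - γ 3 • w.ang ^ 4
def K2 (γ : Fin 5 → ℂ) : A := (1 / 2 : ℂ) • (w.symIPrime γ - w.symI γ)
def K3 (γ : Fin 5 → ℂ) : A := ⁅w.ang, w.K2 γ⁆

theorem lie_ang_ladder (γ : Fin 5 → ℂ) {ε : ℂ} (hε : ε ^ 2 = 1) :
    ⁅w.ang, w.ladder γ ε⁆ = (2 * ε) • w.ladder γ ε := by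
  rw [Ring.lie_def, w.ang_mul_ladder γ hε, add_sub_cancel_left]

theorem symI_eq (γ : Fin 5 → ℂ) :
    w.symI γ = (1 / 2 : ℂ) • (w.ham γ - w.ladder γ 1 - w.ladder γ (-1)
      + (8 * γ 3 - γ 1) • w.ang ^ 2 - γ 3 • w.ang ^ 4) := by
  rw [symI, symIPrime_eq]
  module

theorem K2_eq (γ : Fin 5 → ℂ) :
    w.K2 γ = (1 / 2 : ℂ) • (w.ladder γ 1 + w.ladder γ (-1))
      + (γ 1 / 2 - 2 * γ 3) • w.ang ^ 2 := by
  rw [K2, symI_eq, symIPrime_eq]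
  module

/-- L₁ and L₋₁ are eigenvectors of the adjoint action of C with eigenvalues 2 and -2, and C² drops
out; K₂ and K₃ are thus half the sum, up to C², and the difference of the ladder operators. -/
theorem K3_eq (γ : Fin 5 → ℂ) : w.K3 γ = w.ladder γ 1 - w.ladder γ (-1) := by
  rw [K3, K2_eq, Ring.lie_def, mul_add, add_mul, mul_smul_comm, smul_mul_assoc, mul_add, add_mul,
    w.ang_mul_ladder γ (one_pow 2), w.ang_mul_ladder γ (by norm_num), mul_smul_comm,
    smul_mul_assoc, ← pow_succ, ← pow_succ']
  module

theorem lie_ang_K3 (γ : Fin 5 → ℂ) :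
    ⁅w.ang, w.K3 γ⁆ = (4 : ℂ) • w.K2 γ - (2 * (γ 1 - 4 * γ 3)) • w.ang ^ 2 := by
  rw [K3_eq, Ring.lie_def, mul_sub, sub_mul, w.ang_mul_ladder γ (one_pow 2),
    w.ang_mul_ladder γ (by norm_num), K2_eq]
  module

theorem raise_eq (γ : Fin 5 → ℂ) :
    w.K2 γ + (1 / 2 : ℂ) • w.K3 γ - (γ 1 / 2 - 2 * γ 3) • w.ang ^ 2 = w.ladder γ 1 := by
  rw [K3_eq, K2_eq]
  module

theorem lower_eq (γ : Fin 5 → ℂ) :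
    w.K2 γ - (1 / 2 : ℂ) • w.K3 γ - (γ 1 / 2 - 2 * γ 3) • w.ang ^ 2 = w.ladder γ (-1) := by
  rw [K3_eq, K2_eq]
  module

/-- With K₂ = ½ (L₁ + L₋₁) + κC², κ = γ₂/2 - 2γ₄, the first part contributes the ladder commutator
and the second κ[C², K₃]. The latter is reduced through [C, K₃] and reordered by K₂C = CK₂ - K₃, the
source of the term linear in K₃. -/
theorem lie_K2_K3 (γ : Fin 5 → ℂ) :
    ⁅w.K2 γ, w.K3 γ⁆ = ⁅w.ladder γ (-1), w.ladder γ 1⁆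
      + (4 * (γ 1 - 4 * γ 3)) • (w.ang * w.K2 γ) - (2 * (γ 1 - 4 * γ 3)) • w.K3 γ
      - (2 * (γ 1 - 4 * γ 3) ^ 2) • w.ang ^ 3 := by
  have h1 : ⁅w.ang ^ 2, w.K3 γ⁆ =
      (8 : ℂ) • (w.ang * w.K2 γ) - (4 : ℂ) • w.K3 γ - (4 * (γ 1 - 4 * γ 3)) • w.ang ^ 3 := by
    have h2 := w.lie_ang_K3 γ
    have h3 : w.K2 γ * w.ang = w.ang * w.K2 γ - w.K3 γ := by
      rw [K3, Ring.lie_def, sub_sub_cancel]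
    have h4 : ⁅w.ang ^ 2, w.K3 γ⁆ = w.ang * ⁅w.ang, w.K3 γ⁆ + ⁅w.ang, w.K3 γ⁆ * w.ang := by
      simp only [Ring.lie_def]
      noncomm_ring
    rw [h4, h2, mul_sub, sub_mul, mul_smul_comm, mul_smul_comm, smul_mul_assoc, smul_mul_assoc, h3,
      ← pow_succ, ← pow_succ']
    module
  have h5 : ⁅w.ladder γ 1 + w.ladder γ (-1), w.ladder γ 1 - w.ladder γ (-1)⁆ =
      (2 : ℂ) • ⁅w.ladder γ (-1), w.ladder γ 1⁆ := by
    simp only [Ring.lie_def, two_smul]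
    noncomm_ring
  have h6 : ⁅w.K2 γ, w.K3 γ⁆ = (1 / 2 : ℂ) • ⁅w.ladder γ 1 + w.ladder γ (-1), w.K3 γ⁆
      + (γ 1 / 2 - 2 * γ 3) • ⁅w.ang ^ 2, w.K3 γ⁆ := by
    rw [K2_eq, Ring.lie_def, Ring.lie_def, Ring.lie_def, add_mul, mul_add, smul_mul_assoc,
      smul_mul_assoc, mul_smul_comm, mul_smul_comm]
    module
  have h7 := h5
  rw [← K3_eq] at h7
  rw [h6, h1, h7]
  module

theorem lie_symIPrime_ham (γ : Fin 5 → ℂ) :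
    ⁅w.symIPrime γ, w.ham γ⁆ = 0 := by
  have hc : Commute (w.ham γ) w.ang := (w.ang_mul_ham γ).symm
  have h1 : Commute (w.ham γ) (w.ladder γ 1) := (w.ladder_mul_ham γ (one_pow 2)).symm
  have h2 : Commute (w.ham γ) (w.ladder γ (-1)) := (w.ladder_mul_ham γ (by norm_num)).symm
  rw [← commute_iff_lie_eq, symIPrime_eq]
  exact (((((Commute.refl _).add_right h1).add_right h2).add_right
    ((hc.pow_right 2).smul_right _)).sub_right ((hc.pow_right 4).smul_right _)).smul_right _ |>.symm

theorem lie_symI_ham (γ : Fin 5 → ℂ) : ⁅w.symI γ, w.ham γ⁆ = 0 := by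
  have hc : Commute (w.ham γ) w.ang := (w.ang_mul_ham γ).symm
  have h1 : Commute (w.ham γ) (w.ladder γ 1) := (w.ladder_mul_ham γ (one_pow 2)).symm
  have h2 : Commute (w.ham γ) (w.ladder γ (-1)) := (w.ladder_mul_ham γ (by norm_num)).symm
  rw [← commute_iff_lie_eq, symI_eq]
  exact (((((Commute.refl _).sub_right h1).sub_right h2).add_right
    ((hc.pow_right 2).smul_right _)).sub_right ((hc.pow_right 4).smul_right _)).smul_right _ |>.symm

end Weyl

/-! ### The structure function as a product of ladder operators -/

section Structure

variable {A : Type*} [Ring A] [Algebra ℂ A] (w : Weyl A) (γ : Fin 5 → ℂ)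

theorem Phi1_eq (H K : A) :
    Phi1 γ H K = (1 / 4 : ℂ) • (H - coeffSum γ ((2 * Complex.I) • K)) := by
  simp only [Phi1, coeffSum, smul_pow, smul_smul, mul_comm]

theorem Phi2_eq (H K : A) : Phi2 γ H K = H - coeffSum γ ((-2 * Complex.I) • (K - 1)) := by
  simp only [Phi2, coeffSum, smul_pow, smul_smul, mul_comm]

theorem commute_coeffSum {X Y : A} (h : Commute X Y) : Commute (coeffSum γ X) (coeffSum γ Y) := by
  have h1 : Commute X (coeffSum γ Y) := mul_coeffSum γ h
  exact (mul_coeffSum γ h1.symm).symm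

theorem commute_Phi1_Phi2 {H K : A} (h : Commute H K) : Commute (Phi1 γ H K) (Phi2 γ H K) := by
  rw [Phi1_eq, Phi2_eq]
  have h1 : Commute H (K - 1) := h.sub_right (Commute.one_right _)
  have h2 : Commute K (K - 1) := (Commute.refl K).sub_right (Commute.one_right _)
  refine Commute.smul_left (Commute.sub_left ?_ (Commute.sub_right ?_ ?_)) _
  · exact (Commute.refl H).sub_right (mul_coeffSum γ (h1.smul_right _))
  · exact (mul_coeffSum γ (h.symm.smul_left _).symm : Commute H _).symm
  · exact commute_coeffSum γ ((h2.smul_right _).smul_left _)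

theorem Weyl.ladder_mul_ladder_eq_Phi :
    w.ladder γ 1 * w.ladder γ (-1) = Phi γ (w.ham γ) ((1 / 2 : ℂ) • w.ang) := by
  have hc : Commute (w.ham γ) ((1 / 2 : ℂ) • w.ang) :=
    Commute.smul_right (w.ang_mul_ham γ).symm _
  have h1 : (2 * Complex.I) • ((1 / 2 : ℂ) • w.ang) = ((1 : ℂ) * Complex.I) • w.ang := by module
  have h2 : (-2 * Complex.I) • ((1 / 2 : ℂ) • w.ang - 1) =
      (-((1 : ℂ) * Complex.I)) • (w.ang - (2 * (1 : ℂ)) • (1 : A)) := by module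
  -- The ladder product yields the factors in the order Φ₂Φ₁; they are exchanged because C commutes
  -- with H.
  rw [Phi, (commute_Phi1_Phi2 γ hc).eq, Phi1_eq, Phi2_eq, w.ladder_mul_ladder γ (one_pow 2), h1, h2,
    mul_smul_comm]

theorem Weyl.lower_mul_raise_eq_Phi :
    w.ladder γ (-1) * w.ladder γ 1 = Phi γ (w.ham γ) ((1 / 2 : ℂ) • w.ang + 1) := by
  have h1 : (2 * Complex.I) • ((1 / 2 : ℂ) • w.ang + 1) =
      (-((-1 : ℂ) * Complex.I)) • (w.ang - (2 * (-1 : ℂ)) • (1 : A)) := by module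
  have h2 : (-2 * Complex.I) • ((1 / 2 : ℂ) • w.ang + 1 - 1) =
      ((-1 : ℂ) * Complex.I) • w.ang := by module
  have h := w.ladder_mul_ladder γ (ε := -1) (by norm_num)
  rw [neg_neg] at h
  rw [Phi, Phi1_eq, Phi2_eq, h, h1, h2, smul_mul_assoc]

end Structure

/-! ### Expansion of the structure function and the ninth-order algebra -/

section Phi

variable {A : Type*} [Ring A] [Algebra ℂ A] (γ : Fin 5 → ℂ)

theorem two_I_pow : (2 * Complex.I) ^ 1 = 2 * Complex.I ∧ (2 * Complex.I) ^ 2 = -4 ∧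
    (2 * Complex.I) ^ 3 = -8 * Complex.I ∧ (2 * Complex.I) ^ 4 = 16 ∧
    (2 * Complex.I) ^ 5 = 32 * Complex.I := by
  have h := Complex.I_sq
  refine ⟨?_, ?_, ?_, ?_, ?_⟩
  · ring
  · linear_combination 4 * h
  · linear_combination 8 * Complex.I * h
  · linear_combination (16 * Complex.I ^ 2 - 16) * h
  · linear_combination (32 * Complex.I ^ 3 - 32 * Complex.I) * h

theorem neg_two_I_pow : (-2 * Complex.I) ^ 1 = -2 * Complex.I ∧ (-2 * Complex.I) ^ 2 = -4 ∧
    (-2 * Complex.I) ^ 3 = 8 * Complex.I ∧ (-2 * Complex.I) ^ 4 = 16 ∧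
    (-2 * Complex.I) ^ 5 = -32 * Complex.I := by
  obtain ⟨h1, h2, h3, h4, h5⟩ := two_I_pow
  refine ⟨?_, ?_, ?_, ?_, ?_⟩
  · ring
  · linear_combination h2
  · linear_combination -h3
  · linear_combination h4
  · linear_combination -h5

theorem Phi1_expand (H K : A) :
    Phi1 γ H K = (1 / 4 : ℂ) • (H - (2 * Complex.I * γ 0) • K
          + (4 * γ 1) • K ^ 2 + (8 * Complex.I * γ 2) • K ^ 3
          - (16 * γ 3) • K ^ 4 - (32 * Complex.I * γ 4) • K ^ 5) := by
  obtain ⟨h1, h2, h3, h4, h5⟩ := two_I_pow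
  rw [Phi1]
  simp only [Fin.sum_univ_five, Fin.isValue, Fin.coe_ofNat_eq_mod, Nat.zero_mod, Nat.one_mod,
    Nat.reduceMod, Nat.reduceAdd, zero_add, h1, h2, h3, h4, h5, pow_one K]
  module

theorem Phi2_expand (H K : A) :
    Phi2 γ H K = H + (2 * Complex.I * γ 0) • (K - 1)
          + (4 * γ 1) • (K - 1) ^ 2 - (8 * Complex.I * γ 2) • (K - 1) ^ 3
          - (16 * γ 3) • (K - 1) ^ 4 + (32 * Complex.I * γ 4) • (K - 1) ^ 5 := by
  obtain ⟨h1, h2, h3, h4, h5⟩ := neg_two_I_pow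
  rw [Phi2]
  simp only [Fin.sum_univ_five, Fin.isValue, Fin.coe_ofNat_eq_mod, Nat.zero_mod, Nat.one_mod,
    Nat.reduceMod, Nat.reduceAdd, zero_add, h1, h2, h3, h4, h5, pow_one (K - 1)]
  module

theorem map_Phi {B : Type*} [Ring B] [Algebra ℂ B] {N : ℕ} (γ : Fin N → ℂ) (f : A →ₐ[ℂ] B)
    (H K : A) : f (Phi γ H K) = Phi γ (f H) (f K) := by
  simp only [Phi, Phi1, Phi2, map_mul, map_smul, map_sub, map_sum, map_pow, map_one]

end Phi

/-- The coefficients, of degrees zero and one, of the structure polynomials in terms of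
`α = (2 i γ₁, 4 γ₂, 8 i γ₃, 16 γ₄, 32 i γ₅)`. -/
def structureConst (α : Fin 5 → ℂ) : Fin 5 → ℂ :=
  ![-2 * α 0 ^ 2 + 2 * α 0 * α 1 + 2 * α 0 * α 2 - 2 * α 0 * α 3 - 2 * α 0 * α 4,
    8 * α 0 * α 2 - 12 * α 0 * α 3 - 20 * α 0 * α 4 + 4 * α 1 ^ 2 + 4 * α 1 * α 2 - 8 * α 1 * α 3 - 10 * α 1 * α 4 - 2 * α 2 ^ 2 + 2 * α 2 * α 3 + 2 * α 2 * α 4,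
    -12 * α 0 * α 4 - 12 * α 1 * α 3 - 18 * α 1 * α 4 - 6 * α 2 ^ 2 + 6 * α 2 * α 3 + 22 * α 2 * α 4 + 8 * α 3 ^ 2 + 8 * α 3 * α 4 - 2 * α 4 ^ 2,
    16 * α 2 * α 4 + 8 * α 3 ^ 2 + 8 * α 3 * α 4 - 20 * α 4 ^ 2,
    -10 * α 4 ^ 2]
def structureLin (α : Fin 5 → ℂ) : Fin 5 → ℂ :=
  ![4 * α 1 + 6 * α 2 - 8 * α 3 - 10 * α 4, -8 * α 3 - 20 * α 4, 0, 0, 0]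

def scaledCoeff (γ : Fin 5 → ℂ) : Fin 5 → ℂ :=
  ![2 * Complex.I * γ 0, 4 * γ 1, 8 * Complex.I * γ 2, 16 * γ 3, 32 * Complex.I * γ 4]

/-- The polynomials `c_j` of the ninth-order algebra. -/
def structurePoly (γ : Fin 5 → ℂ) (j : Fin 5) : Polynomial ℂ :=
  Polynomial.C (structureConst (scaledCoeff γ) j / 4) +
    Polynomial.C (structureLin (scaledCoeff γ) j / 4) * Polynomial.X

theorem natDegree_structurePoly (γ : Fin 5 → ℂ) (j : Fin 5) :
    (structurePoly γ j).natDegree ≤ 1 := by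
  rw [structurePoly]
  compute_degree

/-- With a = 32iγ₅ the top part of Φ is -(a²/4) K⁵ (K - 1)⁵, whose K⁹ coefficient is 5a²/4; the γ₄γ₅
terms cancel in that degree. Passing to Φ(-K) - Φ(K) gives -5a²/2 = 2560γ₅². -/
theorem structurePoly_four (γ : Fin 5 → ℂ) :
    structurePoly γ 4 = Polynomial.C (2560 * γ 4 ^ 2) := by
  have h : structureConst (scaledCoeff γ) 4 / 4 = 2560 * γ 4 ^ 2 := by
    simp [structureConst, scaledCoeff]
    linear_combination (-2560 * γ 4 ^ 2) * Complex.I_sq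
  rw [structurePoly, h]
  simp [structureLin]

/-- The substitution K ↦ -K turns the factors of Φ(H, K) into those of Φ(H, K + 1), up to the
constant ¼. The difference is therefore Φ(H, -K) - Φ(H, K), which has only odd powers of K, up to
the ninth. The term H²/4 cancels, so the coefficients have degree at most 1 in H. -/
theorem Phi_succ_sub_of_comm {S : Type*} [CommRing S] [Algebra ℂ S] (γ : Fin 5 → ℂ) (H K : S) :
    Phi γ H (K + 1) - Phi γ H K =
      ∑ j : Fin 5, Polynomial.aeval H (structurePoly γ j) * K ^ (2 * j.val + 1) := by
  have h : ∀ j : Fin 5, Polynomial.aeval H (structurePoly γ j) = (1 / 4 : ℂ) •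
      (algebraMap ℂ S (structureConst (scaledCoeff γ) j) +
        algebraMap ℂ S (structureLin (scaledCoeff γ) j) * H) := by
    intro j
    simp only [structurePoly, map_add, map_mul, Polynomial.aeval_C, Polynomial.aeval_X,
      div_eq_mul_inv,
      Algebra.smul_def, one_mul]
    ring
  simp only [h, smul_mul_assoc, ← Finset.smul_sum]
  rw [Phi, Phi, Phi1_expand, Phi1_expand, Phi2_expand, Phi2_expand, smul_mul_assoc, smul_mul_assoc,
    ← smul_sub]
  congr 1
  obtain ⟨α, hα⟩ : ∃ α, scaledCoeff γ = α := ⟨_, rfl⟩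
  have h0 : 2 * Complex.I * γ 0 = α 0 := congrFun hα 0
  have h1 : 4 * γ 1 = α 1 := congrFun hα 1
  have h2 : 8 * Complex.I * γ 2 = α 2 := congrFun hα 2
  have h3 : 16 * γ 3 = α 3 := congrFun hα 3
  have h4 : 32 * Complex.I * γ 4 = α 4 := congrFun hα 4
  rw [h0, h1, h2, h3, h4, hα, Fin.sum_univ_five]
  simp [structureConst, structureLin, Algebra.smul_def, map_ofNat (algebraMap ℂ S)]
  ring

open scoped IsMulCommutative in
-- Commuting H and K generate a commutative subalgebra; the identity is proved there and carried
-- back by the inclusion.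
theorem Phi_succ_sub {A : Type*} [Ring A] [Algebra ℂ A] (γ : Fin 5 → ℂ) {H K : A}
    (hc : Commute H K) :
    Phi γ H (K + 1) - Phi γ H K =
      ∑ j : Fin 5, Polynomial.aeval H (structurePoly γ j) * K ^ (2 * j.val + 1) := by
  have hs : ∀ a ∈ ({H, K} : Set A), ∀ b ∈ ({H, K} : Set A), a * b = b * a := by
    rintro a (rfl | rfl) b (rfl | rfl)
    · rfl
    · exact hc
    · exact hc.symm
    · rfl
  let h : Algebra.adjoin ℂ ({H, K} : Set A) := ⟨H, Algebra.subset_adjoin (by simp)⟩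
  let k : Algebra.adjoin ℂ ({H, K} : Set A) := ⟨K, Algebra.subset_adjoin (by simp)⟩
  have := Algebra.isMulCommutative_adjoin ℂ hs
  have key := Phi_succ_sub_of_comm γ h k
  have key' : Phi γ h (k + 1) - Phi γ h k =
      ∑ j : Fin 5, Polynomial.aeval h (structurePoly γ j) * k ^ (2 * j.val + 1) := key
  have := congrArg (Algebra.adjoin ℂ ({H, K} : Set A)).val key'
  rw [map_sub, map_Phi, map_Phi, map_sum] at this
  simpa [← Polynomial.aeval_algHom_apply, h, k] using this

/-! ### Grading and order of the symmetries -/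

namespace Weyl

variable {A : Type*} [Ring A] [Algebra ℂ A] (w : Weyl A)

/-- The span of the normally ordered monomials of degree at most `N` with `m` more momenta than
positions. -/
def balanced (m N : ℕ) : Submodule ℂ A :=
  Submodule.span ℂ {X | ∃ a b c d : ℕ, a + b + m = c + d ∧ a + b + c + d ≤ N ∧
    X = w.q₁ ^ a * w.q₂ ^ b * w.p₁ ^ c * w.p₂ ^ d}

theorem monomial_mem_balanced {m N a b c d : ℕ} (h : a + b + m = c + d) (h' : a + b + c + d ≤ N) :
    w.q₁ ^ a * w.q₂ ^ b * w.p₁ ^ c * w.p₂ ^ d ∈ w.balanced m N :=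
  Submodule.subset_span ⟨a, b, c, d, h, h', rfl⟩

theorem mul_mem_of_forall_monomial {m N : ℕ} {S : Submodule ℂ A} (Y : A)
    (h : ∀ a b c d : ℕ, a + b + m = c + d → a + b + c + d ≤ N →
      Y * (w.q₁ ^ a * w.q₂ ^ b * w.p₁ ^ c * w.p₂ ^ d) ∈ S) {X : A} (hX : X ∈ w.balanced m N) :
    Y * X ∈ S := by
  have : w.balanced m N ≤ S.comap (LinearMap.mulLeft ℂ Y) := by
    refine Submodule.span_le.2 ?_
    rintro _ ⟨a, b, c, d, h1, h2, rfl⟩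
    exact h a b c d h1 h2
  exact this hX

theorem q₁_mul_mem {m N : ℕ} {X : A} (hX : X ∈ w.balanced (m + 1) N) :
    w.q₁ * X ∈ w.balanced m (N + 1) := by
  refine w.mul_mem_of_forall_monomial _ (fun a b c d h h' => ?_) hX
  rw [← mul_assoc, ← mul_assoc, ← mul_assoc, ← pow_succ']
  exact w.monomial_mem_balanced (by omega) (by omega)

theorem q₂_mul_mem {m N : ℕ} {X : A} (hX : X ∈ w.balanced (m + 1) N) :
    w.q₂ * X ∈ w.balanced m (N + 1) := by
  refine w.mul_mem_of_forall_monomial _ (fun a b c d h h' => ?_) hX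
  have hc : Commute w.q₂ (w.q₁ ^ a) := Commute.pow_right w.q_comm _
  rw [← mul_assoc, ← mul_assoc, ← mul_assoc, hc.eq, mul_assoc (w.q₁ ^ a), ← pow_succ']
  exact w.monomial_mem_balanced (by omega) (by omega)

theorem p₁_mul_mem {m N : ℕ} {X : A} (hX : X ∈ w.balanced m N) :
    w.p₁ * X ∈ w.balanced (m + 1) (N + 1) := by
  refine w.mul_mem_of_forall_monomial _ (fun a b c d h h' => ?_) hX
  have hc : Commute w.p₁ (w.q₂ ^ b) := Commute.pow_right w.p₁_q₂ _
  rw [← mul_assoc, ← mul_assoc, ← mul_assoc, mul_pow_of_canonical w.p₁_q₁, sub_mul, sub_mul,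
    sub_mul, mul_assoc (w.q₁ ^ a), hc.eq, ← mul_assoc (w.q₁ ^ a), mul_assoc _ w.p₁, ← pow_succ']
  refine Submodule.sub_mem _ (w.monomial_mem_balanced (by omega) (by omega)) ?_
  rcases a with _ | a
  · simp
  · simp only [smul_mul_assoc]
    exact Submodule.smul_mem _ _ (w.monomial_mem_balanced (by omega) (by omega))

theorem p₂_mul_mem {m N : ℕ} {X : A} (hX : X ∈ w.balanced m N) :
    w.p₂ * X ∈ w.balanced (m + 1) (N + 1) := by
  refine w.mul_mem_of_forall_monomial _ (fun a b c d h h' => ?_) hX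
  have hc : Commute w.p₂ (w.q₁ ^ a) := Commute.pow_right w.p₂_q₁ _
  have hc' : Commute w.p₂ (w.p₁ ^ c) := Commute.pow_right w.p_comm _
  rw [← mul_assoc, ← mul_assoc, ← mul_assoc, hc.eq, mul_assoc (w.q₁ ^ a),
    mul_pow_of_canonical w.p₂_q₂, mul_sub, sub_mul,
    sub_mul, ← mul_assoc (w.q₁ ^ a), mul_assoc _ w.p₂, hc'.eq, mul_assoc _ (w.p₁ ^ c * w.p₂),
    mul_assoc (w.p₁ ^ c), ← pow_succ', ← mul_assoc _ (w.p₁ ^ c)]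
  refine Submodule.sub_mem _ (w.monomial_mem_balanced (by omega) (by omega)) ?_
  rcases b with _ | b
  · simp
  · simp only [smul_mul_assoc, mul_smul_comm]
    exact Submodule.smul_mem _ _ (w.monomial_mem_balanced (by omega) (by omega))

theorem balanced_mono {m N N' : ℕ} (h : N ≤ N') : w.balanced m N ≤ w.balanced m N' := by
  refine Submodule.span_mono ?_
  rintro _ ⟨a, b, c, d, h1, h2, rfl⟩
  exact ⟨a, b, c, d, h1, h2.trans h, rfl⟩

theorem one_mem_balanced : (1 : A) ∈ w.balanced 0 0 := by
  simpa using w.monomial_mem_balanced (m := 0) (N := 0) (a := 0) (b := 0) (c := 0) (d := 0) rfl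
    le_rfl

theorem dil_mul_mem {N : ℕ} {X : A} (hX : X ∈ w.balanced 0 N) :
    w.dil * X ∈ w.balanced 0 (N + 2) := by
  rw [dil, add_mul, mul_assoc, mul_assoc]
  exact Submodule.add_mem _ (w.q₁_mul_mem (w.p₁_mul_mem hX)) (w.q₂_mul_mem (w.p₂_mul_mem hX))

theorem ang_mul_mem {N : ℕ} {X : A} (hX : X ∈ w.balanced 0 N) :
    w.ang * X ∈ w.balanced 0 (N + 2) := by
  rw [ang, sub_mul, mul_assoc, mul_assoc]
  exact Submodule.sub_mem _ (w.q₁_mul_mem (w.p₂_mul_mem hX)) (w.q₂_mul_mem (w.p₁_mul_mem hX))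

theorem dil_pow_mul_mem {N : ℕ} {X : A} (hX : X ∈ w.balanced 0 N) (n : ℕ) :
    w.dil ^ n * X ∈ w.balanced 0 (N + 2 * n) := by
  induction n with
  | zero => simpa using hX
  | succ n ih => rw [pow_succ', mul_assoc]; exact w.dil_mul_mem ih

theorem ang_pow_mul_mem {N : ℕ} {X : A} (hX : X ∈ w.balanced 0 N) (n : ℕ) :
    w.ang ^ n * X ∈ w.balanced 0 (N + 2 * n) := by
  induction n with
  | zero => simpa using hX
  | succ n ih => rw [pow_succ', mul_assoc]; exact w.ang_mul_mem ih

theorem ang_pow_mem {N n : ℕ} (h : 2 * n ≤ N) : w.ang ^ n ∈ w.balanced 0 N := by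
  have := w.ang_pow_mul_mem w.one_mem_balanced n
  rw [mul_one] at this
  exact w.balanced_mono (by omega) this

theorem pos_mul_mom_mem (ε : ℂ) : w.pos ε * w.mom ε ∈ w.balanced 0 2 := by
  have h1 := w.p₁_mul_mem w.one_mem_balanced
  have h2 := w.p₂_mul_mem w.one_mem_balanced
  rw [mul_one] at h1 h2
  have h3 : w.mom ε ∈ w.balanced (0 + 1) (0 + 1) :=
    Submodule.add_mem _ h1 (Submodule.smul_mem _ _ h2)
  rw [pos, add_mul, smul_mul_assoc]
  exact Submodule.add_mem _ (w.q₁_mul_mem h3) (Submodule.smul_mem _ _ (w.q₂_mul_mem h3))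

theorem coeffSum_dil_mem {N : ℕ} (γ : Fin N → ℂ) : coeffSum γ w.dil ∈ w.balanced 0 (2 * N) := by
  refine Submodule.sum_mem _ fun k _ => Submodule.smul_mem _ _ ?_
  have := w.dil_pow_mul_mem w.one_mem_balanced (k.val + 1)
  rw [mul_one] at this
  exact w.balanced_mono (by omega) this

/-- Each term D^i C^(k-i) Q_ε P_ε has degree 2(k + 1), which is at most 2N because the index k
starts at 0. -/
theorem divDiff_mul_mem {N : ℕ} (γ : Fin N → ℂ) (ε : ℂ) :
    divDiff γ w.dil ((ε * Complex.I) • w.ang) * w.pos ε * w.mom ε ∈ w.balanced 0 (2 * N) := by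
  rw [mul_assoc, divDiff, Finset.sum_mul]
  refine Submodule.sum_mem _ fun k _ => ?_
  rw [smul_mul_assoc, Finset.sum_mul]
  refine Submodule.smul_mem _ _ (Submodule.sum_mem _ fun i hi => ?_)
  rw [smul_pow, mul_smul_comm, smul_mul_assoc, mul_assoc]
  refine Submodule.smul_mem _ _ ?_
  have h := w.dil_pow_mul_mem (w.ang_pow_mul_mem (w.pos_mul_mom_mem ε) (k.val - i)) i
  have hi' := Finset.mem_range.1 hi
  exact w.balanced_mono (by omega) h

theorem ham_sub_mem {N : ℕ} (γ : Fin N → ℂ) :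
    w.ham γ - (w.p₁ ^ 2 + w.p₂ ^ 2) ∈ w.balanced 0 (2 * N) := by
  rw [ham, add_sub_cancel_left]
  exact w.coeffSum_dil_mem γ

theorem ladder_sub_mem {N : ℕ} (γ : Fin N → ℂ) (ε : ℂ) :
    w.ladder γ ε - (1 / 2 : ℂ) • (w.mom ε * w.mom ε) ∈ w.balanced 0 (2 * N) := by
  rw [ladder, intertwiner, add_mul, smul_add, add_sub_cancel_left]
  exact Submodule.smul_mem _ _ (w.divDiff_mul_mem γ ε)

theorem symIPrime_sub_mem (γ : Fin 5 → ℂ) : w.symIPrime γ - w.p₁ ^ 2 ∈ w.balanced 0 10 := by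
  have h : w.symIPrime γ - w.p₁ ^ 2 = (1 / 2 : ℂ) • ((w.ham γ - (w.p₁ ^ 2 + w.p₂ ^ 2))
      + (w.ladder γ 1 - (1 / 2 : ℂ) • (w.mom 1 * w.mom 1))
      + (w.ladder γ (-1) - (1 / 2 : ℂ) • (w.mom (-1) * w.mom (-1)))
      + γ 1 • w.ang ^ 2 - γ 3 • w.ang ^ 4) := by
    have h0 := w.mom_mul_mom_add
    rw [← sub_eq_zero] at h0
    rw [symIPrime_eq, ← sub_eq_zero]
    refine Eq.trans ?_ ((congrArg ((1 / 4 : ℂ) • ·) h0).trans (smul_zero _))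
    module
  rw [h]
  exact Submodule.smul_mem _ _ (Submodule.sub_mem _ (Submodule.add_mem _ (Submodule.add_mem _
    (Submodule.add_mem _ (w.ham_sub_mem γ) (w.ladder_sub_mem γ 1)) (w.ladder_sub_mem γ (-1)))
    (Submodule.smul_mem _ _ (w.ang_pow_mem (by norm_num))))
    (Submodule.smul_mem _ _ (w.ang_pow_mem (by norm_num))))

theorem symI_sub_mem (γ : Fin 5 → ℂ) : w.symI γ - w.p₂ ^ 2 ∈ w.balanced 0 10 := by
  have h : w.symI γ - w.p₂ ^ 2 = (w.ham γ - (w.p₁ ^ 2 + w.p₂ ^ 2))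
      - (w.symIPrime γ - w.p₁ ^ 2) + (4 * γ 3) • w.ang ^ 2 - γ 3 • w.ang ^ 4 := by
    rw [symI]
    module
  rw [h]
  exact Submodule.sub_mem _ (Submodule.add_mem _ (Submodule.sub_mem _
    (w.ham_sub_mem γ) (w.symIPrime_sub_mem γ))
    (Submodule.smul_mem _ _ (w.ang_pow_mem (by norm_num))))
    (Submodule.smul_mem _ _ (w.ang_pow_mem (by norm_num)))

/-- The span of the normally ordered monomials of order at most `m` in the momenta. -/
def orderLE (m : ℕ) : Submodule ℂ A :=
  Submodule.span ℂ {X | ∃ a b c d : ℕ, c + d ≤ m ∧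
    X = w.q₁ ^ a * w.q₂ ^ b * w.p₁ ^ c * w.p₂ ^ d}

theorem balanced_le_orderLE (N : ℕ) : w.balanced 0 (2 * N) ≤ w.orderLE N := by
  refine Submodule.span_mono ?_
  rintro _ ⟨a, b, c, d, h1, h2, rfl⟩
  exact ⟨a, b, c, d, by omega, rfl⟩

theorem symIPrime_mem_orderLE (γ : Fin 5 → ℂ) : w.symIPrime γ ∈ w.orderLE 5 := by
  have h := w.balanced_le_orderLE 5 (w.symIPrime_sub_mem γ)
  have h' : w.p₁ ^ 2 ∈ w.orderLE 5 := Submodule.subset_span ⟨0, 0, 2, 0, by norm_num, by simp⟩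
  simpa using Submodule.add_mem _ h h'

theorem symI_mem_orderLE (γ : Fin 5 → ℂ) : w.symI γ ∈ w.orderLE 5 := by
  have h := w.balanced_le_orderLE 5 (w.symI_sub_mem γ)
  have h' : w.p₂ ^ 2 ∈ w.orderLE 5 := Submodule.subset_span ⟨0, 0, 0, 2, by norm_num, by simp⟩
  simpa using Submodule.add_mem _ h h'

/-- The fifth difference of a symbol along a ray of momenta. -/
def fifthDiff (x y k l : ℂ) : MvPolynomial (Fin 4) ℂ →ₗ[ℂ] ℂ :=
  ∑ n : Fin 6, ((![-1, 5, -10, 10, -5, 1] : Fin 6 → ℂ) n) •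
    (aeval ![x, y, (n.val : ℂ) * k, (n.val : ℂ) * l]).toLinearMap

theorem fifthDiff_apply (x y k l : ℂ) (f : MvPolynomial (Fin 4) ℂ) :
    fifthDiff x y k l f = -eval ![x, y, 0 * k, 0 * l] f + 5 * eval ![x, y, 1 * k, 1 * l] f
      - 10 * eval ![x, y, 2 * k, 2 * l] f + 10 * eval ![x, y, 3 * k, 3 * l] f
      - 5 * eval ![x, y, 4 * k, 4 * l] f + eval ![x, y, 5 * k, 5 * l] f := by
  simp [fifthDiff, Fin.sum_univ_six, aeval_eq_eval, coe_aeval_eq_eval]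
  ring

/-- On the ray n(k, l) a monomial of order s in the momenta is proportional to n^s, and the
alternating binomial sum over n = 0, …, 5 kills n^s for s ≤ 4. -/
theorem fifthDiff_eq_zero (hw : Function.Injective w.normalOrder) (x y k l : ℂ)
    {f : MvPolynomial (Fin 4) ℂ} (hf : w.normalOrder f ∈ w.orderLE 4) :
    fifthDiff x y k l f = 0 := by
  have key : w.orderLE 4 ≤ (LinearMap.ker (fifthDiff x y k l)).map w.normalOrder := by
    refine Submodule.span_le.2 ?_
    rintro _ ⟨a, b, c, d, h, rfl⟩
    refine ⟨X 0 ^ a * X 1 ^ b * X 2 ^ c * X 3 ^ d, ?_, ?_⟩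
    · rw [SetLike.mem_coe, LinearMap.mem_ker, fifthDiff_apply]
      simp only [map_mul, map_pow, eval_X, Matrix.cons_val]
      have h1 : ∀ n : ℂ, x ^ a * y ^ b * (n * k) ^ c * (n * l) ^ d =
          x ^ a * y ^ b * k ^ c * l ^ d * n ^ (c + d) := by
        intro n
        ring
      simp only [h1]
      obtain ⟨s, hs⟩ : ∃ s, c + d = s := ⟨_, rfl⟩
      rw [hs] at h ⊢
      interval_cases s <;> ring
    · have := w.q₁_pow_mul_normalOrder a (X 1 ^ b * (X 2 ^ c * (X 3 ^ d * 1)))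
      rw [← q₂_pow_mul_normalOrder, ← p₁_pow_mul_normalOrder, ← p₂_pow_mul_normalOrder,
        normalOrder_one, mul_one, mul_one] at this
      · simpa [mul_assoc] using this.symm
      · simp
      · simp [pderiv_X_of_ne]
  obtain ⟨g, hg, hgf⟩ := key hf
  rw [← hw hgf]
  exact hg

/-- On the first ray only q₁⁵p₁⁵ reaches order 5, and the fifth difference of n⁵ is 5! = 120. On the
second ray the symbol vanishes, since each of its monomials contains p₁; this value is recorded for
use with I₅. -/
theorem exists_symbol_symIPrime (γ : Fin 5 → ℂ) : ∃ f, w.symIPrime γ = w.normalOrder f ∧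
    fifthDiff 1 0 1 0 f = 120 * γ 4 ∧ fifthDiff 0 1 0 1 f = 0 := by
  have h : w.symIPrime γ * w.normalOrder 1 = w.symIPrime γ * w.normalOrder 1 := rfl
  -- The symbol is left to be computed by the rewriting of the right-hand side rather than written
  -- out.
  conv_rhs at h =>
    simp only [symIPrime, mul_assoc, add_mul, sub_mul, smul_mul_assoc, q₁_mul_normalOrder,
    q₂_mul_normalOrder, q₁_pow_mul_normalOrder, q₂_pow_mul_normalOrder,
    p₁_mul_normalOrder_of_pderiv, p₂_mul_normalOrder_of_pderiv, p₁_pow_mul_normalOrder,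
    p₂_pow_mul_normalOrder, pderiv_mom, pderiv_one, pderiv_mul, pderiv_pow, mul_zero, zero_mul,
    add_zero, ← map_add w.normalOrder, ← map_sub w.normalOrder, ← map_smul w.normalOrder]
  refine ⟨_, w.eq_normalOrder_of_mul h, ?_, ?_⟩
  · rw [fifthDiff_apply]
    simp [smul_eval]
    ring
  · rw [fifthDiff_apply]
    simp [smul_eval]

/-- Along this ray the symbols of I₅' and of C vanish, and the lower terms produced by C² and C⁴
have too small an order. Only γ₅D⁵ in the Hamiltonian contributes. -/
theorem exists_symbol_symI (γ : Fin 5 → ℂ) : ∃ f, w.symI γ = w.normalOrder f ∧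
    fifthDiff 0 1 0 1 f = 120 * γ 4 := by
  obtain ⟨f, hf, -, hf'⟩ := w.exists_symbol_symIPrime γ
  have h : w.ham γ = (w.p₁ ^ 2 + w.p₂ ^ 2) + (γ 0 • w.dil ^ 1 + γ 1 • w.dil ^ 2 + γ 2 • w.dil ^ 3
      + γ 3 • w.dil ^ 4 + γ 4 • w.dil ^ 5) := by
    rw [ham, coeffSum, Fin.sum_univ_five]
    rfl
  have h2 : w.p₁ ^ 2 + w.p₂ ^ 2 = w.normalOrder (X 2 ^ 2 + X 3 ^ 2) := by
    refine w.eq_normalOrder_of_mul ?_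
    rw [add_mul, w.p₁_pow_mul_normalOrder _ pderiv_one, w.p₂_pow_mul_normalOrder _ pderiv_one,
      mul_one, mul_one, map_add]
  rw [symI, h, h2, hf, dil_pow_1, dil_pow_2, dil_pow_3, dil_pow_4, dil_pow_5, ang_pow_2, ang_pow_4]
  simp only [← map_smul, ← map_add w.normalOrder, ← map_sub w.normalOrder]
  refine ⟨_, rfl, ?_⟩
  rw [map_sub, map_add, map_sub, hf', sub_zero, ← map_add, ← map_sub, fifthDiff_apply]
  simp [smul_eval, dilSym, angSym]
  ring

end Weyl

/-! ### Weighted leading symbols and algebraic independence -/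

/-- The weights of the positions and the momenta for which the kinetic energy dominates. -/
def phaseWeight : Fin 4 → ℤ := ![-4, -4, 5, 5]

/-- The symbols all of whose monomials have weight at most `m`. -/
def weightLE (m : ℤ) : Submodule ℂ (MvPolynomial (Fin 4) ℂ) where
  carrier := {f | ∀ d, coeff d f ≠ 0 → Finsupp.weight phaseWeight d ≤ m}
  add_mem' := by
    intro f g hf hg d hd
    by_cases h : coeff d f = 0
    · exact hg d (by rwa [coeff_add, h, zero_add] at hd)
    · exact hf d h
  zero_mem' := by
    intro d hd
    exact absurd (coeff_zero d) hd
  smul_mem' := by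
    intro c f hf d hd
    rw [coeff_smul, smul_eq_mul] at hd
    exact hf d (right_ne_zero_of_mul hd)

theorem weightLE_mono {m n : ℤ} (h : m ≤ n) : weightLE m ≤ weightLE n :=
  fun _ hf d hd => (hf d hd).trans h

theorem IsWeightedHomogeneous.mem_weightLE {m : ℤ} {f : MvPolynomial (Fin 4) ℂ}
    (hf : IsWeightedHomogeneous phaseWeight f m) : f ∈ weightLE m :=
  fun _ hd => (hf hd).le

theorem mul_mem_weightLE {m n : ℤ} {f g : MvPolynomial (Fin 4) ℂ} (hf : f ∈ weightLE m)
    (hg : g ∈ weightLE n) : f * g ∈ weightLE (m + n) := by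
  classical
  intro d hd
  rw [coeff_mul] at hd
  obtain ⟨x, hx, hne⟩ := Finset.exists_ne_zero_of_sum_ne_zero hd
  rw [← Finset.HasAntidiagonal.mem_antidiagonal.1 hx, map_add]
  exact add_le_add (hf _ (left_ne_zero_of_mul hne)) (hg _ (right_ne_zero_of_mul hne))

theorem pderiv_mem_weightLE {m : ℤ} {f : MvPolynomial (Fin 4) ℂ} (hf : f ∈ weightLE m)
    (i : Fin 4) : pderiv i f ∈ weightLE (m - phaseWeight i) := by
  intro d hd
  rw [coeff_pderiv] at hd
  have h : coeff (d + Finsupp.single i 1) f ≠ 0 := fun h => hd (by simp [h])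
  have := hf _ h
  rw [map_add, Finsupp.weight_single, one_smul] at this
  linarith

theorem eq_zero_of_mem_weightLE_of_isWeightedHomogeneous {m : ℤ} {f : MvPolynomial (Fin 4) ℂ}
    (hf : f ∈ weightLE (m - 1)) (hf' : IsWeightedHomogeneous phaseWeight f m) : f = 0 := by
  ext d
  rw [coeff_zero]
  by_contra h
  have h1 := hf d h
  rw [hf' h] at h1
  linarith

namespace Weyl

variable {A : Type*} [Ring A] [Algebra ℂ A] (w : Weyl A)

/-- The element `X` acts on normally ordered elements, up to terms of lower weight, as the
multiplication of symbols by `s`, homogeneous of weight `k`. -/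
def HasSymbol (X : A) (k : ℤ) (s : MvPolynomial (Fin 4) ℂ) : Prop :=
  IsWeightedHomogeneous phaseWeight s k ∧ ∀ m : ℤ, ∀ f ∈ weightLE m, ∃ g,
    X * w.normalOrder f = w.normalOrder g ∧ g - s * f ∈ weightLE (k + m - 1)

namespace HasSymbol

variable {w} {X Y : A} {k l : ℤ} {s t : MvPolynomial (Fin 4) ℂ}

theorem zero : w.HasSymbol 0 k 0 :=
  ⟨isWeightedHomogeneous_zero _ _ _, fun _ _ _ => ⟨0, by simp, by simp⟩⟩

theorem one : w.HasSymbol 1 0 1 :=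
  ⟨isWeightedHomogeneous_one _ _, fun _ f _ => ⟨f, by simp, by simp⟩⟩

theorem q₁ : w.HasSymbol w.q₁ (-4) (MvPolynomial.X 0) :=
  ⟨isWeightedHomogeneous_X _ _ 0, fun _ f _ => ⟨_, w.q₁_mul_normalOrder f, by simp⟩⟩

theorem q₂ : w.HasSymbol w.q₂ (-4) (MvPolynomial.X 1) :=
  ⟨isWeightedHomogeneous_X _ _ 1, fun _ f _ => ⟨_, w.q₂_mul_normalOrder f, by simp⟩⟩

/-- The multiplication term raises the weight by 5, whereas the contraction removes a position of
weight -4 and raises it by 4 only. -/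
theorem p₁ : w.HasSymbol w.p₁ 5 (MvPolynomial.X 2) := by
  refine ⟨isWeightedHomogeneous_X _ _ 2, fun m f hf => ⟨_, w.p₁_mul_normalOrder f, ?_⟩⟩
  rw [sub_sub_cancel_left, ← smul_eq_C_mul]
  refine Submodule.neg_mem _ (Submodule.smul_mem _ _ ?_)
  refine weightLE_mono (le_of_eq ?_) (pderiv_mem_weightLE hf 0)
  simp [phaseWeight]
  ring

theorem p₂ : w.HasSymbol w.p₂ 5 (MvPolynomial.X 3) := by
  refine ⟨isWeightedHomogeneous_X _ _ 3, fun m f hf => ⟨_, w.p₂_mul_normalOrder f, ?_⟩⟩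
  rw [sub_sub_cancel_left, ← smul_eq_C_mul]
  refine Submodule.neg_mem _ (Submodule.smul_mem _ _ ?_)
  refine weightLE_mono (le_of_eq ?_) (pderiv_mem_weightLE hf 1)
  simp [phaseWeight]
  ring

theorem add (hX : w.HasSymbol X k s) (hY : w.HasSymbol Y k t) : w.HasSymbol (X + Y) k (s + t) := by
  refine ⟨hX.1.add hY.1, fun m f hf => ?_⟩
  obtain ⟨g, hg, hg'⟩ := hX.2 m f hf
  obtain ⟨h, hh, hh'⟩ := hY.2 m f hf
  refine ⟨g + h, by rw [add_mul, hg, hh, map_add], ?_⟩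
  convert Submodule.add_mem _ hg' hh' using 1
  ring

theorem smul (c : ℂ) (hX : w.HasSymbol X k s) : w.HasSymbol (c • X) k (c • s) := by
  refine ⟨?_, fun m f hf => ?_⟩
  · rw [smul_eq_C_mul]
    exact hX.1.C_mul c
  · obtain ⟨g, hg, hg'⟩ := hX.2 m f hf
    refine ⟨c • g, by rw [smul_mul_assoc, hg, map_smul], ?_⟩
    rw [smul_mul_assoc, ← smul_sub]
    exact Submodule.smul_mem _ _ hg'

theorem sub (hX : w.HasSymbol X k s) (hY : w.HasSymbol Y k t) : w.HasSymbol (X - Y) k (s - t) := by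
  have := hX.add (hY.smul (-1))
  rwa [neg_one_smul, neg_one_smul, ← sub_eq_add_neg, ← sub_eq_add_neg] at this

theorem mul (hX : w.HasSymbol X k s) (hY : w.HasSymbol Y l t) :
    w.HasSymbol (X * Y) (k + l) (s * t) := by
  refine ⟨hX.1.mul hY.1, fun m f hf => ?_⟩
  obtain ⟨g, hg, hg'⟩ := hY.2 m f hf
  have hgm : g ∈ weightLE (l + m) := by
    have h1 := mul_mem_weightLE (IsWeightedHomogeneous.mem_weightLE hY.1) hf
    have h2 := Submodule.add_mem _ (weightLE_mono (by linarith) hg') h1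
    rwa [sub_add_cancel] at h2
  obtain ⟨h, hh, hh'⟩ := hX.2 _ g hgm
  refine ⟨h, by rw [mul_assoc, hg, hh], ?_⟩
  have h1 := mul_mem_weightLE (IsWeightedHomogeneous.mem_weightLE hX.1) hg'
  convert Submodule.add_mem _ (weightLE_mono (le_of_eq ?_) hh') (weightLE_mono (le_of_eq ?_) h1)
    using 1
  · ring
  · ring
  · ring

theorem pow (hX : w.HasSymbol X k s) (n : ℕ) : w.HasSymbol (X ^ n) (n * k) (s ^ n) := by
  induction n with
  | zero => simpa using one
  | succ n ih =>
    have := ih.mul hX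
    rw [← pow_succ, ← pow_succ] at this
    convert this using 1
    push_cast
    ring

/-- Elements of smaller weight are assigned the symbol 0 at the higher level, so that sums of
inhomogeneous terms can be read at their top weight. -/
theorem of_lt (hX : w.HasSymbol X k s) (h : k < l) : w.HasSymbol X l 0 := by
  refine ⟨isWeightedHomogeneous_zero _ _ _, fun m f hf => ?_⟩
  obtain ⟨g, hg, hg'⟩ := hX.2 m f hf
  refine ⟨g, hg, ?_⟩
  have h1 := mul_mem_weightLE (IsWeightedHomogeneous.mem_weightLE hX.1) hf
  have h2 := Submodule.add_mem _ (weightLE_mono (by linarith) hg') h1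
  rw [sub_add_cancel] at h2
  rw [zero_mul, sub_zero]
  exact weightLE_mono (by omega) h2

theorem sum {ι : Type*} (S : Finset ι) {X : ι → A} {s : ι → MvPolynomial (Fin 4) ℂ}
    (h : ∀ i ∈ S, w.HasSymbol (X i) k (s i)) : w.HasSymbol (∑ i ∈ S, X i) k (∑ i ∈ S, s i) := by
  classical
  induction S using Finset.induction_on with
  | empty => simpa using zero
  | insert a S ha ih =>
    rw [Finset.sum_insert ha, Finset.sum_insert ha]
    exact (h a (Finset.mem_insert_self _ _)).add
      (ih fun i hi => h i (Finset.mem_insert_of_mem hi))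

theorem eq_zero (hw : Function.Injective w.normalOrder) (h : w.HasSymbol 0 k s) : s = 0 := by
  obtain ⟨g, hg, hg'⟩ := h.2 0 1 (by
    intro d hd
    rw [coeff_one] at hd
    obtain rfl : 0 = d := by
      by_contra hne
      exact hd (if_neg hne)
    simp)
  have hg0 : g = 0 := hw (by rw [← hg, zero_mul, map_zero])
  rw [hg0, zero_sub, mul_one, add_zero] at hg'
  exact eq_zero_of_mem_weightLE_of_isWeightedHomogeneous (by simpa using Submodule.neg_mem _ hg') h.1

theorem list_prod {X : Fin 3 → A} {k : Fin 3 → ℤ} {s : Fin 3 → MvPolynomial (Fin 4) ℂ}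
    (h : ∀ i, w.HasSymbol (X i) (k i) (s i)) (L : List (Fin 3)) :
    w.HasSymbol (L.map X).prod (L.map k).sum (L.map s).prod := by
  induction L with
  | nil => simpa using one
  | cons i L ih => simpa using (h i).mul ih

/-- Symbols commute, so all length! rearrangements have the same leading symbol and it is not
cancelled in the symmetrized product. -/
theorem symProd {X : Fin 3 → A} {k : Fin 3 → ℤ} {s : Fin 3 → MvPolynomial (Fin 4) ℂ}
    (h : ∀ i, w.HasSymbol (X i) (k i) (s i)) (L : List (Fin 3)) :
    w.HasSymbol (Zernike.symProd (L.map X)) (L.map k).sum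
      ((L.length.factorial : ℂ) • (L.map s).prod) := by
  have key : ∀ M : List (List (Fin 3)), (∀ L' ∈ M, L'.Perm L) →
      w.HasSymbol ((M.map fun L' => (L'.map X).prod).sum) (L.map k).sum
        ((M.length : ℂ) • (L.map s).prod) := by
    intro M hM
    induction M with
    | nil => simpa using zero
    | cons L' M ih =>
      have hp := hM L' List.mem_cons_self
      have h1 := list_prod h L'
      rw [(hp.map k).sum_eq, (hp.map s).prod_eq] at h1
      have h2 := h1.add (ih fun L'' h'' => hM L'' (List.mem_cons_of_mem _ h''))
      rw [List.map_cons, List.sum_cons, List.length_cons, Nat.cast_succ, add_smul, one_smul,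
        add_comm (_ • _)]
      exact h2
  have h1 := key L.permutations fun L' hL' => List.mem_permutations.1 hL'
  rw [List.length_permutations] at h1
  rw [Zernike.symProd, ← List.map_permutations, List.map_map]
  exact h1

end HasSymbol

/-- With s = a + b = c + d ≤ 5 the weight of the monomial is -4s + 5s = s ≤ 5, below the weight 10
of the kinetic energy. -/
theorem hasSymbol_of_mem_balanced {X : A} (hX : X ∈ w.balanced 0 10) : w.HasSymbol X 10 0 := by
  induction hX using Submodule.span_induction with
  | mem X hX =>
    obtain ⟨a, b, c, d, h, h', rfl⟩ := hX
    refine ((((HasSymbol.q₁.pow a).mul (HasSymbol.q₂.pow b)).mul (HasSymbol.p₁.pow c)).mul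
      (HasSymbol.p₂.pow d)).of_lt ?_
    omega
  | zero => exact HasSymbol.zero
  | add X Y _ _ hX hY => simpa using hX.add hY
  | smul c X _ hX => simpa using hX.smul c

theorem hasSymbol_ang : w.HasSymbol w.ang 1 (X 0 * X 3 - X 1 * X 2) :=
  (HasSymbol.q₁.mul HasSymbol.p₂).sub (HasSymbol.q₂.mul HasSymbol.p₁)

theorem hasSymbol_ham (γ : Fin 5 → ℂ) : w.HasSymbol (w.ham γ) 10 (X 2 ^ 2 + X 3 ^ 2) := by
  have h := w.hasSymbol_of_mem_balanced (w.ham_sub_mem γ)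
  simpa using h.add ((HasSymbol.p₁.pow 2).add (HasSymbol.p₂.pow 2))

theorem hasSymbol_symIPrime (γ : Fin 5 → ℂ) : w.HasSymbol (w.symIPrime γ) 10 (X 2 ^ 2) := by
  have h := w.hasSymbol_of_mem_balanced (w.symIPrime_sub_mem γ)
  simpa using h.add (HasSymbol.p₁.pow 2)

theorem hasSymbol_symI (γ : Fin 5 → ℂ) : w.HasSymbol (w.symI γ) 10 (X 3 ^ 2) := by
  have h := w.hasSymbol_of_mem_balanced (w.symI_sub_mem γ)
  simpa using h.add (HasSymbol.p₂.pow 2)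

/-- Elements whose symbols have linearly independent monomials are algebraically independent. -/
theorem algIndep_of_hasSymbol (hw : Function.Injective w.normalOrder) {X : Fin 3 → A}
    {k : Fin 3 → ℤ} {s : Fin 3 → MvPolynomial (Fin 4) ℂ}
    (h : ∀ i, w.HasSymbol (X i) (k i) (s i))
    (hs : LinearIndependent ℂ (fun m : ℕ × ℕ × ℕ => s 0 ^ m.1 * s 1 ^ m.2.1 * s 2 ^ m.2.2)) :
    AlgIndep (X 0) (X 1) (X 2) := by
  classical
  let L : ℕ × ℕ × ℕ → List (Fin 3) := fun m =>
    List.replicate m.1 0 ++ List.replicate m.2.1 1 ++ List.replicate m.2.2 2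
  have hL : ∀ m : ℕ × ℕ × ℕ, symProd (List.replicate m.1 (X 0) ++ List.replicate m.2.1 (X 1) ++
      List.replicate m.2.2 (X 2)) = symProd ((L m).map X) := by
    intro m
    simp [L, List.map_append, List.map_replicate]
  have hLs : ∀ m, ((L m).map s).prod = s 0 ^ m.1 * s 1 ^ m.2.1 * s 2 ^ m.2.2 := by
    intro m
    simp [L, List.map_append, List.map_replicate, mul_assoc]
  rw [AlgIndep, linearIndependent_iff']
  simp only [hL]
  intro S c hc
  by_contra! hne
  obtain ⟨m₁, hm₁, hcm₁⟩ := hne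
  -- A term of maximal weight with nonzero coefficient: the symbol of the vanishing sum at this
  -- weight is a relation between the commutative monomials, where this term keeps its coefficient
  -- times a factorial.
  obtain ⟨m₀, hm₀, hmax⟩ := (S.filter fun m => c m ≠ 0).exists_max_image
    (fun m => ((L m).map k).sum) ⟨m₁, Finset.mem_filter.2 ⟨hm₁, hcm₁⟩⟩
  obtain ⟨hm₀S, hcm₀⟩ := Finset.mem_filter.1 hm₀
  set K := ((L m₀).map k).sum with hK
  have hsum : w.HasSymbol (∑ m ∈ S, c m • symProd ((L m).map X)) K
      (∑ m ∈ S, (if ((L m).map k).sum = K then c m * ((L m).length.factorial : ℂ) else 0) •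
        (s 0 ^ m.1 * s 1 ^ m.2.1 * s 2 ^ m.2.2)) := by
    refine HasSymbol.sum S fun m hm => ?_
    by_cases hcm : c m = 0
    · simpa [hcm] using HasSymbol.zero
    · have h1 := (HasSymbol.symProd h (L m)).smul (c m)
      by_cases hk : ((L m).map k).sum = K
      · rw [if_pos hk, mul_smul, ← hLs, ← hk]
        exact h1
      · rw [if_neg hk, zero_smul]
        exact h1.of_lt (lt_of_le_of_ne (hmax m (Finset.mem_filter.2 ⟨hm, hcm⟩)) hk)
  rw [hc] at hsum
  have h0 := linearIndependent_iff'.1 hs S _ (hsum.eq_zero hw) m₀ hm₀S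
  rw [if_pos hK.symm] at h0
  exact mul_ne_zero hcm₀ (Nat.cast_ne_zero.2 (Nat.factorial_ne_zero _)) h0

end Weyl

/-- A polynomial relation between three polynomials whose values fill the complement of a
coordinate plane is trivial. -/
theorem linearIndependent_monomials_of_values {s : Fin 3 → MvPolynomial (Fin 4) ℂ}
    (h : ∀ v : Fin 3 → ℂ, v 2 ≠ 0 → ∃ x : Fin 4 → ℂ, ∀ i, eval x (s i) = v i) :
    LinearIndependent ℂ (fun m : ℕ × ℕ × ℕ => s 0 ^ m.1 * s 1 ^ m.2.1 * s 2 ^ m.2.2) := by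
  have hinj : LinearMap.ker (aeval s : MvPolynomial (Fin 3) ℂ →ₐ[ℂ] _).toLinearMap = ⊥ := by
    rw [LinearMap.ker_eq_bot']
    intro P hP
    have hP' : aeval s P = 0 := hP
    -- The values are only known to fill the region where the last coordinate is nonzero;
    -- multiplication by that coordinate makes the product vanish everywhere.
    have h0 : P * X 2 = 0 := by
      refine MvPolynomial.funext fun v => ?_
      rw [map_mul, eval_X, map_zero]
      by_cases hv : v 2 = 0
      · rw [hv, mul_zero]
      · obtain ⟨x, hx⟩ := h v hv
        have h1 := congrArg (eval x) hP'
        have h2 : (eval x).comp (algebraMap ℂ (MvPolynomial (Fin 4) ℂ)) = RingHom.id ℂ := by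
          ext c
          simp
        rw [map_zero, map_aeval, h2, funext hx] at h1
        rw [eval, h1, zero_mul]
    exact (mul_eq_zero.1 h0).resolve_right (X_ne_zero 2)
  have hli := (basisMonomials (Fin 3) ℂ).linearIndependent.map' _ hinj
  have hinj' : Function.Injective (fun m : ℕ × ℕ × ℕ =>
      (Finsupp.equivFunOnFinite.symm ![m.1, m.2.1, m.2.2] : Fin 3 →₀ ℕ)) := by
    rintro ⟨a, b, c⟩ ⟨a', b', c'⟩ hm
    have hm' := Finsupp.equivFunOnFinite.symm.injective hm
    have h0 := congrFun hm' 0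
    have h1 := congrFun hm' 1
    have h2 := congrFun hm' 2
    simp at h0 h1 h2
    simp [h0, h1, h2]
  have h2 := hli.comp _ hinj'
  have h3 : (fun m : ℕ × ℕ × ℕ => s 0 ^ m.1 * s 1 ^ m.2.1 * s 2 ^ m.2.2) =
      ((aeval s : MvPolynomial (Fin 3) ℂ →ₐ[ℂ] _).toLinearMap ∘ basisMonomials (Fin 3) ℂ) ∘
        fun m => (Finsupp.equivFunOnFinite.symm ![m.1, m.2.1, m.2.2] : Fin 3 →₀ ℕ) := by
    funext m
    rw [Function.comp_apply, Function.comp_apply, coe_basisMonomials, AlgHom.toLinearMap_apply,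
      aeval_monomial, Finsupp.prod_fintype _ _ (fun i => pow_zero _), Fin.prod_univ_three]
    simp
  rw [h3]
  exact h2

theorem algIndep_symIPrime (γ : Fin 5 → ℂ) :
    AlgIndep (weylOp.ham γ) weylOp.ang (weylOp.symIPrime γ) := by
  refine weylOp.algIndep_of_hasSymbol normalOrder_injective
    (X := ![weylOp.ham γ, weylOp.ang, weylOp.symIPrime γ]) (k := ![10, 1, 10])
    (s := ![X 2 ^ 2 + X 3 ^ 2, X 0 * X 3 - X 1 * X 2, X 2 ^ 2]) ?_ ?_
  · intro i
    fin_cases i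
    · exact weylOp.hasSymbol_ham γ
    · exact weylOp.hasSymbol_ang
    · exact weylOp.hasSymbol_symIPrime γ
  · refine linearIndependent_monomials_of_values fun v hv => ?_
    obtain ⟨a, ha⟩ := IsAlgClosed.exists_pow_nat_eq (v 2) two_pos
    obtain ⟨b, hb⟩ := IsAlgClosed.exists_pow_nat_eq (v 0 - v 2) two_pos
    have ha0 : a ≠ 0 := by
      rintro rfl
      exact hv (by rw [← ha]; norm_num)
    -- Square roots determine the momenta (a, b), and with first position 0 the angular momentum
    -- equation -x₂a = v₁ is solved by division by a.
    refine ⟨![0, -v 1 / a, a, b], fun i => ?_⟩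
    fin_cases i
    · simp [ha, hb]
    · simp [ha0]
    · simp [ha]

theorem algIndep_symI (γ : Fin 5 → ℂ) :
    AlgIndep (weylOp.ham γ) weylOp.ang (weylOp.symI γ) := by
  refine weylOp.algIndep_of_hasSymbol normalOrder_injective
    (X := ![weylOp.ham γ, weylOp.ang, weylOp.symI γ]) (k := ![10, 1, 10])
    (s := ![X 2 ^ 2 + X 3 ^ 2, X 0 * X 3 - X 1 * X 2, X 3 ^ 2]) ?_ ?_
  · intro i
    fin_cases i
    · exact weylOp.hasSymbol_ham γ
    · exact weylOp.hasSymbol_ang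
    · exact weylOp.hasSymbol_symI γ
  · refine linearIndependent_monomials_of_values fun v hv => ?_
    obtain ⟨a, ha⟩ := IsAlgClosed.exists_pow_nat_eq (v 2) two_pos
    obtain ⟨b, hb⟩ := IsAlgClosed.exists_pow_nat_eq (v 0 - v 2) two_pos
    have ha0 : a ≠ 0 := by
      rintro rfl
      exact hv (by rw [← ha]; norm_num)
    -- Now the second momentum is the nonzero one, so the first position carries the angular
    -- momentum.
    refine ⟨![v 1 / a, 0, b, a], fun i => ?_⟩
    fin_cases i
    · simp [ha, hb]
    · simp [ha0]
    · simp [ha]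

/-! ### Finite-dimensional representations of the deformed oscillator -/

section Representation

variable {N : ℕ} (γ : Fin N → ℂ)

theorem Phi_diagonal {ι : Type*} [Fintype ι] [DecidableEq ι] (E c : ℂ) (v : ι → ℂ) :
    Phi γ (E • (1 : Matrix ι ι ℂ)) (Matrix.diagonal v + c • 1) =
      Matrix.diagonal (fun j => Phi γ E (v j + c)) := by
  have h1 : (E • (1 : Matrix ι ι ℂ)) = Matrix.diagonalAlgHom ℂ (fun _ => E) :=
    Matrix.smul_one_eq_diagonal E
  have h2 : (Matrix.diagonal v + c • (1 : Matrix ι ι ℂ)) =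
      Matrix.diagonalAlgHom ℂ (fun j => v j + c) := by
    rw [Matrix.smul_one_eq_diagonal, Matrix.diagonal_add]
    rfl
  have h3 : Phi γ (fun _ : ι => E) (fun j => v j + c) = fun j => Phi γ E (v j + c) := by
    funext j
    exact map_Phi γ (Pi.evalAlgHom ℂ (fun _ : ι => ℂ) j) (fun _ => E) (fun j => v j + c)
  rw [h1, h2, ← map_Phi, h3]
  rfl

theorem lie_diagonal_apply {ι : Type*} [Fintype ι] [DecidableEq ι] (v : ι → ℂ)
    (M : Matrix ι ι ℂ) (i j : ι) : ⁅Matrix.diagonal v, M⁆ i j = (v i - v j) * M i j := by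
  rw [Ring.lie_def, Matrix.sub_apply, Matrix.diagonal_mul, Matrix.mul_diagonal]
  ring

/-- The commutator with the diagonal matrix confines b₊ to the first subdiagonal, so its first row
and last column vanish. The first diagonal entry of b₊b₋ and the last one of b₋b₊ are then zero,
which are the two conditions. -/
theorem HasOscillatorRep.specEqs {n : ℕ} {u E : ℂ} (h : HasOscillatorRep γ n u E) :
    SpecEqs γ n u E := by
  obtain ⟨B, bm, bp, rfl, h1, h2, h3, h4⟩ := h
  rw [Phi_diagonal, Phi_diagonal] at h3
  rw [Phi_diagonal] at h4
  have hp : ∀ i j : Fin (n + 1), i.val ≠ j.val + 1 → bp i j = 0 := by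
    intro i j hij
    have h5 := congrFun (congrFun h1 i) j
    rw [lie_diagonal_apply] at h5
    have h6 : ((i.val : ℂ) - j.val - 1) * bp i j = 0 := by linear_combination h5
    refine (mul_eq_zero.1 h6).resolve_left fun h7 => hij ?_
    have h8 : (i.val : ℂ) = ((j.val + 1 : ℕ) : ℂ) := by
      push_cast
      linear_combination h7
    exact_mod_cast h8
  have hbm : bm * bp = Matrix.diagonal fun j : Fin (n + 1) => Phi γ E ((j.val : ℂ) + (u + 1)) := by
    rw [Ring.lie_def, h4] at h3
    exact sub_left_inj.1 h3
  constructor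
  · have h5 := congrFun (congrFun h4 0) 0
    rw [Matrix.mul_apply, Matrix.diagonal_apply_eq, Finset.sum_eq_zero] at h5
    · simpa using h5.symm
    · intro j _
      rw [hp 0 j (by simp), zero_mul]
  · have h5 := congrFun (congrFun hbm (Fin.last n)) (Fin.last n)
    rw [Matrix.mul_apply, Matrix.diagonal_apply_eq, Finset.sum_eq_zero] at h5
    · rw [h5, Fin.val_last]
      congr 1
      ring
    · intro j _
      rw [hp j (Fin.last n) (by rw [Fin.val_last]; omega), mul_zero]

/-- The shift with unit entries serves as b₊, and b₋ carries the values of Φ. The two products are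
the required diagonal matrices except possibly at the two ends, where the spectral conditions supply
the missing zeros. -/
theorem SpecEqs.hasOscillatorRep {n : ℕ} {u E : ℂ} (h : SpecEqs γ n u E) :
    HasOscillatorRep γ n u E := by
  let bp : Matrix (Fin (n + 1)) (Fin (n + 1)) ℂ :=
    Matrix.of fun i j => if i.val = j.val + 1 then 1 else 0
  let bm : Matrix (Fin (n + 1)) (Fin (n + 1)) ℂ :=
    Matrix.of fun i j => if j.val = i.val + 1 then Phi γ E ((j.val : ℂ) + u) else 0
  have hpm : bp * bm = Matrix.diagonal fun j : Fin (n + 1) => Phi γ E ((j.val : ℂ) + u) := by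
    ext i k
    rw [Matrix.mul_apply]
    refine Fin.cases ?_ (fun i => ?_) i
    · rw [Finset.sum_eq_zero fun j _ => by simp [bp]]
      by_cases hk : 0 = k
      · subst hk
        rw [Matrix.diagonal_apply_eq, Fin.val_zero, Nat.cast_zero, h.1]
      · rw [Matrix.diagonal_apply_ne _ hk]
    · rw [Finset.sum_eq_single i.castSucc]
      · by_cases hk : i.succ = k
        · subst hk
          simp [bp, bm]
        · rw [Matrix.diagonal_apply_ne _ hk]
          have : k.val ≠ i.val + 1 := fun h => hk (Fin.ext (by simp [h]))
          simp [bm, this]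
      · intro j _ hj
        have : ¬ (i.val + 1 = j.val + 1) := fun h => hj (Fin.ext (by simp; omega))
        simp only [bp, Matrix.of_apply, Fin.val_succ, if_neg this, zero_mul]
      · simp
  have hmp : bm * bp =
      Matrix.diagonal fun j : Fin (n + 1) => Phi γ E ((j.val : ℂ) + (u + 1)) := by
    ext i k
    rw [Matrix.mul_apply]
    refine Fin.lastCases ?_ (fun i => ?_) i
    · rw [Finset.sum_eq_zero fun j _ => by
        have : ¬ (j.val = n + 1) := by omega
        simp only [bm, Matrix.of_apply, Fin.val_last, if_neg this, zero_mul]]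
      by_cases hk : Fin.last n = k
      · subst hk
        rw [Matrix.diagonal_apply_eq, Fin.val_last, ← h.2]
        congr 1
        ring
      · rw [Matrix.diagonal_apply_ne _ hk]
    · rw [Finset.sum_eq_single i.succ]
      · by_cases hk : i.castSucc = k
        · subst hk
          simp only [bm, bp, Matrix.of_apply, Fin.val_succ, Fin.val_castSucc, if_true, mul_one,
            Matrix.diagonal_apply_eq]
          congr 1
          push_cast
          ring
        · rw [Matrix.diagonal_apply_ne _ hk]
          have : ¬ (i.val + 1 = k.val + 1) := fun h => hk (Fin.ext (by simp; omega))
          simp only [bp, Matrix.of_apply, Fin.val_succ, if_neg this, mul_zero]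
      · intro j _ hj
        have : j.val ≠ i.val + 1 := fun h => hj (Fin.ext (by simp [h]))
        simp [bm, this]
      · simp
  refine ⟨_, bm, bp, rfl, ?_, ?_, ?_, ?_⟩
  · ext i j
    rw [lie_diagonal_apply]
    by_cases hij : i.val = j.val + 1
    · simp [bp, hij]
    · simp [bp, hij]
  · ext i j
    rw [lie_diagonal_apply, Matrix.neg_apply]
    by_cases hij : j.val = i.val + 1
    · simp [bm, hij]
    · simp [bm, hij]
  · rw [Phi_diagonal, Phi_diagonal, Ring.lie_def, hpm, hmp]
  · rw [Phi_diagonal, hpm]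

theorem specEqs_iff_hasOscillatorRep (n : ℕ) (u E : ℂ) :
    SpecEqs γ n u E ↔ HasOscillatorRep γ n u E :=
  ⟨SpecEqs.hasOscillatorRep γ, HasOscillatorRep.specEqs γ⟩

end Representation

/-! ### The spectra of types I and II -/

section Spectrum

variable {N : ℕ} (γ : Fin N → ℂ) (n : ℕ)

theorem Phi_complex (E z : ℂ) : Phi γ E z = 1 / 4 * (E - coeffSum γ (2 * Complex.I * z)) *
    (E - coeffSum γ (-2 * Complex.I * (z - 1))) := by
  have e : ∀ c z : ℂ, ∑ k : Fin N, c ^ (k.val + 1) * γ k * z ^ (k.val + 1) =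
      ∑ k : Fin N, γ k * (c * z) ^ (k.val + 1) := fun c z =>
    Finset.sum_congr rfl fun k _ => by rw [mul_pow]; ring
  simp only [Phi, Phi1, Phi2, coeffSum, smul_eq_mul]
  rw [e, e]

theorem coeffSum_mul_sub (c a b : ℂ) : coeffSum γ (c * a) - coeffSum γ (c * b) =
    ∑ k : Fin N, c ^ (k.val + 1) * γ k * (a ^ (k.val + 1) - b ^ (k.val + 1)) := by
  rw [coeffSum, coeffSum, ← Finset.sum_sub_distrib]
  refine Finset.sum_congr rfl fun k _ => ?_
  rw [smul_eq_mul, smul_eq_mul, mul_pow, mul_pow]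
  ring

theorem EI_eq_coeffSum : EI γ n = coeffSum γ (-Complex.I * n) := by
  simp only [EI, coeffSum, smul_eq_mul, mul_pow]
  refine Finset.sum_congr rfl fun k _ => ?_
  ring

theorem EII_eq_coeffSum : EII γ n = coeffSum γ (Complex.I * (n + 2)) := by
  simp only [EII, coeffSum, smul_eq_mul, mul_pow]
  refine Finset.sum_congr rfl fun k _ => ?_
  ring

theorem specEqs_iff (u E : ℂ) : SpecEqs γ n u E ↔
    (E = coeffSum γ (2 * Complex.I * u) ∨ E = coeffSum γ (-2 * Complex.I * (u - 1))) ∧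
    (E = coeffSum γ (2 * Complex.I * (n + 1 + u)) ∨ E = coeffSum γ (-2 * Complex.I * (n + u))) := by
  have h : (n : ℂ) + 1 + u - 1 = n + u := by ring
  rw [SpecEqs, Phi_complex, Phi_complex, zero_add, h]
  simp [sub_eq_zero]

/-- At u = -n/2 the argument of f in Φ₁ at 0 coincides with that in Φ₂ at n + 1, both being -in, so
one value of E meets both conditions. Type II pairs the other two factors, at i(n + 2). -/
theorem specEqs_EI : SpecEqs γ n (-(n : ℂ) / 2) (EI γ n) := by
  rw [specEqs_iff, EI_eq_coeffSum]
  refine ⟨Or.inl ?_, Or.inr ?_⟩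
  · congr 1
    ring
  · congr 1
    ring

theorem specEqs_EII : SpecEqs γ n (-(n : ℂ) / 2) (EII γ n) := by
  rw [specEqs_iff, EII_eq_coeffSum]
  refine ⟨Or.inr ?_, Or.inl ?_⟩
  · congr 1
    ring
  · congr 1
    ring

theorem Phi_EI (B : ℂ) : Phi γ (EI γ n) (B + -(n : ℂ) / 2) = PhiI γ n B := by
  have h1 : 2 * Complex.I * (B + -(n : ℂ) / 2) = -Complex.I * (n - 2 * B) := by ring
  have h2 : -2 * Complex.I * (B + -(n : ℂ) / 2 - 1) = -Complex.I * (2 * B - n - 2) := by ring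
  rw [Phi_complex, EI_eq_coeffSum, PhiI, h1, h2, coeffSum_mul_sub, coeffSum_mul_sub]

theorem Phi_EII (B : ℂ) : Phi γ (EII γ n) (B + -(n : ℂ) / 2) = PhiII γ n B := by
  have h1 : 2 * Complex.I * (B + -(n : ℂ) / 2) = Complex.I * (2 * B - n) := by ring
  have h2 : -2 * Complex.I * (B + -(n : ℂ) / 2 - 1) = Complex.I * (n + 2 - 2 * B) := by ring
  rw [Phi_complex, EII_eq_coeffSum, PhiII, h1, h2, coeffSum_mul_sub, coeffSum_mul_sub]

theorem I_pow_three : Complex.I ^ 3 = -Complex.I := by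
  rw [pow_succ, Complex.I_sq, neg_one_mul]

theorem I_pow_five : Complex.I ^ 5 = Complex.I := by
  rw [pow_succ, Complex.I_pow_four, one_mul]

theorem EI_expand (γ : Fin 5 → ℂ) : EI γ n = -(Complex.I * γ 0 * n + γ 1 * n ^ 2
    - Complex.I * γ 2 * n ^ 3 - γ 3 * n ^ 4 + Complex.I * γ 4 * n ^ 5) := by
  have h2 := Complex.I_sq
  have h3 := I_pow_three
  have h4 := Complex.I_pow_four
  have h5 := I_pow_five
  simp only [EI, Fin.sum_univ_five, Fin.isValue, Fin.coe_ofNat_eq_mod, Nat.zero_mod, Nat.one_mod,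
    Nat.reduceMod, Nat.reduceAdd, zero_add]
  linear_combination γ 1 * n ^ 2 * h2 - γ 2 * n ^ 3 * h3 + γ 3 * n ^ 4 * h4 - γ 4 * n ^ 5 * h5

theorem EII_expand (γ : Fin 5 → ℂ) : EII γ n = Complex.I * γ 0 * (n + 2) - γ 1 * (n + 2) ^ 2
    - Complex.I * γ 2 * (n + 2) ^ 3 + γ 3 * (n + 2) ^ 4 + Complex.I * γ 4 * (n + 2) ^ 5 := by
  have h2 := Complex.I_sq
  have h3 := I_pow_three
  have h4 := Complex.I_pow_four
  have h5 := I_pow_five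
  simp only [EII, Fin.sum_univ_five, Fin.isValue, Fin.coe_ofNat_eq_mod, Nat.zero_mod, Nat.one_mod,
    Nat.reduceMod, Nat.reduceAdd, zero_add]
  linear_combination γ 1 * (n + 2) ^ 2 * h2 + γ 2 * (n + 2) ^ 3 * h3 + γ 3 * (n + 2) ^ 4 * h4
    + γ 4 * (n + 2) ^ 5 * h5

theorem sum_castLE_of_eq_zero {M : Type*} [AddCommMonoid M] {N N' : ℕ} (hN : N ≤ N')
    (f : ℕ → ℂ → M) (hf : ∀ k, f k 0 = 0) (γ : Fin N' → ℂ) (hγ : ∀ k : Fin N', N ≤ k.val → γ k = 0) :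
    ∑ k : Fin N', f k.val (γ k) = ∑ k : Fin N, f k.val (γ (Fin.castLE hN k)) := by
  symm
  refine Finset.sum_of_injOn (Fin.castLE hN) (Fin.castLE_injective hN).injOn (by simp) ?_ (by simp)
  intro k _ hk
  rw [hγ k, hf]
  by_contra hlt
  push Not at hlt
  exact hk ⟨⟨k.val, hlt⟩, by simp, rfl⟩

end Spectrum

/-! ### Local rigidity of continuous solutions -/

open Filter Topology

section Uniqueness

variable {X : Type*} [TopologicalSpace X] {γ : X → Fin 5 → ℂ} {u E : X → ℂ} {n : ℕ}

theorem continuous_coeffSum {N : ℕ} {γ : X → Fin N → ℂ} {z : X → ℂ} (hγ : Continuous γ)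
    (hz : Continuous z) : Continuous fun x => coeffSum (γ x) (z x) := by
  unfold coeffSum
  fun_prop

theorem continuous_divDiff {N : ℕ} {γ : X → Fin N → ℂ} {y z : X → ℂ} (hγ : Continuous γ)
    (hy : Continuous y) (hz : Continuous z) : Continuous fun x => divDiff (γ x) (y x) (z x) := by
  unfold divDiff
  fun_prop

theorem eq_of_coeffSum_eq {N : ℕ} {γ : Fin N → ℂ} {y z : ℂ} (h : coeffSum γ y = coeffSum γ z)
    (hd : divDiff γ y z ≠ 0) : y = z := by
  have := divDiff_mul_sub γ (Commute.all y z)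
  rw [h, sub_self] at this
  exact sub_eq_zero.1 ((mul_eq_zero.1 this).resolve_left hd)

theorem eventually_ne_of_continuous {f g : X → ℂ} (hf : Continuous f) (hg : Continuous g) {x₀ : X}
    (h : f x₀ ≠ g x₀) : ∀ᶠ x in 𝓝 x₀, f x ≠ g x :=
  (isOpen_ne_fun hf hg).mem_nhds h

/-- Near a parameter at which the two energies differ and the critical values are simple, a
continuous solution of type I stays of type I. -/
theorem eventually_typeI {N : ℕ} {γ : X → Fin N → ℂ} (hγ : Continuous γ) (hu : Continuous u)
    (hE : Continuous E) (hs : ∀ x, SpecEqs (γ x) n (u x) (E x)) {x₀ : X}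
    (hu₀ : u x₀ = -(n : ℂ) / 2) (hE₀ : E x₀ = EI (γ x₀) n)
    (hne : EI (γ x₀) n ≠ EII (γ x₀) n)
    (hd : divDiff (γ x₀) (-Complex.I * n) (-Complex.I * n) ≠ 0) :
    ∀ᶠ x in 𝓝 x₀, u x = -(n : ℂ) / 2 ∧ E x = EI (γ x) n := by
  have e1 : -2 * Complex.I * (u x₀ - 1) = Complex.I * (n + 2) := by rw [hu₀]; ring
  have e2 : 2 * Complex.I * (n + 1 + u x₀) = Complex.I * (n + 2) := by rw [hu₀]; ring
  have e3 : 2 * Complex.I * u x₀ = -Complex.I * n := by rw [hu₀]; ring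
  have e4 : -2 * Complex.I * (n + u x₀) = -Complex.I * n := by rw [hu₀]; ring
  -- At the base point the two competing factors take the value E_I - E_II ≠ 0, so by continuity
  -- they stay nonzero nearby and the other two factors must vanish.
  have h1 : ∀ᶠ x in 𝓝 x₀, E x ≠ coeffSum (γ x) (-2 * Complex.I * (u x - 1)) := by
    refine eventually_ne_of_continuous hE
      (continuous_coeffSum hγ (show Continuous fun x => -2 * Complex.I * (u x - 1) by fun_prop)) ?_
    rw [e1, hE₀, ← EII_eq_coeffSum]
    exact hne
  have h2 : ∀ᶠ x in 𝓝 x₀, E x ≠ coeffSum (γ x) (2 * Complex.I * (n + 1 + u x)) := by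
    refine eventually_ne_of_continuous hE
      (continuous_coeffSum hγ (show Continuous fun x => 2 * Complex.I * (n + 1 + u x) by fun_prop)) ?_
    rw [e2, hE₀, ← EII_eq_coeffSum]
    exact hne
  -- The divided difference on the diagonal is the derivative of f; where it is nonzero, f separates
  -- nearby points, so equal values force equal arguments and hence u = -n/2.
  have h3 : ∀ᶠ x in 𝓝 x₀,
      divDiff (γ x) (2 * Complex.I * u x) (-2 * Complex.I * (n + u x)) ≠ 0 := by
    refine (continuous_divDiff hγ (by fun_prop) (by fun_prop)).continuousAt.eventually_ne ?_
    rw [e3, e4]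
    exact hd
  filter_upwards [h1, h2, h3] with x h1 h2 h3
  obtain ⟨h4, h5⟩ := (specEqs_iff _ _ _ _).1 (hs x)
  have h6 := h4.resolve_right h1
  have h7 := h5.resolve_left h2
  have h8 := eq_of_coeffSum_eq (h6.symm.trans h7) h3
  have h9 : u x = -(n : ℂ) / 2 := by
    refine mul_left_cancel₀ (show (4 : ℂ) * Complex.I ≠ 0 by simp) ?_
    linear_combination h8
  refine ⟨h9, ?_⟩
  rw [h6, EI_eq_coeffSum, h9]
  congr 1
  ring

/-- The same for type II. -/
theorem eventually_typeII {N : ℕ} {γ : X → Fin N → ℂ} (hγ : Continuous γ) (hu : Continuous u)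
    (hE : Continuous E) (hs : ∀ x, SpecEqs (γ x) n (u x) (E x)) {x₀ : X}
    (hu₀ : u x₀ = -(n : ℂ) / 2) (hE₀ : E x₀ = EII (γ x₀) n)
    (hne : EI (γ x₀) n ≠ EII (γ x₀) n)
    (hd : divDiff (γ x₀) (Complex.I * (n + 2)) (Complex.I * (n + 2)) ≠ 0) :
    ∀ᶠ x in 𝓝 x₀, u x = -(n : ℂ) / 2 ∧ E x = EII (γ x) n := by
  have e1 : -2 * Complex.I * (u x₀ - 1) = Complex.I * (n + 2) := by rw [hu₀]; ring
  have e2 : 2 * Complex.I * (n + 1 + u x₀) = Complex.I * (n + 2) := by rw [hu₀]; ring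
  have e3 : 2 * Complex.I * u x₀ = -Complex.I * n := by rw [hu₀]; ring
  have e4 : -2 * Complex.I * (n + u x₀) = -Complex.I * n := by rw [hu₀]; ring
  have h1 : ∀ᶠ x in 𝓝 x₀, E x ≠ coeffSum (γ x) (2 * Complex.I * u x) := by
    refine eventually_ne_of_continuous hE
      (continuous_coeffSum hγ (show Continuous fun x => 2 * Complex.I * u x by fun_prop)) ?_
    rw [e3, hE₀, ← EI_eq_coeffSum]
    exact hne.symm
  have h2 : ∀ᶠ x in 𝓝 x₀, E x ≠ coeffSum (γ x) (-2 * Complex.I * (n + u x)) := by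
    refine eventually_ne_of_continuous hE
      (continuous_coeffSum hγ (show Continuous fun x => -2 * Complex.I * (n + u x) by fun_prop)) ?_
    rw [e4, hE₀, ← EI_eq_coeffSum]
    exact hne.symm
  have h3 : ∀ᶠ x in 𝓝 x₀,
      divDiff (γ x) (-2 * Complex.I * (u x - 1)) (2 * Complex.I * (n + 1 + u x)) ≠ 0 := by
    refine (continuous_divDiff hγ (by fun_prop) (by fun_prop)).continuousAt.eventually_ne ?_
    rw [e1, e2]
    exact hd
  filter_upwards [h1, h2, h3] with x h1 h2 h3
  obtain ⟨h4, h5⟩ := (specEqs_iff _ _ _ _).1 (hs x)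
  have h6 := h4.resolve_left h1
  have h7 := h5.resolve_right h2
  have h8 := eq_of_coeffSum_eq (h6.symm.trans h7) h3
  have h9 : u x = -(n : ℂ) / 2 := by
    refine mul_left_cancel₀ (show (4 : ℂ) * Complex.I ≠ 0 by simp) ?_
    linear_combination -h8
  refine ⟨h9, ?_⟩
  rw [h6, EII_eq_coeffSum, h9]
  congr 1
  ring

/-- For a Hamiltonian with a linear term only, the solutions are those of types I and II. -/
theorem type_of_linear {c : ℂ} (hc : c ≠ 0) {γ : Fin 5 → ℂ} (hγ : γ = Pi.single 0 c) {u E : ℂ}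
    (h : SpecEqs γ n u E) : u = -(n : ℂ) / 2 ∧ (E = EI γ n ∨ E = EII γ n) := by
  have hf : ∀ z, coeffSum γ z = c * z := by
    intro z
    simp [coeffSum, hγ, Fin.sum_univ_succ]
  have hI := Complex.I_ne_zero
  have hn : (n : ℂ) + 1 ≠ 0 := Nat.cast_add_one_ne_zero n
  rw [specEqs_iff] at h
  rw [EI_eq_coeffSum, EII_eq_coeffSum]
  simp only [hf] at h ⊢
  have hcI : 4 * (c * Complex.I) ≠ 0 := 
    mul_ne_zero (by norm_num) (mul_ne_zero hc hI)
  have hcn : 2 * (c * Complex.I) * (n + 1) ≠ 0 :=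
    mul_ne_zero (mul_ne_zero two_ne_zero (mul_ne_zero hc hI)) hn
  obtain ⟨h1 | h1, h2 | h2⟩ := h
  · exact absurd (by linear_combination h1 - h2) hcn
  · have h3 : u = -(n : ℂ) / 2 := by
      refine mul_left_cancel₀ hcI ?_
      linear_combination h2 - h1
    refine ⟨h3, Or.inl ?_⟩
    rw [h1, h3]
    ring
  · have h3 : u = -(n : ℂ) / 2 := by
      refine mul_left_cancel₀ hcI ?_
      linear_combination h1 - h2
    refine ⟨h3, Or.inr ?_⟩
    rw [h1, h3]
    ring
  · exact absurd (by linear_combination h2 - h1) hcn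

theorem EI_ne_EII {N : ℕ} {γ : Fin N → ℂ}
    (h : divDiff γ (-Complex.I * n) (Complex.I * (n + 2)) ≠ 0) : EI γ n ≠ EII γ n := by
  intro h'
  rw [EI_eq_coeffSum, EII_eq_coeffSum] at h'
  have hn : (n : ℂ) + 1 ≠ 0 := Nat.cast_add_one_ne_zero n
  refine mul_ne_zero (show (2 : ℂ) * Complex.I ≠ 0 by simp) hn ?_
  linear_combination -(eq_of_coeffSum_eq h' h)

theorem divDiff_linear (c y z : ℂ) : divDiff (Pi.single 0 c : Fin 5 → ℂ) y z = c := by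
  simp [divDiff, Fin.sum_univ_succ]

theorem divDiff_add {N : ℕ} (γ γ' : Fin N → ℂ) (y z : ℂ) :
    divDiff (γ + γ') y z = divDiff γ y z + divDiff γ' y z := by
  simp [divDiff, add_mul, Finset.sum_add_distrib]

theorem divDiff_smul {N : ℕ} (s : ℂ) (γ : Fin N → ℂ) (y z : ℂ) :
    divDiff (s • γ) y z = s * divDiff γ y z := by
  simp [divDiff, Finset.mul_sum, mul_assoc]

/-- The divided difference is linear in the coefficients, hence affine in s along a line. As it is
nonzero at s = 0, it has at most one zero. -/
theorem finite_divDiff_eq_zero {N : ℕ} {γ : Fin N → ℂ} {y z : ℂ} (h : divDiff γ y z ≠ 0)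
    (v : Fin N → ℂ) : {s : ℂ | divDiff (γ + s • v) y z = 0}.Finite := by
  refine (Set.finite_singleton (-divDiff γ y z / divDiff v y z)).subset fun s hs => ?_
  rw [Set.mem_ofPred_eq, divDiff_add, divDiff_smul] at hs
  have hv : divDiff v y z ≠ 0 := by
    intro hv
    rw [hv, mul_zero, add_zero] at hs
    exact h hs
  rw [Set.mem_singleton_iff, eq_div_iff hv]
  linear_combination hs

/-- A closed subset of the complex plane that is a neighbourhood of each of its points outside a
finite set, and has such a point, is the whole plane. -/
theorem eq_univ_of_isClosed_of_finite {T F : Set ℂ} (hT : IsClosed T) (hF : F.Finite)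
    {s₀ : ℂ} (hs₀ : s₀ ∈ T) (hs₀F : s₀ ∉ F) (h : ∀ s ∈ T, s ∉ F → T ∈ 𝓝 s) : T = Set.univ := by
  have hrank : 1 < Module.rank ℝ ℂ := by
    rw [Complex.rank_real_complex]
    exact Nat.one_lt_ofNat
  -- Removing finitely many points leaves the plane connected; the corresponding statement fails for
  -- a real line.
  have hV : IsPreconnected Fᶜ :=
    (hF.countable.isPathConnected_compl_of_one_lt_rank hrank).isConnected.isPreconnected
  have h1 : Fᶜ ⊆ interior T := by
    refine hV.subset_of_closure_inter_subset isOpen_interior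
      ⟨s₀, hs₀F, mem_interior_iff_mem_nhds.2 (h s₀ hs₀ hs₀F)⟩ ?_
    rintro s ⟨hs, hsF⟩
    exact mem_interior_iff_mem_nhds.2
      (h s (hT.closure_subset_iff.2 interior_subset hs) hsF)
  have h2 : Dense Fᶜ := hF.countable.dense_compl ℝ
  rw [Set.eq_univ_iff_forall]
  intro s
  exact hT.closure_subset_iff.2 (h1.trans interior_subset) (h2 s)

end Uniqueness

/-! ### Global classification of the solutions -/

section Classification

variable {n : ℕ}

theorem continuous_EI : Continuous fun γ : Fin 5 → ℂ => EI γ n := by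
  unfold EI
  fun_prop

theorem continuous_EII : Continuous fun γ : Fin 5 → ℂ => EII γ n := by
  unfold EII
  fun_prop

/-- A continuous solution on `ℂ⁵` that is of one of the types at a linear Hamiltonian is of that
type everywhere. -/
theorem type_everywhere {u E e : (Fin 5 → ℂ) → ℂ} (hu : Continuous u) (hE : Continuous E)
    (he : Continuous e) {c : ℂ}
    (y₁ z₁ y₂ z₂ : ℂ)
    (h : ∀ {f : ℂ → Fin 5 → ℂ}, Continuous f → ∀ s : ℂ,
      u (f s) = -(n : ℂ) / 2 → E (f s) = e (f s) →
      divDiff (f s) y₁ z₁ ≠ 0 → divDiff (f s) y₂ z₂ ≠ 0 →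
      ∀ᶠ s' in 𝓝 s, u (f s') = -(n : ℂ) / 2 ∧ E (f s') = e (f s'))
    (hc : c ≠ 0) (hu₀ : u (Pi.single 0 c) = -(n : ℂ) / 2)
    (hE₀ : E (Pi.single 0 c) = e (Pi.single 0 c)) (γ : Fin 5 → ℂ) :
    u γ = -(n : ℂ) / 2 ∧ E γ = e γ := by
  -- The complex line joining the linear Hamiltonian, at s = 0, to the given one, at s = 1.
  let f : ℂ → Fin 5 → ℂ := fun s => Pi.single 0 c + s • (γ - Pi.single 0 c)
  have hf : Continuous f := by fun_prop
  have hd : ∀ y z : ℂ, divDiff (Pi.single 0 c : Fin 5 → ℂ) y z ≠ 0 := fun y z => by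
    rwa [divDiff_linear]
  have hf₀ : f 0 = Pi.single 0 c := by simp [f]
  have hf₁ : f 1 = γ := by simp [f]
  -- The two exceptional sets contain the parameters where E_I = E_II or where the derivative of f
  -- vanishes at the relevant argument. The point s = 1 may be exceptional; closedness of the
  -- solution set covers it.
  have hT : {s | u (f s) = -(n : ℂ) / 2 ∧ E (f s) = e (f s)} = Set.univ := by
    refine eq_univ_of_isClosed_of_finite (s₀ := 0)
      (F := {s | divDiff (f s) y₁ z₁ = 0} ∪ {s | divDiff (f s) y₂ z₂ = 0}) ?_
      ((finite_divDiff_eq_zero (hd y₁ z₁) _).union (finite_divDiff_eq_zero (hd y₂ z₂) _)) ?_ ?_ ?_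
    · exact (isClosed_eq (hu.comp hf) continuous_const).inter
        (isClosed_eq (hE.comp hf) (he.comp hf))
    · rw [Set.mem_ofPred_eq, hf₀]
      exact ⟨hu₀, hE₀⟩
    · rw [Set.mem_union, Set.mem_ofPred_eq, Set.mem_ofPred_eq, hf₀]
      exact not_or.2 ⟨hd _ _, hd _ _⟩
    · rintro s ⟨hs₁, hs₂⟩ hs
      obtain ⟨hs₃, hs₄⟩ := not_or.1 hs
      exact h hf s hs₁ hs₂ hs₃ hs₄
  rw [← hf₁]
  exact Set.eq_univ_iff_forall.1 hT 1

theorem continuous_solutions (u E : (Fin 5 → ℂ) → ℂ) (hu : Continuous u) (hE : Continuous E) :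
    (∀ γ, SpecEqs γ n (u γ) (E γ)) ↔
      ((∀ γ, u γ = -(n : ℂ) / 2 ∧ E γ = EI γ n) ∨
       (∀ γ, u γ = -(n : ℂ) / 2 ∧ E γ = EII γ n)) := by
  constructor
  · intro h
    obtain ⟨h₁, h₂ | h₂⟩ := type_of_linear one_ne_zero rfl (h (Pi.single 0 1))
    · refine Or.inl (type_everywhere hu hE continuous_EI
        (-Complex.I * n) (Complex.I * (n + 2)) (-Complex.I * n) (-Complex.I * n) ?_
        one_ne_zero h₁ h₂)
      intro f hf s hs₁ hs₂ hd₁ hd₂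
      exact eventually_typeI hf (hu.comp hf) (hE.comp hf) (fun s => h (f s)) hs₁ hs₂
        (EI_ne_EII hd₁) hd₂
    · refine Or.inr (type_everywhere hu hE continuous_EII
        (-Complex.I * n) (Complex.I * (n + 2)) (Complex.I * (n + 2)) (Complex.I * (n + 2)) ?_
        one_ne_zero h₁ h₂)
      intro f hf s hs₁ hs₂ hd₁ hd₂
      exact eventually_typeII hf (hu.comp hf) (hE.comp hf) (fun s => h (f s)) hs₁ hs₂
        (EI_ne_EII hd₁) hd₂
  · rintro (h | h) γ
    · rw [(h γ).1, (h γ).2]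
      exact specEqs_EI γ n
    · rw [(h γ).1, (h γ).2]
      exact specEqs_EII γ n

theorem analyticOnNhd_coeff (θ : Fin 5 → ℂ) (k : Fin 5) :
    AnalyticOnNhd ℝ (fun t : Fin 5 → ℝ => θ k * (t k : ℂ)) Set.univ := fun t _ =>
  analyticAt_const.mul
    ((Complex.ofRealCLM.comp (ContinuousLinearMap.proj (R := ℝ) (φ := fun _ : Fin 5 => ℝ) k)).analyticAt t)

theorem analyticOnNhd_EI (θ : Fin 5 → ℂ) :
    AnalyticOnNhd ℝ (fun t : Fin 5 → ℝ => EI (fun k => θ k * (t k : ℂ)) n) Set.univ := by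
  unfold EI
  exact Finset.analyticOnNhd_fun_sum _ fun k _ =>
    (analyticOnNhd_const.mul (analyticOnNhd_coeff θ k)).mul analyticOnNhd_const

theorem analyticOnNhd_EII (θ : Fin 5 → ℂ) :
    AnalyticOnNhd ℝ (fun t : Fin 5 → ℝ => EII (fun k => θ k * (t k : ℂ)) n) Set.univ := by
  unfold EII
  exact Finset.analyticOnNhd_fun_sum _ fun k _ =>
    (analyticOnNhd_const.mul (analyticOnNhd_coeff θ k)).mul analyticOnNhd_const

/-- With real parameters the exceptional points may disconnect a line, so propagation by continuity
is not available. Instead the type is fixed on a neighbourhood of one linear Hamiltonian and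
extended by the identity theorem. -/
theorem analytic_solutions (θ : Fin 5 → ℂ) (hθ : θ 0 ≠ 0) (u E : (Fin 5 → ℝ) → ℂ)
    (hu : AnalyticOnNhd ℝ u Set.univ) (hE : AnalyticOnNhd ℝ E Set.univ) :
    (∀ t, SpecEqs (fun k => θ k * (t k : ℂ)) n (u t) (E t)) ↔
      ((∀ t, u t = -(n : ℂ) / 2 ∧ E t = EI (fun k => θ k * (t k : ℂ)) n) ∨
       (∀ t, u t = -(n : ℂ) / 2 ∧ E t = EII (fun k => θ k * (t k : ℂ)) n)) := by
  constructor
  · intro h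
    let t₀ : Fin 5 → ℝ := Pi.single 0 1
    have ht₀ : (fun k => θ k * (t₀ k : ℂ)) = Pi.single 0 (θ 0) := by
      funext k
      by_cases hk : k = 0
      · subst hk
        simp [t₀]
      · simp [t₀, hk]
    have hγ : Continuous fun (t : Fin 5 → ℝ) k => θ k * (t k : ℂ) := by fun_prop
    have hu' : Continuous u := continuousOn_univ.1 hu.continuousOn
    have hE' : Continuous E := continuousOn_univ.1 hE.continuousOn
    have hd : ∀ y z : ℂ, divDiff (fun k => θ k * (t₀ k : ℂ)) y z ≠ 0 := fun y z => by
      rwa [ht₀, divDiff_linear]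
    obtain ⟨h₁, h₂ | h₂⟩ := type_of_linear hθ ht₀ (h t₀)
    · have h₃ := eventually_typeI hγ hu' hE' h h₁ h₂ (EI_ne_EII (hd _ _)) (hd _ _)
      have h₄ := hu.eq_of_eventuallyEq analyticOnNhd_const (h₃.mono fun _ => And.left)
      have h₅ := hE.eq_of_eventuallyEq (analyticOnNhd_EI θ) (h₃.mono fun _ => And.right)
      exact Or.inl fun t => ⟨congrFun h₄ t, congrFun h₅ t⟩
    · have h₃ := eventually_typeII hγ hu' hE' h h₁ h₂ (EI_ne_EII (hd _ _)) (hd _ _)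
      have h₄ := hu.eq_of_eventuallyEq analyticOnNhd_const (h₃.mono fun _ => And.left)
      have h₅ := hE.eq_of_eventuallyEq (analyticOnNhd_EII θ) (h₃.mono fun _ => And.right)
      exact Or.inr fun t => ⟨congrFun h₄ t, congrFun h₅ t⟩
  · rintro (h | h) t
    · rw [(h t).1, (h t).2]
      exact specEqs_EI _ n
    · rw [(h t).1, (h t).2]
      exact specEqs_EII _ n

end Classification

/-! ### Commutation relations in the abstract canonical algebra -/

section Algebra

variable {A : Type*} [Ring A] [Algebra ℂ A] (w : Weyl A) (γ : Fin 5 → ℂ)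

theorem Weyl.ham_eq_symI_add :
    w.ham γ = w.symI γ + w.symIPrime γ - (4 * γ 3) • w.ang ^ 2 + γ 3 • w.ang ^ 4 := by
  rw [Weyl.symI]
  abel

theorem Weyl.lie_number_ladder {ε : ℂ} (hε : ε ^ 2 = 1) :
    ⁅(1 / 2 : ℂ) • w.ang, w.ladder γ ε⁆ = ε • w.ladder γ ε := by
  rw [Ring.lie_def, smul_mul_assoc, mul_smul_comm, ← smul_sub, ← Ring.lie_def,
    w.lie_ang_ladder γ hε, smul_smul]
  congr 1
  ring

theorem Weyl.commute_ham_number : Commute (w.ham γ) ((1 / 2 : ℂ) • w.ang) :=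
  Commute.smul_right (w.ang_mul_ham γ).symm _

theorem Weyl.lie_lower_raise :
    ⁅w.ladder γ (-1), w.ladder γ 1⁆ = Phi γ (w.ham γ) ((1 / 2 : ℂ) • w.ang + 1)
      - Phi γ (w.ham γ) ((1 / 2 : ℂ) • w.ang) := by
  rw [Ring.lie_def, w.lower_mul_raise_eq_Phi, w.ladder_mul_ladder_eq_Phi]

theorem Weyl.number_ladder_relations :
    ⁅(1 / 2 : ℂ) • w.ang, w.ladder γ 1⁆ = w.ladder γ 1 ∧
    ⁅(1 / 2 : ℂ) • w.ang, w.ladder γ (-1)⁆ = -w.ladder γ (-1) ∧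
    ⁅w.ladder γ (-1), w.ladder γ 1⁆ = Phi γ (w.ham γ) ((1 / 2 : ℂ) • w.ang + 1)
      - Phi γ (w.ham γ) ((1 / 2 : ℂ) • w.ang) ∧
    w.ladder γ 1 * w.ladder γ (-1) = Phi γ (w.ham γ) ((1 / 2 : ℂ) • w.ang) ∧
    ⁅Phi1 γ (w.ham γ) ((1 / 2 : ℂ) • w.ang), Phi2 γ (w.ham γ) ((1 / 2 : ℂ) • w.ang)⁆ = 0 := by
  refine ⟨?_, ?_, w.lie_lower_raise γ, w.ladder_mul_ladder_eq_Phi γ,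
    (commute_Phi1_Phi2 γ (w.commute_ham_number γ)).lie_eq⟩
  · rw [w.lie_number_ladder γ (one_pow 2), one_smul]
  · rw [w.lie_number_ladder γ (by norm_num), neg_one_smul]

theorem Weyl.lie_lower_raise_eq_sum :
    ⁅w.ladder γ (-1), w.ladder γ 1⁆ = ∑ j : Fin 5,
      Polynomial.aeval (w.ham γ) (structurePoly γ j) * ((1 / 2 : ℂ) • w.ang) ^ (2 * j.val + 1) := by
  rw [w.lie_lower_raise, Phi_succ_sub γ (w.commute_ham_number γ)]

theorem Weyl.lie_K2_K3_eq_sum :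
    ⁅w.K2 γ, w.K3 γ⁆ = ∑ j : Fin 5,
      Polynomial.aeval (w.ham γ) (structurePoly γ j) * ((1 / 2 : ℂ) • w.ang) ^ (2 * j.val + 1)
      + (4 * (γ 1 - 4 * γ 3)) • (w.ang * w.K2 γ) - (2 * (γ 1 - 4 * γ 3)) • w.K3 γ
      - (2 * (γ 1 - 4 * γ 3) ^ 2) • w.ang ^ 3 := by
  rw [w.lie_K2_K3, w.lie_lower_raise_eq_sum]

theorem Weyl.shifted_ladder_relations (u : ℂ) (B : A)
    (hB : B = (1 / 2 : ℂ) • w.ang - u • (1 : A)) :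
    ⁅B, w.ladder γ 1⁆ = w.ladder γ 1 ∧ ⁅B, w.ladder γ (-1)⁆ = -w.ladder γ (-1) ∧
    ⁅w.ladder γ (-1), w.ladder γ 1⁆ =
      Phi γ (w.ham γ) (B + (u + 1) • (1 : A)) - Phi γ (w.ham γ) (B + u • (1 : A)) ∧
    w.ladder γ 1 * w.ladder γ (-1) = Phi γ (w.ham γ) (B + u • (1 : A)) := by
  obtain ⟨h1, h2, h3, h4, -⟩ := w.number_ladder_relations γ
  have hlie : ∀ X : A, ⁅B, X⁆ = ⁅(1 / 2 : ℂ) • w.ang, X⁆ := fun X => by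
    rw [hB, Ring.lie_def, Ring.lie_def, sub_mul, mul_sub, smul_mul_assoc u, mul_smul_comm u,
      one_mul,
      mul_one]
    abel
  have e1 : B + u • (1 : A) = (1 / 2 : ℂ) • w.ang := by rw [hB, sub_add_cancel]
  have e2 : B + (u + 1) • (1 : A) = (1 / 2 : ℂ) • w.ang + 1 := by
    rw [add_smul, one_smul, ← add_assoc, e1]
  rw [hlie, hlie, e1, e2]
  exact ⟨h1, h2, h3, h4⟩

end Algebra

/-! ### Transfer to the operators on smooth functions -/

theorem Weyl.raise_eq_of_eq {A : Type*} [Ring A] [Algebra ℂ A] (w : Weyl A) {γ : Fin 5 → ℂ}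
    {X Y : A} (hX : X = w.K2 γ) (hY : Y = w.K3 γ) :
    X + (1 / 2 : ℂ) • Y - (γ 1 / 2 - 2 * γ 3) • w.ang ^ 2 = w.ladder γ 1 := by
  rw [hX, hY, w.raise_eq]

theorem Weyl.lower_eq_of_eq {A : Type*} [Ring A] [Algebra ℂ A] (w : Weyl A) {γ : Fin 5 → ℂ}
    {X Y : A} (hX : X = w.K2 γ) (hY : Y = w.K3 γ) :
    X - (1 / 2 : ℂ) • Y - (γ 1 / 2 - 2 * γ 3) • w.ang ^ 2 = w.ladder γ (-1) := by
  rw [hX, hY, w.lower_eq]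

theorem ham_eq_weylOp (γ : Fin 5 → ℂ) : ham γ = weylOp.ham γ := rfl

theorem K1_eq_weylOp : K1 = weylOp.ang := rfl

theorem numK_eq_weylOp : numK = (1 / 2 : ℂ) • weylOp.ang := rfl

theorem symIPrime_eq_weylOp (γ : Fin 5 → ℂ) : symIPrime γ = weylOp.symIPrime γ := rfl

theorem symI_eq_weylOp (γ : Fin 5 → ℂ) : symI γ = weylOp.symI γ := rfl

theorem K2_eq_weylOp (γ : Fin 5 → ℂ) : K2 γ = weylOp.K2 γ :=
  congrArg₂ (fun X Y : Op => (1 / 2 : ℂ) • (X - Y)) (symIPrime_eq_weylOp γ) (symI_eq_weylOp γ)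

theorem K3_eq_weylOp (γ : Fin 5 → ℂ) : K3 γ = weylOp.K3 γ :=
  congrArg (fun X : Op => ⁅angMom, X⁆) (K2_eq_weylOp γ)

theorem raiseK_eq (γ : Fin 5 → ℂ) : raiseK γ = weylOp.ladder γ 1 :=
  weylOp.raise_eq_of_eq (K2_eq_weylOp γ) (K3_eq_weylOp γ)

theorem lowerK_eq (γ : Fin 5 → ℂ) : lowerK γ = weylOp.ladder γ (-1) :=
  weylOp.lower_eq_of_eq (K2_eq_weylOp γ) (K3_eq_weylOp γ)

theorem symIPrime_notMem_orderLE {γ : Fin 5 → ℂ} (h : γ 4 ≠ 0) : symIPrime γ ∉ orderLE 4 := by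
  rw [symIPrime_eq_weylOp]
  intro h'
  obtain ⟨f, hf, hf', -⟩ := weylOp.exists_symbol_symIPrime γ
  rw [hf] at h'
  have := weylOp.fifthDiff_eq_zero normalOrder_injective 1 0 1 0 (f := f) h'
  rw [hf'] at this
  exact h (by simpa using this)

theorem symI_notMem_orderLE {γ : Fin 5 → ℂ} (h : γ 4 ≠ 0) : symI γ ∉ orderLE 4 := by
  rw [symI_eq_weylOp]
  intro h'
  obtain ⟨f, hf, hf'⟩ := weylOp.exists_symbol_symI γ
  rw [hf] at h'
  have := weylOp.fifthDiff_eq_zero normalOrder_injective 0 1 0 1 (f := f) h'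
  rw [hf'] at this
  exact h (by simpa using this)

section Transport

attribute [local irreducible] Weyl.ladder Weyl.ham Weyl.ang Weyl.K2 Weyl.K3 Phi Phi1 Phi2

theorem numK_ladder_relations (γ : Fin 5 → ℂ) :
    ⁅numK, raiseK γ⁆ = raiseK γ ∧ ⁅numK, lowerK γ⁆ = -lowerK γ ∧
    ⁅lowerK γ, raiseK γ⁆ = Phi γ (ham γ) (numK + 1) - Phi γ (ham γ) numK ∧
    raiseK γ * lowerK γ = Phi γ (ham γ) numK ∧
    ⁅Phi1 γ (ham γ) numK, Phi2 γ (ham γ) numK⁆ = 0 := by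
  rw [raiseK_eq, lowerK_eq, ham_eq_weylOp, numK_eq_weylOp]
  exact weylOp.number_ladder_relations γ

theorem shifted_numK_ladder_relations (γ : Fin 5 → ℂ) (u : ℂ) (B : Op)
    (hB : B = numK - u • (1 : Op)) :
    ⁅B, raiseK γ⁆ = raiseK γ ∧ ⁅B, lowerK γ⁆ = -lowerK γ ∧
    ⁅lowerK γ, raiseK γ⁆ =
      Phi γ (ham γ) (B + (u + 1) • (1 : Op)) - Phi γ (ham γ) (B + u • (1 : Op)) ∧
    raiseK γ * lowerK γ = Phi γ (ham γ) (B + u • (1 : Op)) := by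
  rw [numK_eq_weylOp] at hB
  rw [raiseK_eq, lowerK_eq, ham_eq_weylOp]
  exact weylOp.shifted_ladder_relations γ u B hB

theorem lie_lowerK_raiseK (γ : Fin 5 → ℂ) :
    ⁅lowerK γ, raiseK γ⁆ = ∑ j : Fin 5,
      Polynomial.aeval (ham γ) (structurePoly γ j) * numK ^ (2 * j.val + 1) := by
  rw [raiseK_eq, lowerK_eq, ham_eq_weylOp, numK_eq_weylOp]
  exact weylOp.lie_lower_raise_eq_sum γ

theorem lie_K1_K3 (γ : Fin 5 → ℂ) :
    ⁅K1, K3 γ⁆ = (4 : ℂ) • K2 γ - (2 * (γ 1 - 4 * γ 3)) • K1 ^ 2 := by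
  rw [K1_eq_weylOp, K2_eq_weylOp, K3_eq_weylOp]
  exact weylOp.lie_ang_K3 γ

theorem lie_K2_K3 (γ : Fin 5 → ℂ) :
    ⁅K2 γ, K3 γ⁆ = ∑ j : Fin 5,
      Polynomial.aeval (ham γ) (structurePoly γ j) * ((1 / 2 : ℂ) • K1) ^ (2 * j.val + 1)
      + (4 * (γ 1 - 4 * γ 3)) • (K1 * K2 γ) - (2 * (γ 1 - 4 * γ 3)) • K3 γ
      - (2 * (γ 1 - 4 * γ 3) ^ 2) • K1 ^ 3 := by
  rw [K1_eq_weylOp, K2_eq_weylOp, K3_eq_weylOp, ham_eq_weylOp]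
  exact weylOp.lie_K2_K3_eq_sum γ

end Transport

theorem ham_castLE {γ : Fin 5 → ℂ} {N : ℕ} (hN : N ≤ 5) (h : ∀ k : Fin 5, N ≤ k.val → γ k = 0) :
    ham γ = ham (fun k : Fin N => γ (Fin.castLE hN k)) :=
  congrArg (p₁ ^ 2 + p₂ ^ 2 + ·) (sum_castLE_of_eq_zero hN
    (fun k c => c • (q₁ * p₁ + q₂ * p₂) ^ (k + 1)) (fun _ => zero_smul ℂ _) γ h)

theorem EI_castLE {γ : Fin 5 → ℂ} {N : ℕ} (hN : N ≤ 5) (h : ∀ k : Fin 5, N ≤ k.val → γ k = 0)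
    (n : ℕ) : EI γ n = EI (fun k : Fin N => γ (Fin.castLE hN k)) n :=
  sum_castLE_of_eq_zero hN (fun k c => (-Complex.I) ^ (k + 1) * c * (n : ℂ) ^ (k + 1))
    (fun _ => by simp) γ h

theorem EII_castLE {γ : Fin 5 → ℂ} {N : ℕ} (hN : N ≤ 5) (h : ∀ k : Fin 5, N ≤ k.val → γ k = 0)
    (n : ℕ) : EII γ n = EII (fun k : Fin N => γ (Fin.castLE hN k)) n :=
  sum_castLE_of_eq_zero hN (fun k c => Complex.I ^ (k + 1) * c * ((n : ℂ) + 2) ^ (k + 1))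
    (fun _ => by simp) γ h

end Zernike
end

theorem mainTheorem7 :
    (∀ γ : Fin 5 → ℂ,
      -- the symmetries, their form, their order and their dependence relation
      (⁅angMom, ham γ⁆ = 0 ∧ ⁅symIPrime γ, ham γ⁆ = 0 ∧ ⁅symI γ, ham γ⁆ = 0) ∧
      ham γ = symI γ + symIPrime γ - (4 * γ 3) • angMom ^ 2 + γ 3 • angMom ^ 4 ∧
      (symIPrime γ - p₁ ^ 2 ∈ gradeZero 5 ∧ symI γ - p₂ ^ 2 ∈ gradeZero 5) ∧
      (symIPrime γ ∈ orderLE 5 ∧ symI γ ∈ orderLE 5) ∧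
      (γ 4 ≠ 0 → symIPrime γ ∉ orderLE 4 ∧ symI γ ∉ orderLE 4) ∧
      (AlgIndep (ham γ) angMom (symI γ) ∧ AlgIndep (ham γ) angMom (symIPrime γ)) ∧
      -- the number and ladder operators and the factorized structure function
      (⁅numK, raiseK γ⁆ = raiseK γ ∧ ⁅numK, lowerK γ⁆ = -lowerK γ ∧
        ⁅lowerK γ, raiseK γ⁆ = Phi γ (ham γ) (numK + 1) - Phi γ (ham γ) numK ∧
        raiseK γ * lowerK γ = Phi γ (ham γ) numK ∧
        Phi γ (ham γ) numK = Phi1 γ (ham γ) numK * Phi2 γ (ham γ) numK ∧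
        ⁅Phi1 γ (ham γ) numK, Phi2 γ (ham γ) numK⁆ = 0) ∧
      (Phi1 γ (ham γ) numK = (1 / 4 : ℂ) • (ham γ - (2 * Complex.I * γ 0) • numK
          + (4 * γ 1) • numK ^ 2 + (8 * Complex.I * γ 2) • numK ^ 3
          - (16 * γ 3) • numK ^ 4 - (32 * Complex.I * γ 4) • numK ^ 5) ∧
        Phi2 γ (ham γ) numK = ham γ + (2 * Complex.I * γ 0) • (numK - 1)
          + (4 * γ 1) • (numK - 1) ^ 2 - (8 * Complex.I * γ 2) • (numK - 1) ^ 3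
          - (16 * γ 3) • (numK - 1) ^ 4 + (32 * Complex.I * γ 4) • (numK - 1) ^ 5) ∧
      -- the ninth-order polynomial algebra
      (∃ c : Fin 5 → Polynomial ℂ,
        (∀ j, (c j).natDegree ≤ 1) ∧ c 4 = Polynomial.C (2560 * γ 4 ^ 2) ∧
        ⁅lowerK γ, raiseK γ⁆ =
          ∑ j : Fin 5, Polynomial.aeval (ham γ) (c j) * numK ^ (2 * j.val + 1) ∧
        ⁅K1, K2 γ⁆ = K3 γ ∧
        ⁅K1, K3 γ⁆ = (4 : ℂ) • K2 γ - (2 * (γ 1 - 4 * γ 3)) • K1 ^ 2 ∧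
        ⁅K2 γ, K3 γ⁆ =
          ∑ j : Fin 5, Polynomial.aeval (ham γ) (c j) * ((1 / 2 : ℂ) • K1) ^ (2 * j.val + 1)
          + (4 * (γ 1 - 4 * γ 3)) • (K1 * K2 γ) - (2 * (γ 1 - 4 * γ 3)) • K3 γ
          - (2 * (γ 1 - 4 * γ 3) ^ 2) • K1 ^ 3) ∧
      -- the deformed oscillator algebra, for every constant `u`
      (∀ (u : ℂ) (B : Op), B = numK - u • (1 : Op) →
        ⁅B, raiseK γ⁆ = raiseK γ ∧ ⁅B, lowerK γ⁆ = -lowerK γ ∧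
        ⁅lowerK γ, raiseK γ⁆ =
          Phi γ (ham γ) (B + (u + 1) • (1 : Op)) - Phi γ (ham γ) (B + u • (1 : Op)) ∧
        raiseK γ * lowerK γ = Phi γ (ham γ) (B + u • (1 : Op))) ∧
      -- the spectral conditions are those of the representations of dimension `n + 1`
      (∀ (n : ℕ), 1 ≤ n → ∀ u E : ℂ, SpecEqs γ n u E ↔ HasOscillatorRep γ n u E) ∧
      -- the solutions of types I and II
      (∀ n : ℕ, 1 ≤ n →
        SpecEqs γ n (-(n : ℂ) / 2) (EI γ n) ∧ SpecEqs γ n (-(n : ℂ) / 2) (EII γ n) ∧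
        EI γ n = -(Complex.I * γ 0 * n + γ 1 * n ^ 2 - Complex.I * γ 2 * n ^ 3
          - γ 3 * n ^ 4 + Complex.I * γ 4 * n ^ 5) ∧
        EII γ n = Complex.I * γ 0 * (n + 2) - γ 1 * (n + 2) ^ 2
          - Complex.I * γ 2 * (n + 2) ^ 3 + γ 3 * (n + 2) ^ 4
          + Complex.I * γ 4 * (n + 2) ^ 5 ∧
        (∀ B : ℂ, Phi γ (EI γ n) (B + -(n : ℂ) / 2) = PhiI γ n B ∧
          Phi γ (EII γ n) (B + -(n : ℂ) / 2) = PhiII γ n B)) ∧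
      -- compatibility with the lower-order systems
      (∀ (N : ℕ) (hN : N ≤ 5), (∀ k : Fin 5, N ≤ k.val → γ k = 0) →
        ham γ = ham (fun k : Fin N => γ (Fin.castLE hN k)) ∧
        ∀ n : ℕ, EI γ n = EI (fun k : Fin N => γ (Fin.castLE hN k)) n ∧
          EII γ n = EII (fun k : Fin N => γ (Fin.castLE hN k)) n)) ∧
    -- types I and II are the only solutions that hold for all complex coefficients,
    -- with continuous dependence on them
    (∀ n : ℕ, 1 ≤ n → ∀ u E : (Fin 5 → ℂ) → ℂ, Continuous u → Continuous E →
      ((∀ γ, SpecEqs γ n (u γ) (E γ)) ↔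
        ((∀ γ, u γ = -(n : ℂ) / 2 ∧ E γ = EI γ n) ∨
         (∀ γ, u γ = -(n : ℂ) / 2 ∧ E γ = EII γ n)))) ∧
    -- the same when each coefficient runs through the real or the imaginary axis,
    -- with real-analytic dependence
    (∀ θ : Fin 5 → ℂ, (∀ k, θ k = 1 ∨ θ k = Complex.I) →
      ∀ n : ℕ, 1 ≤ n → ∀ u E : (Fin 5 → ℝ) → ℂ,
        AnalyticOnNhd ℝ u Set.univ → AnalyticOnNhd ℝ E Set.univ →
        ((∀ t, SpecEqs (fun k => θ k * (t k : ℂ)) n (u t) (E t)) ↔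
          ((∀ t, u t = -(n : ℂ) / 2 ∧ E t = EI (fun k => θ k * (t k : ℂ)) n) ∨
           (∀ t, u t = -(n : ℂ) / 2 ∧ E t = EII (fun k => θ k * (t k : ℂ)) n)))) := by
  refine ⟨fun γ => ⟨?_, ?_, ?_, ?_, ?_, ?_, ?_, ?_, ?_, ?_, ?_, ?_, ?_⟩, ?_, ?_⟩
  · rw [symIPrime_eq_weylOp, symI_eq_weylOp, ham_eq_weylOp]
    exact ⟨(commute_iff_lie_eq (x := weylOp.ang)).1 (weylOp.ang_mul_ham γ),
      weylOp.lie_symIPrime_ham γ, weylOp.lie_symI_ham γ⟩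
  · rw [symIPrime_eq_weylOp, symI_eq_weylOp, ham_eq_weylOp]
    exact weylOp.ham_eq_symI_add γ
  · rw [symIPrime_eq_weylOp, symI_eq_weylOp]
    exact ⟨weylOp.symIPrime_sub_mem γ, weylOp.symI_sub_mem γ⟩
  · rw [symIPrime_eq_weylOp, symI_eq_weylOp]
    exact ⟨weylOp.symIPrime_mem_orderLE γ, weylOp.symI_mem_orderLE γ⟩
  · exact fun h => ⟨symIPrime_notMem_orderLE h, symI_notMem_orderLE h⟩
  · rw [symIPrime_eq_weylOp, symI_eq_weylOp, ham_eq_weylOp]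
    exact ⟨algIndep_symI γ, algIndep_symIPrime γ⟩
  · obtain ⟨h1, h2, h3, h4, h5⟩ := numK_ladder_relations γ
    exact ⟨h1, h2, h3, h4, rfl, h5⟩
  · exact ⟨Phi1_expand γ _ _, Phi2_expand γ _ _⟩
  · exact ⟨structurePoly γ, natDegree_structurePoly γ, structurePoly_four γ,
      lie_lowerK_raiseK γ, rfl, lie_K1_K3 γ, lie_K2_K3 γ⟩
  · exact shifted_numK_ladder_relations γ
  · exact fun n _ => specEqs_iff_hasOscillatorRep γ n
  · exact fun n _ => ⟨specEqs_EI γ n, specEqs_EII γ n, EI_expand n γ, EII_expand n γ,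
      fun B => ⟨Phi_EI γ n B, Phi_EII γ n B⟩⟩
  · exact fun N hN h => ⟨ham_castLE hN h, fun n => ⟨EI_castLE hN h n, EII_castLE hN h n⟩⟩
  · exact fun n _ => continuous_solutions
  · intro θ hθ n _
    refine analytic_solutions θ ?_
    rcases hθ 0 with h | h
    · rw [h]
      exact one_ne_zero
    · rw [h]
      exact Complex.I_ne_zero
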